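/- Let $D\ge 3$ be an odd integer. For a non-zero binary form $F(X,Y)\in\mathbb{Z}[X,Y]$ of degree $D$ let $\|F\|$ denote the maximum modulus of the coefficients of $F$, and for real $U,V\ge 1$ let $\mu_F(U,V)$ be the number of pairs of integers $x\in[-U,U]$ and $y\in[-V,V]$ for which $F(x,y)$ is a non-zero square. There are constants $C_D,C'_D>0$ depending only on $D$ such that, for every non-zero form $F(X,Y)\in\mathbb{Z}[X,Y]$ of degree $D$ having no repeated factor (that is, not divisible in $\mathbb{Q}[X,Y]$ by the square of a non-constant polynomial), and for all real $U,V\ge 1$, one has \[\mu_F(U,V)\le C_D\left\{(UV)^{2/3}\bigl(\log(2\|F\|)\bigr)^2+U+V\right\}\] and moreover \[\mu_F(U,V)\le C'_D\,(UV)^{2/3}\bigl(\log(2\|F\|)\bigr)^2.\] -/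

import Mathlib

/-- The maximum modulus `‖F‖` of the coefficients of an integer polynomial in two variables. -/
def maxCoeff (F : MvPolynomial (Fin 2) ℤ) : ℕ :=
  F.support.sup fun m => (F.coeff m).natAbs

/-- A polynomial has no repeated factor if it is squarefree over `ℚ`, so that constant factors,
being units, play no role. -/
def HasNoRepeatedFactor (F : MvPolynomial (Fin 2) ℤ) : Prop :=
  Squarefree (MvPolynomial.map (Int.castRingHom ℚ) F)

/-- The pairs of integers `x ∈ [-U, U]`, `y ∈ [-V, V]` for which `F(x, y)` is a non-zero square. -/
def nonzeroSquarePoints (F : MvPolynomial (Fin 2) ℤ) (U V : ℝ) : Set (ℤ × ℤ) :=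
  {p | (p.1 : ℝ) ∈ Set.Icc (-U) U ∧ (p.2 : ℝ) ∈ Set.Icc (-V) V ∧
    MvPolynomial.eval ![p.1, p.2] F ≠ 0 ∧ IsSquare (MvPolynomial.eval ![p.1, p.2] F)}

theorem nonzeroSquarePoints_finite (F : MvPolynomial (Fin 2) ℤ) (U V : ℝ) :
    (nonzeroSquarePoints F U V).Finite := by
  refine ((Set.finite_Icc ⌈-U⌉ ⌊U⌋).prod (Set.finite_Icc ⌈-V⌉ ⌊V⌋)).subset ?_
  rintro ⟨x, y⟩ ⟨hx, hy, -, -⟩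
  exact ⟨⟨Int.ceil_le.2 hx.1, Int.le_floor.2 hx.2⟩, ⟨Int.ceil_le.2 hy.1, Int.le_floor.2 hy.2⟩⟩

/-- The number `μ(U, V)` of such pairs. -/
noncomputable def nonzeroSquareCount (F : MvPolynomial (Fin 2) ℤ) (U V : ℝ) : ℕ :=
  (nonzeroSquarePoints F U V).ncard

/-!
# Square values of binary forms of odd degree

The bound comes from a square sieve with moduli `k * p`, where `p` is a prime, `k` is squarefree,
and `k * p ≤ R = (U V) ^ (1 / 3)`. The second bound implies the first one, and by symmetry `V ≤ U`.

*Local functions.* For a prime `r` of good reduction, the function which is `1` or `-1` according to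
whether `F(x, y)` is a square modulo `r` has small mean on each row `y`. This is Weil's bound for
quadratic character sums, `abs_sum_quadraticChar_le`, which is proved by Stepanov's method. With its
row means removed, and renormalized to be `1` at squares, the function has mean zero on the rows,
mean square `1 + O(1 / √r)`, and Fourier coefficients whose absolute values, summed over the second
frequency, give at most `1 + O(1 / √r)`. The last point uses that `F` is homogeneous of odd degree,
which reduces it to Parseval's identity; without the renormalization all Fourier coefficients are
`O(1 / r)`, by square root cancellation in both variables.

*Sieve.* At a point where `F` is a square, each product of these functions over the primes dividing
`k * p`, renormalized at the primes dividing `k` only, is at least `1 / 2`. The sum of the products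
is squared and summed with smooth weights over the box. The products for two moduli with the same
`p` and different `k` are orthogonal. If the primes `p` differ, the Fourier coefficients of the
factors at `k` are majorized by those of a multiple of `k * 1_{k ∣ x}`; since the Fourier transforms
of the weights are nonnegative, the sum is bounded by `O(R ^ 2)` on average
(`norm_sum_mul_le_of_isMajorized`, `abs_sum_liftProd_le`). The result is
`|A| |M| ^ 2 ≪ U V R + R ^ 4` for the set `A` of points and the set `M` of moduli
(`card_mul_card_sq_le`).

*Moduli.* Primes alone would be too few by a logarithm. The moduli `k * p` with `k` up to a small
power of `R` are `≫ R / (1 + ω)` in number, if `ω` primes have to be avoided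
(`log_le_sum_sievingNumbers`), which gives `|A| ≪ (1 + ω) ^ 2 (U V) ^ (2 / 3)`. Apart from a number
of primes depending on the degree, these are divisors of the leading coefficient of `F(X, 1)` or of
its resultant with its derivative, so that `ω ≪ log (2 ‖F‖)` (`exists_bad_primes`).

*Degenerate rows.* If `Y` divides `F`, then `F` vanishes on the row `y = 0` modulo every prime `r`,
and this row carries no information. But if `F(x, y)` is a square and `r ∣ y` for a prime `r` of
good reduction, then `r ∣ x` or `r ^ 2 ∣ y`, because `F` is not divisible by `Y ^ 2`, even modulo
`r`. These points come from a similar problem in a box of area smaller by `r ^ 2`, and an induction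
disposes of them (`exists_card_le_of_coeff_eq_zero`).
-/

/-! ### Weil's bound for quadratic character sums, by Stepanov's method -/

open Polynomial in
/-- The remainder factor `D_k u` in `(f ^ n * u) ^ (k) = f ^ (n - k) * D_k u`, for `k ≤ n`. It is
linear in `u` and raises degrees by at most `k * (deg f - 1)`. -/
noncomputable def stepanovDeriv {K : Type*} [Field K] (f : K[X]) (n : ℕ) : ℕ → K[X] →ₗ[K] K[X]
  | 0 => LinearMap.id
  | k + 1 => (LinearMap.mulLeft K f ∘ₗ derivative +
      LinearMap.mulLeft K (((n - k : ℕ) : K[X]) * derivative f)) ∘ₗ stepanovDeriv f n k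

section Stepanov

open Polynomial

theorem iterate_derivative_pow_mul {K : Type*} [Field K] (f u h : K[X]) (hh : derivative h = 0)
    (n k : ℕ) (hk : k ≤ n) :
    derivative^[k] (f ^ n * u * h) = f ^ (n - k) * stepanovDeriv f n k u * h := by
  induction k with
  | zero => simp [stepanovDeriv]
  | succ k ih =>
    rw [Function.iterate_succ_apply', ih (by omega)]
    obtain ⟨j, hj⟩ : ∃ j, n - k = j + 1 := ⟨n - k - 1, by omega⟩
    have hj' : n - (k + 1) = j := by omega
    simp only [stepanovDeriv, LinearMap.comp_apply, LinearMap.add_apply, LinearMap.mulLeft_apply,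
      derivative_mul, hh, hj, hj', derivative_pow, Nat.add_sub_cancel]
    simp only [map_natCast]
    ring

theorem natDegree_stepanovDeriv_le {K : Type*} [Field K] (f : K[X]) (hf : 1 ≤ f.natDegree)
    (n k d : ℕ) (u : K[X]) (hu : u.natDegree ≤ d) :
    (stepanovDeriv f n k u).natDegree ≤ d + k * (f.natDegree - 1) := by
  induction k with
  | zero => simpa [stepanovDeriv] using hu
  | succ k ih =>
    simp only [stepanovDeriv, LinearMap.comp_apply, LinearMap.add_apply, LinearMap.mulLeft_apply]
    set v := stepanovDeriv f n k u
    have h1 : (f * derivative v).natDegree ≤ d + (k + 1) * (f.natDegree - 1) := by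
      rcases Nat.eq_zero_or_pos v.natDegree with h0 | h0
      · rw [eq_C_of_natDegree_eq_zero h0]; simp
      · refine natDegree_mul_le.trans ?_
        have := natDegree_derivative_le v
        rw [add_mul]
        omega
    have h2 : (((n - k : ℕ) : K[X]) * derivative f * v).natDegree ≤
        d + (k + 1) * (f.natDegree - 1) := by
      refine natDegree_mul_le.trans ?_
      have h3 : (((n - k : ℕ) : K[X]) * derivative f).natDegree ≤ f.natDegree - 1 := by
        refine natDegree_mul_le.trans ?_
        have := natDegree_derivative_le f
        rw [natDegree_natCast]
        omega
      rw [add_mul]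
      omega
    exact natDegree_add_le_of_degree_le h1 h2

variable {p : ℕ} [Fact p.Prime]

/-- The auxiliary polynomial of Stepanov's method vanishes only if all its ingredients do. -/
theorem stepanov_independent (f : (ZMod p)[X]) (c d : ℕ) (hc : p = 2 * c + 1)
    (hf0 : f.coeff 0 ≠ 0)
    (hns : ∀ (a : ZMod p) (r s : (ZMod p)[X]), f * r ^ 2 = C a * s ^ 2 → r = 0)
    (hd : 2 * d + f.natDegree < p) (J : ℕ) :
    ∀ r s : ℕ → (ZMod p)[X], (∀ j, (r j).natDegree ≤ d) → (∀ j, (s j).natDegree ≤ d) →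
      ∑ j ∈ Finset.range J, (r j + s j * f ^ c) * X ^ (j * p) = 0 →
      ∀ j < J, r j = 0 ∧ s j = 0 := by
  induction J with
  | zero => intro r s _ _ _ j hj; omega
  | succ J ih =>
    intro r s hr hs h
    have hX : (X : (ZMod p)[X]) ^ p ≠ 0 := pow_ne_zero _ X_ne_zero
    rw [Finset.sum_range_succ'] at h
    have hsplit : ∑ j ∈ Finset.range J, (r (j + 1) + s (j + 1) * f ^ c) * X ^ ((j + 1) * p) =
        X ^ p * ∑ j ∈ Finset.range J, (r (j + 1) + s (j + 1) * f ^ c) * X ^ (j * p) := by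
      rw [Finset.mul_sum]
      refine Finset.sum_congr rfl fun j _ => ?_
      rw [show (j + 1) * p = p + j * p by ring, pow_add]
      ring
    rw [hsplit] at h
    simp only [zero_mul, pow_zero, mul_one] at h
    obtain ⟨T, hT⟩ : ∃ T, T = ∑ j ∈ Finset.range J,
      (r (j + 1) + s (j + 1) * f ^ c) * X ^ (j * p) := ⟨_, rfl⟩
    rw [← hT] at h
    -- modulo `X ^ p` the polynomial `f ^ p` is the constant `f(0)`, so that the lowest block of the
    -- vanishing sum gives `f * r₀ ^ 2 = f(0) * s₀ ^ 2` up to multiples of `X ^ p`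
    have hfp : f ^ p = C (f.coeff 0) + X ^ p * (divX f) ^ p := by
      conv_lhs => rw [← divX_mul_X_add f]
      rw [add_pow_char, mul_pow, ← C_pow, ZMod.pow_card]
      ring
    have hdvd : X ^ p ∣ f * (r 0) ^ 2 - C (f.coeff 0) * (s 0) ^ 2 := by
      refine ⟨(divX f) ^ p * (s 0) ^ 2 - f * T * (r 0 - s 0 * f ^ c), ?_⟩
      have h1 : r 0 + s 0 * f ^ c = - (X ^ p * T) := by linear_combination h
      have h2 : f * (r 0) ^ 2 - f ^ p * (s 0) ^ 2 =
          f * (r 0 + s 0 * f ^ c) * (r 0 - s 0 * f ^ c) := by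
        have : f ^ p = f * (f ^ c) ^ 2 := by
          rw [← pow_mul, ← pow_succ']
          congr 1
          omega
        rw [this]; ring
      rw [h1] at h2
      rw [hfp] at h2
      linear_combination h2
    have hz : f * (r 0) ^ 2 - C (f.coeff 0) * (s 0) ^ 2 = 0 := by
      refine eq_zero_of_dvd_of_natDegree_lt hdvd ?_
      rw [natDegree_X_pow]
      refine lt_of_le_of_lt (natDegree_sub_le_of_le (m := 2 * d + f.natDegree)
        (n := 2 * d + f.natDegree) ?_ ?_) ?_
      · refine natDegree_mul_le.trans ?_
        have := natDegree_pow_le (p := r 0) (n := 2)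
        have := hr 0
        omega
      · refine (natDegree_C_mul_le _ _).trans ?_
        have := natDegree_pow_le (p := s 0) (n := 2)
        have := hs 0
        omega
      · simpa using hd
    have hr0 : r 0 = 0 := hns _ _ _ (sub_eq_zero.1 hz)
    have hs0 : s 0 = 0 := by
      rw [hr0] at hz
      have : C (f.coeff 0) * (s 0) ^ 2 = 0 := by linear_combination -hz
      rcases mul_eq_zero.1 this with h' | h'
      · exact absurd (C_eq_zero.1 h') hf0
      · exact pow_eq_zero_iff (by norm_num) |>.1 h'
    rw [hr0, hs0] at h
    have hT0 : T = 0 := by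
      have : X ^ p * T = 0 := by linear_combination h
      exact (mul_eq_zero.1 this).resolve_left hX
    have key := ih (fun j => r (j + 1)) (fun j => s (j + 1)) (fun j => hr _) (fun j => hs _)
      (hT ▸ hT0)
    intro j hj
    rcases j with _ | j
    · exact ⟨hr0, hs0⟩
    · exact key j (by omega)

/-- Stepanov's upper bound for the number of points where `f ^ ((p - 1) / 2)` takes the value `a`,
in terms of the parameters `ℓ` (the order of vanishing) and `J` of the auxiliary polynomial. -/
theorem stepanov_card_le (f : (ZMod p)[X]) (c d ℓ J : ℕ) (hc : p = 2 * c + 1)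
    (hm : 1 ≤ f.natDegree) (hf0 : f.coeff 0 ≠ 0)
    (hns : ∀ (a : ZMod p) (r s : (ZMod p)[X]), f * r ^ 2 = C a * s ^ 2 → r = 0)
    (hd : 2 * d + f.natDegree < p) (hℓ : ℓ ≤ p)
    (hdim : ℓ * (d + ℓ * (f.natDegree - 1) + J) < 2 * J * (d + 1)) (a : ZMod p)
    (S : Finset (ZMod p)) (hS : ∀ x ∈ S, f.eval x ^ c = a) :
    ℓ * S.card ≤ (ℓ + c) * f.natDegree + d + J * p := by
  classical
  set m := f.natDegree with hmdef
  set e := d + ℓ * (m - 1) + J with he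
  -- `P` turns a vector of coefficients into a polynomial of degree at most `d`
  let P : (Fin (d + 1) → ZMod p) →ₗ[ZMod p] (ZMod p)[X] :=
    ∑ i : Fin (d + 1), (monomial (i : ℕ)).comp (LinearMap.proj i)
  have hPdef : ∀ u, P u = ∑ i : Fin (d + 1), monomial (i : ℕ) (u i) := by
    intro u; simp [P]
  have hPdeg : ∀ u, (P u).natDegree ≤ d := by
    intro u
    rw [hPdef]
    refine natDegree_sum_le_of_forall_le _ _ fun i _ => ?_
    exact (natDegree_monomial_le _).trans (by omega)
  have hPinj : ∀ u, P u = 0 → u = 0 := by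
    intro u hu
    funext i
    have h1 := congrArg (fun q => coeff q (i : ℕ)) hu
    simp only [hPdef, finsetSum_coeff, coeff_monomial, coeff_zero] at h1
    rw [Finset.sum_eq_single i] at h1
    · simpa using h1
    · intro b _ hb
      rw [if_neg]
      exact fun h => hb (Fin.ext h)
    · simp
  let V := (Fin J → Fin (d + 1) → ZMod p) × (Fin J → Fin (d + 1) → ZMod p)
  -- `Q k v` takes the value of the `k`-th derivative of the auxiliary polynomial, up to a power of
  -- `f`, at all points `x` where `f x ^ c = a`, since `x ^ p = x` there
  let Q (k : ℕ) : V →ₗ[ZMod p] (ZMod p)[X] := ∑ j : Fin J,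
    (LinearMap.mulRight (ZMod p) (X ^ (j : ℕ)) ∘ₗ
      (stepanovDeriv f ℓ k ∘ₗ P ∘ₗ LinearMap.proj j ∘ₗ LinearMap.fst _ _ _ +
       LinearMap.mulLeft (ZMod p) (C a) ∘ₗ stepanovDeriv f (ℓ + c) k ∘ₗ P ∘ₗ LinearMap.proj j ∘ₗ
        LinearMap.snd _ _ _))
  have hQ : ∀ k (v : V), Q k v = ∑ j : Fin J, (stepanovDeriv f ℓ k (P (v.1 j)) +
      C a * stepanovDeriv f (ℓ + c) k (P (v.2 j))) * X ^ (j : ℕ) := by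
    intro k v; simp [Q]; rfl
  let Φ : V →ₗ[ZMod p] (Fin ℓ → Fin e → ZMod p) :=
    LinearMap.pi fun k => LinearMap.pi fun i => lcoeff (ZMod p) (i : ℕ) ∘ₗ Q k
  -- fewer conditions than coefficients, so that all `Q k` vanish for some nonzero `v`
  have hker : LinearMap.ker Φ ≠ ⊥ := by
    apply LinearMap.ker_ne_bot_of_finrank_lt
    simp only [V, Module.finrank_prod, Module.finrank_pi_fintype, Module.finrank_self,
      Finset.sum_const, Finset.card_univ, Fintype.card_fin, smul_eq_mul, mul_one]
    calc ℓ * e < 2 * J * (d + 1) := hdim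
      _ = _ := by ring
  obtain ⟨v, hv, hv0⟩ := Submodule.exists_mem_ne_zero_of_ne_bot hker
  have hQ0 : ∀ k < ℓ, Q k v = 0 := by
    intro k hk
    have hdeg : (Q k v).natDegree < e ∨ e = 0 := by
      rcases Nat.eq_zero_or_pos e with h0 | h0
      · exact Or.inr h0
      left
      rcases Nat.eq_zero_or_pos J with hJ | hJ
      · subst hJ; simp at hdim
      have : (Q k v).natDegree ≤ d + (ℓ * (m - 1)) + (J - 1) := by
        rw [hQ]
        refine natDegree_sum_le_of_forall_le _ _ fun j _ => ?_
        refine natDegree_mul_le.trans ?_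
        rw [natDegree_X_pow]
        have hk' : k * (m - 1) ≤ ℓ * (m - 1) := Nat.mul_le_mul_right _ hk.le
        have h1 : (stepanovDeriv f ℓ k (P (v.1 j)) +
            C a * stepanovDeriv f (ℓ + c) k (P (v.2 j))).natDegree ≤ d + ℓ * (m - 1) := by
          refine natDegree_add_le_of_degree_le ?_ ((natDegree_C_mul_le _ _).trans ?_)
          · exact (natDegree_stepanovDeriv_le f hm _ _ d _ (hPdeg _)).trans (by rw [← hmdef]; omega)
          · exact (natDegree_stepanovDeriv_le f hm _ _ d _ (hPdeg _)).trans (by rw [← hmdef]; omega)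
        have := j.2
        omega
      omega
    ext i
    rcases hdeg with hdeg | h0
    · rcases lt_or_ge i e with hi | hi
      · have := congrFun (congrFun (LinearMap.mem_ker.1 hv) ⟨k, hk⟩) ⟨i, hi⟩
        simpa [Φ] using this
      · rw [coeff_eq_zero_of_natDegree_lt (by omega), coeff_zero]
    · have hJ : J = 0 := by omega
      subst hJ; simp at hdim
  let r : ℕ → (ZMod p)[X] := fun j => if h : j < J then P (v.1 ⟨j, h⟩) else 0
  let s : ℕ → (ZMod p)[X] := fun j => if h : j < J then P (v.2 ⟨j, h⟩) else 0
  have hr : ∀ j, (r j).natDegree ≤ d := by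
    intro j; by_cases h : j < J
    · simp only [r, h, dif_pos]; exact hPdeg _
    · simp [r, h]
  have hs : ∀ j, (s j).natDegree ≤ d := by
    intro j; by_cases h : j < J
    · simp only [s, h, dif_pos]; exact hPdeg _
    · simp [s, h]
  -- the auxiliary polynomial is `f ^ ℓ * A`
  set A := ∑ j ∈ Finset.range J, (r j + s j * f ^ c) * X ^ (j * p) with hA
  have hA0 : A ≠ 0 := by
    intro h0
    have := stepanov_independent f c d hc hf0 hns hd J r s hr hs h0
    apply hv0
    refine Prod.ext ?_ ?_
    · funext j
      refine hPinj _ ?_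
      have := (this j j.2).1
      simpa [r, j.2] using this
    · funext j
      refine hPinj _ ?_
      have := (this j j.2).2
      simpa [s, j.2] using this
  have hfne : f ≠ 0 := by rintro rfl; simp at hf0
  have hR0 : f ^ ℓ * A ≠ 0 := mul_ne_zero (pow_ne_zero _ hfne) hA0
  have hdX : ∀ j : ℕ, derivative ((X : (ZMod p)[X]) ^ (j * p)) = 0 := by
    intro j
    rw [derivative_X_pow]
    simp
  have hderiv : ∀ k < ℓ, ∀ x ∈ S, (derivative^[k] (f ^ ℓ * A)).IsRoot x := by
    intro k hk x hx
    have hsum : f ^ ℓ * A = ∑ j ∈ Finset.range J,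
        (f ^ ℓ * r j * X ^ (j * p) + f ^ (ℓ + c) * s j * X ^ (j * p)) := by
      rw [hA, Finset.mul_sum]
      refine Finset.sum_congr rfl fun j _ => ?_
      rw [pow_add]; ring
    rw [hsum, iterate_derivative_sum, IsRoot.def, eval_finsetSum]
    have hterm : ∀ j ∈ Finset.range J, eval x (derivative^[k]
        (f ^ ℓ * r j * X ^ (j * p) + f ^ (ℓ + c) * s j * X ^ (j * p))) =
        f.eval x ^ (ℓ - k) * eval x ((stepanovDeriv f ℓ k (r j) +
          C a * stepanovDeriv f (ℓ + c) k (s j)) * X ^ j) := by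
      intro j _
      rw [iterate_map_add, iterate_derivative_pow_mul f _ _ (hdX j) ℓ k hk.le,
        iterate_derivative_pow_mul f _ _ (hdX j) (ℓ + c) k (by omega)]
      have hx' : x ^ (j * p) = x ^ j := by rw [mul_comm, pow_mul, ZMod.pow_card]
      have hsub : ℓ + c - k = (ℓ - k) + c := by omega
      simp only [eval_add, eval_mul, eval_pow, eval_X, eval_C, hx', hsub, pow_add, hS x hx]
      ring
    rw [Finset.sum_congr rfl hterm, ← Finset.mul_sum, ← eval_finsetSum]
    have : ∑ j ∈ Finset.range J, (stepanovDeriv f ℓ k (r j) +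
          C a * stepanovDeriv f (ℓ + c) k (s j)) * X ^ j = Q k v := by
      rw [hQ, ← Fin.sum_univ_eq_sum_range (fun j => (stepanovDeriv f ℓ k (r j) +
          C a * stepanovDeriv f (ℓ + c) k (s j)) * X ^ j) J]
      refine Finset.sum_congr rfl fun j _ => ?_
      simp [r, s]
    rw [this, hQ0 k hk]
    simp
  rcases Nat.eq_zero_or_pos ℓ with h0 | hℓ0
  · simp [h0]
  -- as `ℓ ≤ p`, the factorials up to `ℓ - 1` are invertible and derivatives detect multiplicities
  have hmult : ∀ x ∈ S, ℓ ≤ (f ^ ℓ * A).rootMultiplicity x := by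
    intro x hx
    have := lt_rootMultiplicity_of_isRoot_iterate_derivative_of_mem_nonZeroDivisors (n := ℓ - 1)
      hR0 (fun k hk => hderiv k (by omega) x hx) (by
        apply mem_nonZeroDivisors_of_ne_zero
        rw [Ne, ZMod.natCast_eq_zero_iff, (Fact.out : p.Prime).dvd_factorial]
        omega)
    omega
  calc ℓ * S.card = ∑ x ∈ S, ℓ := by simp [mul_comm]
    _ ≤ ∑ x ∈ S, (f ^ ℓ * A).roots.count x := by
        refine Finset.sum_le_sum fun x hx => ?_
        rw [count_roots]; exact hmult x hx
    _ ≤ (f ^ ℓ * A).roots.card := by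
        rw [← Multiset.toFinset_sum_count_eq]
        refine Finset.sum_le_sum_of_ne_zero fun x _ hx => ?_
        exact Multiset.mem_toFinset.2 (Multiset.count_ne_zero.1 hx)
    _ ≤ (f ^ ℓ * A).natDegree := card_roots' _
    _ ≤ (ℓ + c) * m + d + J * p := by
        refine natDegree_mul_le.trans ?_
        have h1 : (f ^ ℓ).natDegree ≤ ℓ * m := natDegree_pow_le
        have h2 : A.natDegree ≤ d + c * m + J * p := by
          refine natDegree_sum_le_of_forall_le _ _ fun j hj => ?_
          refine natDegree_mul_le.trans ?_
          rw [natDegree_X_pow]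
          have h3 : (r j + s j * f ^ c).natDegree ≤ d + c * m := by
            refine natDegree_add_le_of_degree_le ((hr j).trans (by omega)) ?_
            refine natDegree_mul_le.trans ?_
            have h4 : (f ^ c).natDegree ≤ c * m := natDegree_pow_le
            have := hs j
            omega
          have h5 : j * p ≤ J * p := Nat.mul_le_mul_right _ (Finset.mem_range.1 hj).le
          omega
        rw [add_mul]
        omega

/-- Stepanov's bound with `ℓ` close to `√p` and `J` close to `ℓ / 2`. -/
theorem stepanov_card_le_sqrt (f : (ZMod p)[X]) (hp2 : p ≠ 2)
    (hm : 1 ≤ f.natDegree) (hp : 16 * (f.natDegree + 1) ^ 2 ≤ p) (hf0 : f.coeff 0 ≠ 0)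
    (hns : ∀ (a : ZMod p) (r s : (ZMod p)[X]), f * r ^ 2 = C a * s ^ 2 → r = 0)
    (a : ZMod p) (S : Finset (ZMod p)) (hS : ∀ x ∈ S, f.eval x ^ (p / 2) = a) :
    (S.card : ℝ) ≤ p / 2 + 4 * (f.natDegree + 1) * √p := by
  set m := f.natDegree with hmdef
  obtain ⟨c, hc⟩ := (Fact.out : p.Prime).odd_of_ne_two hp2
  have hc2 : p / 2 = c := by omega
  rw [hc2] at hS
  set ℓ := Nat.sqrt p with hℓdef
  have hℓ1 : ℓ * ℓ ≤ p := Nat.sqrt_le p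
  have hℓ2 : p < (ℓ + 1) * (ℓ + 1) := Nat.lt_succ_sqrt p
  have hℓ4 : 4 * (m + 1) ≤ ℓ := by
    rw [hℓdef, Nat.le_sqrt]; nlinarith
  obtain ⟨d, hd⟩ : ∃ d, c = d + m + 1 := by
    have : m + 1 ≤ c := by nlinarith
    exact ⟨c - m - 1, by omega⟩
  obtain ⟨J, hJ⟩ : ∃ J, J = ℓ / 2 + m + 1 := ⟨_, rfl⟩
  obtain ⟨m', hm'⟩ : ∃ m', m = m' + 1 := ⟨m - 1, by omega⟩
  have hJ1 : ℓ + 2 * m + 1 ≤ 2 * J := by omega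
  have hJ2 : 2 * J ≤ ℓ + 2 * m + 2 := by omega
  have hdim : ℓ * (d + ℓ * (m - 1) + J) < 2 * J * (d + 1) := by
    have e1 : m - 1 = m' := by omega
    rw [e1]
    have h1 : (ℓ + 2 * m + 1) * (d + 1) ≤ 2 * J * (d + 1) := Nat.mul_le_mul_right _ hJ1
    have h2 : ℓ * (2 * J) ≤ ℓ * (ℓ + 2 * m + 2) := Nat.mul_le_mul_left _ hJ2
    have h3 : ℓ * ℓ * m' ≤ p * m' := Nat.mul_le_mul_right _ hℓ1
    have h4 : 4 * (m + 1) * ℓ ≤ ℓ * ℓ := Nat.mul_le_mul_right _ hℓ4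
    nlinarith
  have key := stepanov_card_le f c d ℓ J hc hm hf0 hns (by omega) (Nat.sqrt_le_self p) hdim a S hS
  have hpR : (0 : ℝ) < p := by exact_mod_cast (Fact.out : p.Prime).pos
  have hs : √(p : ℝ) * √p = p := Real.mul_self_sqrt hpR.le
  have hs0 : 0 < √(p : ℝ) := Real.sqrt_pos.2 hpR
  have hℓs : √(p : ℝ) ≤ ℓ + 1 := by
    rw [Real.sqrt_le_left (by positivity)]
    have : ((p : ℕ) : ℝ) < (((ℓ + 1) * (ℓ + 1) : ℕ) : ℝ) := by exact_mod_cast hℓ2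
    push_cast at this
    nlinarith
  have hℓ8 : (8 : ℝ) ≤ ℓ := by
    have : 8 ≤ ℓ := by omega
    exact_mod_cast this
  have keyR : (ℓ : ℝ) * S.card ≤ (ℓ + c) * m + d + J * p := by exact_mod_cast key
  have hcR : (c : ℝ) ≤ p / 2 := by
    have : (2 * c + 1 : ℝ) = p := by exact_mod_cast hc.symm
    linarith
  have hdR : (d : ℝ) ≤ p / 2 := by
    have : (d : ℝ) ≤ c := by exact_mod_cast (by omega : d ≤ c)
    linarith
  have hJR : (2 : ℝ) * J ≤ ℓ + 2 * m + 2 := by exact_mod_cast hJ2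
  have hm0 : (1 : ℝ) ≤ m := by exact_mod_cast hm
  have hℓp : (ℓ : ℝ) * ℓ ≤ p := by exact_mod_cast hℓ1
  by_contra hcon
  push Not at hcon
  have h5 : (ℓ : ℝ) * (p / 2 + 4 * (m + 1) * √p) < (ℓ + c) * m + d + J * p :=
    lt_of_lt_of_le (mul_lt_mul_of_pos_left hcon (by linarith)) keyR
  have h6 : (8 / 9 : ℝ) * √p ≤ ℓ := by linarith
  have h7 : (c : ℝ) * m ≤ p / 2 * m := by gcongr
  have h8 : (J : ℝ) * p ≤ (ℓ / 2 + m + 1) * p := by gcongr; linarith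
  have h9 : (8 / 9 : ℝ) * p ≤ ℓ * √p := by nlinarith
  have h10 : (8 / 9 : ℝ) * p * (4 * (m + 1)) ≤ ℓ * √p * (4 * (m + 1)) := by gcongr
  have h11 : (ℓ : ℝ) * m ≤ p * m := by
    have : (ℓ : ℝ) ≤ p := by nlinarith
    gcongr
  nlinarith

theorem abs_sum_quadraticChar_le_of_coeff_zero_ne (f : (ZMod p)[X]) (hp2 : p ≠ 2)
    (hm : 1 ≤ f.natDegree) (hf0 : f.coeff 0 ≠ 0)
    (hns : ∀ (a : ZMod p) (r s : (ZMod p)[X]), f * r ^ 2 = C a * s ^ 2 → r = 0) :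
    |∑ x : ZMod p, (quadraticChar (ZMod p) (f.eval x) : ℝ)| ≤ 9 * (f.natDegree + 1) * √p := by
  classical
  set m := f.natDegree with hmdef
  have hpR : (0 : ℝ) < p := by exact_mod_cast (Fact.out : p.Prime).pos
  have hs : √(p : ℝ) * √p = p := Real.mul_self_sqrt hpR.le
  have hs0 : 0 < √(p : ℝ) := Real.sqrt_pos.2 hpR
  have hchar : ringChar (ZMod p) ≠ 2 := by rwa [ZMod.ringChar_zmod_n]
  have hval : ∀ x : ZMod p, quadraticChar (ZMod p) (f.eval x) = 0 ∨
      quadraticChar (ZMod p) (f.eval x) = 1 ∨ quadraticChar (ZMod p) (f.eval x) = -1 := by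
    intro x
    by_cases h : f.eval x = 0
    · left; simp [h]
    · right; exact quadraticChar_dichotomy h
  have hm0 : (1 : ℝ) ≤ m := by exact_mod_cast hm
  rcases lt_or_ge p (16 * (m + 1) ^ 2) with hp | hp
  -- the bound is trivial for small `p`
  · have h1 : |∑ x : ZMod p, (quadraticChar (ZMod p) (f.eval x) : ℝ)| ≤ p := by
      refine (Finset.abs_sum_le_sum_abs _ _).trans ?_
      calc ∑ x : ZMod p, |(quadraticChar (ZMod p) (f.eval x) : ℝ)| ≤ ∑ x : ZMod p, 1 := by
            refine Finset.sum_le_sum fun x _ => ?_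
            rcases hval x with h | h | h <;> simp [h]
        _ = p := by simp [ZMod.card]
    have h2 : √(p : ℝ) ≤ 4 * (m + 1) := by
      rw [Real.sqrt_le_left (by positivity)]
      have : (p : ℝ) < ((16 * (m + 1) ^ 2 : ℕ) : ℝ) := by exact_mod_cast hp
      push_cast at this
      nlinarith
    nlinarith
  · set S1 := Finset.univ.filter fun x : ZMod p => quadraticChar (ZMod p) (f.eval x) = 1
    set S2 := Finset.univ.filter fun x : ZMod p => quadraticChar (ZMod p) (f.eval x) = -1
    set S0 := Finset.univ.filter fun x : ZMod p => quadraticChar (ZMod p) (f.eval x) = 0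
    have hpow : ∀ x : ZMod p, ((quadraticChar (ZMod p) (f.eval x) : ℤ) : ZMod p) =
        f.eval x ^ (p / 2) := by
      intro x
      have := quadraticChar_eq_pow_of_char_ne_two' hchar (f.eval x)
      rwa [ZMod.card] at this
    have b1 := stepanov_card_le_sqrt f hp2 hm hp hf0 hns 1 S1 (by
      intro x hx
      rw [← hpow, (Finset.mem_filter.1 hx).2]; simp)
    have b2 := stepanov_card_le_sqrt f hp2 hm hp hf0 hns (-1) S2 (by
      intro x hx
      rw [← hpow, (Finset.mem_filter.1 hx).2]; simp)
    have hf : f ≠ 0 := by rintro rfl; simp at hf0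
    have b0 : (S0.card : ℝ) ≤ m := by
      have : S0 ⊆ f.roots.toFinset := by
        intro x hx
        have := (Finset.mem_filter.1 hx).2
        rw [quadraticChar_eq_zero_iff] at this
        simpa [hf] using this
      have h1 := (Finset.card_le_card this).trans (Multiset.toFinset_card_le _)
      exact_mod_cast h1.trans (card_roots' f)
    have hpart : ∀ x : ZMod p, (1 : ℝ) = (if quadraticChar (ZMod p) (f.eval x) = 1 then 1 else 0)
        + (if quadraticChar (ZMod p) (f.eval x) = -1 then 1 else 0)
        + (if quadraticChar (ZMod p) (f.eval x) = 0 then 1 else 0) := by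
      intro x
      rcases hval x with h | h | h <;> simp [h]
    have hdec : ∀ x : ZMod p, (quadraticChar (ZMod p) (f.eval x) : ℝ) =
        (if quadraticChar (ZMod p) (f.eval x) = 1 then 1 else 0)
        - (if quadraticChar (ZMod p) (f.eval x) = -1 then 1 else 0) := by
      intro x
      rcases hval x with h | h | h <;> simp [h]
    have t1 : (p : ℝ) = S1.card + S2.card + S0.card := by
      have : ∑ x : ZMod p, (1 : ℝ) = S1.card + S2.card + S0.card := by
        rw [Finset.sum_congr rfl fun x _ => hpart x, Finset.sum_add_distrib,
          Finset.sum_add_distrib]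
        simp [S1, S2, S0, Finset.sum_boole]
      simpa [ZMod.card] using this
    have t2 : ∑ x : ZMod p, (quadraticChar (ZMod p) (f.eval x) : ℝ) = S1.card - S2.card := by
      rw [Finset.sum_congr rfl fun x _ => hdec x, Finset.sum_sub_distrib]
      simp [S1, S2, Finset.sum_boole]
    rw [t2, abs_le]
    have hs1 : 1 ≤ √(p : ℝ) := by
      rw [Real.one_le_sqrt]; exact_mod_cast (Fact.out : p.Prime).one_lt.le
    constructor <;> nlinarith

/-- **Weil's bound** for quadratic character sums, with a weak constant: `f` is assumed not to be
a constant multiple of the square of a rational function. -/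
theorem abs_sum_quadraticChar_le (f : (ZMod p)[X]) (hp2 : p ≠ 2) (hm : 1 ≤ f.natDegree)
    (hns : ∀ (a : ZMod p) (r s : (ZMod p)[X]), f * r ^ 2 = C a * s ^ 2 → r = 0) :
    |∑ x : ZMod p, (quadraticChar (ZMod p) (f.eval x) : ℝ)| ≤ 9 * (f.natDegree + 1) * √p := by
  classical
  by_cases ht : ∃ t, f.eval t ≠ 0
  · obtain ⟨t, ht⟩ := ht
    -- a translation makes the constant coefficient nonzero
    have h := abs_sum_quadraticChar_le_of_coeff_zero_ne (f.comp (X + C t)) hp2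
      (by rw [natDegree_comp]; simpa using hm)
      (by rw [coeff_zero_eq_eval_zero]; simpa using ht) (by
        intro a r s h
        have h1 : f * (r.comp (X - C t)) ^ 2 = C a * (s.comp (X - C t)) ^ 2 := by
          have := congrArg (fun q => q.comp (X - C t)) h
          simpa [comp_assoc] using this
        have h2 := hns _ _ _ h1
        have := congrArg (fun q => q.comp (X + C t)) h2
        simpa [comp_assoc] using this)
    rw [natDegree_comp, natDegree_X_add_C, mul_one] at h
    rw [← Equiv.sum_comp (Equiv.addRight t)]
    simpa using h
  · push Not at ht
    simp only [ht, quadraticChar_zero]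
    simp only [Int.cast_zero, Finset.sum_const_zero, abs_zero]
    positivity

end Stepanov

/-! ### Products that are not squares of rational functions -/

section Nonsquare

open Polynomial

variable {K : Type*} [Field K]

/-- A prime factor of exact order one in `f * L` keeps this product from being a constant multiple
of the square of a rational function. -/
theorem eq_zero_of_mul_sq_eq_of_prime {f L q : K[X]} (hq : Prime q) (hqf : q ∣ f)
    (hqf2 : ¬ q * q ∣ f) (hqL : ¬ q ∣ L) (a : K) (r s : K[X])
    (h : f * L * r ^ 2 = C a * s ^ 2) : r = 0 := by
  by_contra hr
  have hf0 : f ≠ 0 := by rintro rfl; simp at hqf2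
  have hL0 : L ≠ 0 := by rintro rfl; simp at hqL
  have hne : f * L * r ^ 2 ≠ 0 := mul_ne_zero (mul_ne_zero hf0 hL0) (pow_ne_zero _ hr)
  have ha : a ≠ 0 := by rintro rfl; simp [hf0, hL0, hr] at h
  have hs : s ≠ 0 := by rintro rfl; simp [hf0, hL0, hr] at h
  have fr : FiniteMultiplicity q r := FiniteMultiplicity.of_prime_left hq hr
  have fs : FiniteMultiplicity q s := FiniteMultiplicity.of_prime_left hq hs
  have e1 : emultiplicity q f = 1 := by
    have : emultiplicity q f = ((1 : ℕ) : ℕ∞) := by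
      rw [emultiplicity_eq_coe]
      refine ⟨by simpa using hqf, by simpa [pow_two] using hqf2⟩
    simpa using this
  have e2 : emultiplicity q L = 0 := emultiplicity_eq_zero.2 hqL
  have e3 : emultiplicity q (C a) = 0 := by
    apply emultiplicity_eq_zero.2
    intro hd
    exact hq.not_isUnit (isUnit_of_dvd_unit hd (isUnit_C.2 (isUnit_iff_ne_zero.2 ha)))
  have h2 := congrArg (emultiplicity q) h
  rw [emultiplicity_mul hq, emultiplicity_mul hq, emultiplicity_mul hq, emultiplicity_pow hq,
    emultiplicity_pow hq, e1, e2, e3, fr.emultiplicity_eq_multiplicity,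
    fs.emultiplicity_eq_multiplicity] at h2
  have h3 : 1 + 2 * multiplicity q r = 2 * multiplicity q s := by
    have : ((1 + 0 + 2 * multiplicity q r : ℕ) : ℕ∞) = ((0 + 2 * multiplicity q s : ℕ) : ℕ∞) := by
      push_cast; exact_mod_cast h2
    have := ENat.natCast_inj.1 this
    omega
  omega

theorem Squarefree.eq_zero_of_mul_sq_eq {f : K[X]} (hf : Squarefree f) (hd : 1 ≤ f.natDegree)
    (a : K) (r s : K[X]) (h : f * r ^ 2 = C a * s ^ 2) : r = 0 := by
  have hu : ¬ IsUnit f := fun hu => by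
    have := natDegree_eq_zero_of_isUnit hu; omega
  obtain ⟨q, hq, hqf⟩ := WfDvdMonoid.exists_irreducible_factor hu (by rintro rfl; simp at hd)
  refine eq_zero_of_mul_sq_eq_of_prime (L := 1) hq.prime hqf
    (fun h2 => hq.not_isUnit (hf _ h2)) (fun h1 => hq.not_isUnit (isUnit_of_dvd_one h1)) a r s ?_
  simpa using h

theorem Squarefree.eq_zero_of_mul_linear_mul_sq_eq {f : K[X]} (hf : Squarefree f)
    (hd : 2 ≤ f.natDegree) {L : K[X]} (hL : L.natDegree = 1) (a : K) (r s : K[X])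
    (h : f * L * r ^ 2 = C a * s ^ 2) : r = 0 := by
  have hLirr : Irreducible L := irreducible_of_degree_eq_one (by
    rw [degree_eq_natDegree (by rintro rfl; simp at hL), hL]; rfl)
  have key : ∃ q, Irreducible q ∧ q ∣ f ∧ ¬ q ∣ L := by
    by_contra hcon
    push Not at hcon
    have hu : ¬ IsUnit f := fun hu => by
      have := natDegree_eq_zero_of_isUnit hu; omega
    obtain ⟨q, hq, f2, rfl⟩ := WfDvdMonoid.exists_irreducible_factor hu
      (by rintro rfl; simp at hd)
    have a1 := (hq.dvd_irreducible_iff_associated hLirr).1 (hcon q hq (dvd_mul_right _ _))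
    have hdq : q.natDegree = 1 :=
        (natDegree_eq_of_degree_eq (degree_eq_degree_of_associated a1)).trans hL
    have hu2 : ¬ IsUnit f2 := fun hu2 => by
      have h1 := natDegree_eq_zero_of_isUnit hu2
      have := natDegree_mul_le (p := q) (q := f2)
      omega
    have hf2 : f2 ≠ 0 := by rintro rfl; simp at hd
    obtain ⟨q2, hq2, hq2f⟩ := WfDvdMonoid.exists_irreducible_factor hu2 hf2
    have a2 := (hq2.dvd_irreducible_iff_associated hLirr).1
      (hcon q2 hq2 (hq2f.mul_left _))
    have : q * q ∣ q * f2 := mul_dvd_mul_left _ ((a1.trans a2.symm).dvd.trans hq2f)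
    exact hq.not_isUnit (hf _ this)
  obtain ⟨q, hq, hqf, hqL⟩ := key
  exact eq_zero_of_mul_sq_eq_of_prime hq.prime hqf (fun h2 => hq.not_isUnit (hf _ h2)) hqL a r s h

end Nonsquare

/-! ### Fourier analysis on `ZMod N` -/

section Fourier

variable {N : ℕ} [NeZero N]

theorem sum_stdAddChar_mul (a : ZMod N) :
    ∑ x : ZMod N, ZMod.stdAddChar (a * x) = if a = 0 then (N : ℂ) else 0 := by
  have := AddChar.sum_mulShift a (ZMod.isPrimitive_stdAddChar N)
  rw [ZMod.card] at this
  simp_rw [mul_comm a, this]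
  split_ifs <;> simp

theorem norm_stdAddChar (a : ZMod N) : ‖ZMod.stdAddChar a‖ = 1 := by
  rw [ZMod.stdAddChar_apply]
  exact Circle.norm_coe _

theorem conj_stdAddChar (a : ZMod N) :
    (starRingEnd ℂ) (ZMod.stdAddChar a) = ZMod.stdAddChar (-a) := by
  rw [AddChar.map_neg_eq_inv, Complex.inv_def, Complex.normSq_eq_norm_sq, norm_stdAddChar]
  simp

/-- Parseval's identity on `ZMod N`. -/
theorem zmod_parseval (φ : ZMod N → ℂ) :
    ∑ a : ZMod N, ‖∑ x, φ x * ZMod.stdAddChar (a * x)‖ ^ 2 = N * ∑ x, ‖φ x‖ ^ 2 := by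
  have h : ∑ a : ZMod N, (((‖∑ x, φ x * ZMod.stdAddChar (a * x)‖ ^ 2 : ℝ)) : ℂ) =
      N * ∑ x, ((‖φ x‖ ^ 2 : ℝ) : ℂ) := by
    have h1 : ∀ a : ZMod N, (((‖∑ x, φ x * ZMod.stdAddChar (a * x)‖ ^ 2 : ℝ)) : ℂ) =
        ∑ x, ∑ y, φ x * (starRingEnd ℂ) (φ y) * ZMod.stdAddChar ((x - y) * a) := by
      intro a
      rw [Complex.ofReal_pow, ← Complex.mul_conj', map_sum, Finset.sum_mul_sum]
      refine Finset.sum_congr rfl fun x _ => Finset.sum_congr rfl fun y _ => ?_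
      rw [map_mul (starRingEnd ℂ) (φ y), conj_stdAddChar, show (x - y) * a = a * x +
          -(a * y) by ring,
        AddChar.map_add_eq_mul]
      ring
    simp_rw [h1]
    rw [Finset.sum_comm, Finset.mul_sum]
    refine Finset.sum_congr rfl fun x _ => ?_
    rw [Finset.sum_comm]
    simp_rw [← Finset.mul_sum, sum_stdAddChar_mul, sub_eq_zero]
    simp only [mul_ite, mul_zero, Finset.sum_ite_eq, Finset.mem_univ, if_true]
    rw [Complex.mul_conj', Complex.ofReal_pow]
    ring
  exact_mod_cast h

/-- The Fourier coefficients of a function on `(ZMod N)²`. -/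
noncomputable def zmodHat (φ : ZMod N → ZMod N → ℂ) (a b : ZMod N) : ℂ :=
  (1 / (N : ℂ) ^ 2) * ∑ y, ∑ x, φ x y * ZMod.stdAddChar (-(a * x + b * y))

/-- Fourier inversion on `(ZMod N)²`. -/
theorem zmodHat_inversion (φ : ZMod N → ZMod N → ℂ) (x y : ZMod N) :
    φ x y = ∑ a, ∑ b, zmodHat φ a b * ZMod.stdAddChar (a * x + b * y) := by
  have hN : (N : ℂ) ≠ 0 := Nat.cast_ne_zero.2 (NeZero.ne N)
  have h1 : ∀ a b, zmodHat φ a b * ZMod.stdAddChar (a * x + b * y) =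
      (1 / (N : ℂ) ^ 2) * ∑ v, ∑ u, φ u v *
        (ZMod.stdAddChar ((x - u) * a) * ZMod.stdAddChar ((y - v) * b)) := by
    intro a b
    rw [zmodHat, mul_assoc, Finset.sum_mul]
    congr 1
    refine Finset.sum_congr rfl fun v _ => ?_
    rw [Finset.sum_mul]
    refine Finset.sum_congr rfl fun u _ => ?_
    rw [mul_assoc, ← AddChar.map_add_eq_mul, ← AddChar.map_add_eq_mul]
    congr 2
    ring
  simp_rw [h1, ← Finset.mul_sum]
  have h2 : ∑ a, ∑ b, ∑ v, ∑ u, φ u v *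
        (ZMod.stdAddChar ((x - u) * a) * ZMod.stdAddChar ((y - v) * b)) =
      ∑ v, ∑ u, φ u v * ((∑ a, ZMod.stdAddChar ((x - u) * a)) *
        ∑ b, ZMod.stdAddChar ((y - v) * b)) := by
    calc _ = ∑ a, ∑ v, ∑ u, ∑ b, φ u v *
        (ZMod.stdAddChar ((x - u) * a) * ZMod.stdAddChar ((y - v) * b)) := by
          refine Finset.sum_congr rfl fun a _ => ?_
          rw [Finset.sum_comm]
          refine Finset.sum_congr rfl fun v _ => ?_
          rw [Finset.sum_comm]
      _ = _ := by
          rw [Finset.sum_comm]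
          refine Finset.sum_congr rfl fun v _ => ?_
          rw [Finset.sum_comm]
          refine Finset.sum_congr rfl fun u _ => ?_
          rw [Finset.sum_mul_sum, Finset.mul_sum]
          refine Finset.sum_congr rfl fun a _ => ?_
          rw [Finset.mul_sum]
  rw [h2]
  simp_rw [sum_stdAddChar_mul, sub_eq_zero]
  rw [Finset.sum_eq_single y, Finset.sum_eq_single x]
  · simp only [if_true]
    field_simp
  · intro u _ hu
    simp [hu.symm]
  · simp
  · intro v _ hv
    simp [hv.symm]
  · simp

/-- A Cauchy-Schwarz bound for the sum over `b` of the Fourier coefficients at `(a, b)`. -/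
theorem sum_norm_zmodHat_sq_le (φ : ZMod N → ZMod N → ℂ) (a : ZMod N) :
    (∑ b, ‖zmodHat φ a b‖) ^ 2 ≤
      ∑ y, ‖(1 / (N : ℂ)) * ∑ x, φ x y * ZMod.stdAddChar (-(a * x))‖ ^ 2 := by
  have hN : (N : ℂ) ≠ 0 := Nat.cast_ne_zero.2 (NeZero.ne N)
  have hNR : (0 : ℝ) < N := Nat.cast_pos.2 (Nat.pos_of_ne_zero (NeZero.ne N))
  set c : ZMod N → ℂ := fun y => (1 / (N : ℂ)) * ∑ x, φ x y * ZMod.stdAddChar (-(a * x)) with hc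
  have h1 : ∀ b, ‖zmodHat φ a b‖ = (1 / N) * ‖∑ y, c y * ZMod.stdAddChar ((-b) * y)‖ := by
    intro b
    have : zmodHat φ a b = (1 / (N : ℂ)) * ∑ y, c y * ZMod.stdAddChar ((-b) * y) := by
      rw [zmodHat, Finset.mul_sum, Finset.mul_sum]
      refine Finset.sum_congr rfl fun y _ => ?_
      rw [hc]
      simp only
      rw [Finset.mul_sum, Finset.mul_sum, Finset.sum_mul, Finset.mul_sum]
      refine Finset.sum_congr rfl fun x _ => ?_
      rw [show -(a * x + b * y) = -(a * x) + -b * y by ring, AddChar.map_add_eq_mul]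
      field_simp
    rw [this, norm_mul]
    simp
  have h3 : (∑ b, ‖zmodHat φ a b‖) ^ 2 ≤ N * ∑ b, ‖zmodHat φ a b‖ ^ 2 := by
    have := sq_sum_le_card_mul_sum_sq (s := (Finset.univ : Finset (ZMod N)))
      (f := fun b => ‖zmodHat φ a b‖)
    simpa [ZMod.card] using this
  refine h3.trans (le_of_eq ?_)
  have h4 : ∑ b, ‖zmodHat φ a b‖ ^ 2 = (1 / N) ^ 2 * (N * ∑ y, ‖c y‖ ^ 2) := by
    rw [← zmod_parseval c, Finset.mul_sum, ← Equiv.sum_comp (Equiv.neg (ZMod N))]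
    refine Finset.sum_congr rfl fun b _ => ?_
    rw [h1]
    simp [mul_pow]
  rw [h4]
  change _ = ∑ y, ‖c y‖ ^ 2
  field_simp

end Fourier

/-! ### The quadratic character of a binary form modulo a prime -/

section LocalWeights

open Polynomial

variable {p : ℕ} [Fact p.Prime]

theorem quadraticChar_cases (x : ZMod p) : quadraticChar (ZMod p) x = 0 ∨
    quadraticChar (ZMod p) x = 1 ∨ quadraticChar (ZMod p) x = -1 := by
  by_cases h : x = 0
  · left; simp [h]
  · right; exact quadraticChar_dichotomy h

theorem abs_quadraticChar_le_one (x : ZMod p) : |(quadraticChar (ZMod p) x : ℝ)| ≤ 1 := by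
  rcases quadraticChar_cases x with h | h | h <;> simp [h]

theorem norm_quadraticChar_le_one (x : ZMod p) : ‖(quadraticChar (ZMod p) x : ℂ)‖ ≤ 1 := by
  rcases quadraticChar_cases x with h | h | h <;> simp [h]

theorem quadraticChar_pow_odd {D : ℕ} (hD : Odd D) (x : ZMod p) :
    quadraticChar (ZMod p) (x ^ D) = quadraticChar (ZMod p) x := by
  rw [map_pow]
  rcases quadraticChar_cases x with h | h | h <;> rw [h]
  · exact zero_pow hD.pos.ne'
  · exact one_pow _
  · exact hD.neg_one_pow

theorem sum_quadraticChar_eq_zero (hp2 : p ≠ 2) :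
    ∑ y : ZMod p, (quadraticChar (ZMod p) y : ℂ) = 0 := by
  have h0 := quadraticChar_sum_zero (F := ZMod p) (by rwa [ZMod.ringChar_zmod_n])
  exact_mod_cast h0

/-- The Gauss sum at the frequency `c`, in terms of the one at `1`. -/
theorem sum_quadraticChar_mul_stdAddChar (hp2 : p ≠ 2) (c : ZMod p) :
    ∑ y : ZMod p, (quadraticChar (ZMod p) y : ℂ) * ZMod.stdAddChar (c * y) =
      quadraticChar (ZMod p) c *
        ∑ y : ZMod p, (quadraticChar (ZMod p) y : ℂ) * ZMod.stdAddChar y := by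
  by_cases hc : c = 0
  · subst hc
    simp only [zero_mul, AddChar.map_zero_eq_one, mul_one, quadraticChar_zero, Int.cast_zero]
    exact sum_quadraticChar_eq_zero hp2
  · rw [Finset.mul_sum, ← Equiv.sum_comp (Equiv.mulLeft₀ c hc)
      (fun y => (quadraticChar (ZMod p) c : ℂ) *
        ((quadraticChar (ZMod p) y : ℂ) * ZMod.stdAddChar y))]
    refine Finset.sum_congr rfl fun y _ => ?_
    rw [Equiv.mulLeft₀_apply, map_mul (quadraticChar (ZMod p))]
    rcases quadraticChar_dichotomy hc with h | h <;> rw [h] <;> push_cast <;> ring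

/-- The bound for Gauss sums, including the trivial character `c = 0`, where the sum is `0`. -/
theorem norm_sum_quadraticChar_mul_stdAddChar_le (hp2 : p ≠ 2) (c : ZMod p) :
    ‖∑ y : ZMod p, (quadraticChar (ZMod p) y : ℂ) * ZMod.stdAddChar (c * y)‖ ≤ √p := by
  set τ := ∑ y : ZMod p, (quadraticChar (ZMod p) y : ℂ) * ZMod.stdAddChar y with hτ
  have hp1 : (1 : ℝ) < p := by exact_mod_cast (Fact.out : p.Prime).one_lt
  have hτ2 : ‖τ‖ ≤ √p := by
    have h1 := zmod_parseval (N := p) (fun y => (quadraticChar (ZMod p) y : ℂ))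
    simp_rw [sum_quadraticChar_mul_stdAddChar hp2, norm_mul, mul_pow, ← Finset.sum_mul] at h1
    have h2 : ∑ i : ZMod p, ‖(quadraticChar (ZMod p) i : ℂ)‖ ^ 2 = p - 1 := by
      have : ∀ i : ZMod p, ‖(quadraticChar (ZMod p) i : ℂ)‖ ^ 2 = if i = 0 then 0 else 1 := by
        intro i
        split_ifs with h
        · simp [h]
        · rcases quadraticChar_dichotomy h with h | h <;> simp [h]
      simp_rw [this]
      rw [Finset.sum_ite]
      simp [Finset.filter_ne', Finset.card_erase_of_mem, ZMod.card,
        Nat.cast_sub (Fact.out : p.Prime).one_lt.le]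
    rw [h2, ← hτ] at h1
    have h3 : ‖τ‖ ^ 2 = p := by
      have : (p - 1 : ℝ) ≠ 0 := by linarith
      apply mul_left_cancel₀ this
      rw [h1]; ring
    exact Real.le_sqrt_of_sq_le h3.le
  rw [sum_quadraticChar_mul_stdAddChar hp2, norm_mul]
  calc _ ≤ 1 * ‖τ‖ := by gcongr; exact norm_quadraticChar_le_one c
    _ ≤ √p := by simpa using hτ2

/-- The hypotheses on the reduction `Φ` modulo `p` of a binary form of odd degree `D`, with
dehomogenization `f`, under which `p` can be used for sieving: `f` is squarefree of degree at
least `2`, and `p` is large in terms of `D`. -/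
structure IsGoodReduction (D : ℕ) (f : (ZMod p)[X]) (Φ : ZMod p → ZMod p → ZMod p) : Prop where
  odd : Odd D
  ne_two : p ≠ 2
  hom : ∀ t x y, Φ (t * x) (t * y) = t ^ D * Φ x y
  eval : ∀ x, Φ x 1 = f.eval x
  squarefree : Squarefree f
  two_le : 2 ≤ f.natDegree
  le : f.natDegree ≤ D
  large : 40 * ((D : ℝ) + 2) ^ 2 ≤ √p

/-- The function `1` where `Φ` vanishes and the quadratic character of `Φ` elsewhere. -/
noncomputable def squareSign (Φ : ZMod p → ZMod p → ZMod p) (x y : ZMod p) : ℝ :=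
  (quadraticChar (ZMod p) (Φ x y) : ℝ) + if Φ x y = 0 then 1 else 0

/-- The mean of `squareSign Φ` over the row `y`. -/
noncomputable def rowMean (Φ : ZMod p → ZMod p → ZMod p) (y : ZMod p) : ℝ :=
  (∑ x, squareSign Φ x y) / p

/-- The function `squareSign Φ` with its row means removed. It is put equal to `0` on the row
`y = 0` if `Φ` vanishes there identically. -/
noncomputable def centeredSign (Φ : ZMod p → ZMod p → ZMod p) (x y : ZMod p) : ℝ :=
  if y = 0 ∧ Φ 1 0 = 0 then 0 else squareSign Φ x y - rowMean Φ y

/-- The multiple of `centeredSign Φ` which is `1` at all points, outside a degenerate row, where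
`Φ` is a square. -/
noncomputable def unitSign (Φ : ZMod p → ZMod p → ZMod p) (x y : ZMod p) : ℝ :=
  centeredSign Φ x y / (1 - rowMean Φ y)

theorem squareSign_eq_one {Φ : ZMod p → ZMod p → ZMod p} {x y : ZMod p} (h : IsSquare (Φ x y)) :
    squareSign Φ x y = 1 := by
  rw [squareSign]
  split_ifs with h0
  · simp [h0]
  · rw [(quadraticChar_one_iff_isSquare h0).2 h]; simp

theorem abs_squareSign (Φ : ZMod p → ZMod p → ZMod p) (x y : ZMod p) :
    |squareSign Φ x y| = 1 := by
  rw [squareSign]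
  split_ifs with h0
  · simp [h0]
  · rcases quadraticChar_dichotomy h0 with h | h <;> simp [h]

theorem squareSign_sq (Φ : ZMod p → ZMod p → ZMod p) (x y : ZMod p) :
    squareSign Φ x y ^ 2 = 1 := by
  rw [← sq_abs, abs_squareSign, one_pow]

variable {D : ℕ} {f : (ZMod p)[X]} {Φ : ZMod p → ZMod p → ZMod p}

namespace IsGoodReduction

theorem apply_zero (h : IsGoodReduction D f Φ) (x : ZMod p) : Φ x 0 = x ^ D * Φ 1 0 := by
  simpa using h.hom x 1 0

theorem apply_mul (h : IsGoodReduction D f Φ) (x y : ZMod p) :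
    Φ (y * x) y = y ^ D * f.eval x := by
  simpa [h.eval] using h.hom y x 1

theorem sqrt_pos (h : IsGoodReduction D f Φ) : 0 < √(p : ℝ) :=
  lt_of_lt_of_le (by positivity) h.large

theorem card_roots_le (h : IsGoodReduction D f Φ) :
    ∑ x : ZMod p, (if f.eval x = 0 then (1 : ℝ) else 0) ≤ D := by
  classical
  rw [Finset.sum_boole]
  have hf : f ≠ 0 := h.squarefree.ne_zero
  have h1 : (Finset.univ.filter fun x : ZMod p => f.eval x = 0) ⊆ f.roots.toFinset := by
    intro x hx
    simpa [hf] using (Finset.mem_filter.1 hx).2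
  have h2 := (Finset.card_le_card h1).trans (Multiset.toFinset_card_le _)
  exact_mod_cast (h2.trans (card_roots' f)).trans h.le

theorem sum_row {y : ZMod p} (hy : y ≠ 0) {M : Type*}
    [AddCommMonoid M] (φ : ZMod p → M) : ∑ x, φ x = ∑ x, φ (y * x) :=
  (Equiv.sum_comp (Equiv.mulLeft₀ y hy) φ).symm

theorem sum_zero_row_le (h : IsGoodReduction D f Φ) {y : ZMod p} (hy : y ≠ 0) :
    ∑ x : ZMod p, (if Φ x y = 0 then (1 : ℝ) else 0) ≤ D := by
  rw [sum_row hy]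
  refine le_of_eq_of_le (Finset.sum_congr rfl fun x _ => ?_) h.card_roots_le
  rw [h.apply_mul]
  simp [hy]

theorem quadraticChar_apply_mul (h : IsGoodReduction D f Φ) (x y : ZMod p) :
    quadraticChar (ZMod p) (Φ (y * x) y) =
      quadraticChar (ZMod p) y * quadraticChar (ZMod p) (f.eval x) := by
  rw [h.apply_mul, map_mul, quadraticChar_pow_odd h.odd]

theorem two_le_D (h : IsGoodReduction D f Φ) : (2 : ℝ) ≤ D := by
  exact_mod_cast h.two_le.trans h.le

/-- On the rows `y ≠ 0` this is Weil's bound; the row `y = 0` is elementary, as the degree is odd.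
-/
theorem abs_rowMean_le (h : IsGoodReduction D f Φ) {y : ZMod p} (hy : ¬ (y = 0 ∧ Φ 1 0 = 0)) :
    |rowMean Φ y| ≤ 10 * ((D : ℝ) + 2) ^ 2 / √p := by
  have hs := h.sqrt_pos
  have hD := h.two_le_D
  have hpR : (0 : ℝ) < p := by exact_mod_cast (Fact.out : p.Prime).pos
  have hss : √(p : ℝ) * √p = p := Real.mul_self_sqrt hpR.le
  have hs1 : 1 ≤ √(p : ℝ) := by nlinarith [h.large]
  have key : |∑ x, squareSign Φ x y| ≤ 10 * ((D : ℝ) + 2) ^ 2 * √p := by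
    simp only [squareSign, Finset.sum_add_distrib]
    by_cases hy0 : y = 0
    · subst hy0
      have ha : Φ 1 0 ≠ 0 := fun ha => hy ⟨rfl, ha⟩
      have e1 : ∑ x : ZMod p, (quadraticChar (ZMod p) (Φ x 0) : ℝ) = 0 := by
        have : ∀ x : ZMod p, (quadraticChar (ZMod p) (Φ x 0) : ℝ) =
            (quadraticChar (ZMod p) x : ℝ) * quadraticChar (ZMod p) (Φ 1 0) := by
          intro x
          rw [h.apply_zero, map_mul, quadraticChar_pow_odd h.odd]
          push_cast; rfl
        rw [Finset.sum_congr rfl fun x _ => this x, ← Finset.sum_mul]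
        have h0 := quadraticChar_sum_zero (F := ZMod p)
          (by rw [ZMod.ringChar_zmod_n]; exact h.ne_two)
        have h0' : ∑ x : ZMod p, (quadraticChar (ZMod p) x : ℝ) = 0 := by exact_mod_cast h0
        rw [h0', zero_mul]
      have e2 : ∑ x : ZMod p, (if Φ x 0 = 0 then (1 : ℝ) else 0) = 1 := by
        have : ∀ x : ZMod p, Φ x 0 = 0 ↔ x = 0 := by
          intro x
          rw [h.apply_zero]
          rw [mul_eq_zero, or_iff_left ha, pow_eq_zero_iff h.odd.pos.ne']
        simp only [this, Finset.sum_ite_eq', Finset.mem_univ, if_true]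
      rw [e1, e2]
      simp only [zero_add, abs_one]
      nlinarith
    · have e1 : |∑ x : ZMod p, (quadraticChar (ZMod p) (Φ x y) : ℝ)| ≤ 9 * (D + 1) * √p := by
        rw [sum_row hy0]
        simp_rw [h.quadraticChar_apply_mul]
        push_cast
        rw [← Finset.mul_sum, abs_mul]
        have hw := abs_sum_quadraticChar_le f h.ne_two (by have := h.two_le; omega)
          (h.squarefree.eq_zero_of_mul_sq_eq (by have := h.two_le; omega))
        have hdeg : (f.natDegree : ℝ) ≤ D := by exact_mod_cast h.le
        calc _ ≤ 1 * (9 * (f.natDegree + 1) * √p) :=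
              mul_le_mul (abs_quadraticChar_le_one y) hw (abs_nonneg _) zero_le_one
          _ ≤ 9 * (D + 1) * √p := by rw [one_mul]; gcongr
      have e2 := h.sum_zero_row_le hy0
      have e3 : 0 ≤ ∑ x : ZMod p, (if Φ x y = 0 then (1 : ℝ) else 0) :=
        Finset.sum_nonneg fun x _ => by split_ifs <;> norm_num
      refine (abs_add_le _ _).trans ?_
      rw [abs_of_nonneg e3]
      have e4 : (D : ℝ) * 1 ≤ D * √p := by gcongr
      have e5 : 0 ≤ (10 * ((D : ℝ) + 2) ^ 2 - 10 * D - 9) * √p :=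
        mul_nonneg (by nlinarith) hs.le
      nlinarith
  rw [rowMean, abs_div, abs_of_pos hpR, div_le_div_iff₀ hpR hs]
  calc _ ≤ 10 * ((D : ℝ) + 2) ^ 2 * √p * √p := by gcongr
    _ = _ := by rw [mul_assoc _ (√(p : ℝ)), hss]

theorem defect_le (h : IsGoodReduction D f Φ) : 10 * ((D : ℝ) + 2) ^ 2 / √p ≤ 1 / 4 := by
  rw [div_le_iff₀ h.sqrt_pos]
  linarith [h.large]

theorem abs_rowMean_le_quarter (h : IsGoodReduction D f Φ) {y : ZMod p}
    (hy : ¬ (y = 0 ∧ Φ 1 0 = 0)) : |rowMean Φ y| ≤ 1 / 4 :=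
  (h.abs_rowMean_le hy).trans h.defect_le

theorem abs_centeredSign_le (h : IsGoodReduction D f Φ) (x y : ZMod p) :
    |centeredSign Φ x y| ≤ 2 := by
  rw [centeredSign]
  split_ifs with hy
  · simp
  · have h1 := abs_squareSign Φ x y
    have h2 := h.abs_rowMean_le_quarter hy
    have := abs_sub (squareSign Φ x y) (rowMean Φ y)
    linarith

theorem half_le_centeredSign (h : IsGoodReduction D f Φ) {x y : ZMod p}
    (hy : ¬ (y = 0 ∧ Φ 1 0 = 0)) (hsq : IsSquare (Φ x y)) : 1 / 2 ≤ centeredSign Φ x y := by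
  rw [centeredSign, if_neg hy, squareSign_eq_one hsq]
  have := (abs_le.1 (h.abs_rowMean_le_quarter hy)).2
  linarith

theorem unitSign_eq_one (h : IsGoodReduction D f Φ) {x y : ZMod p}
    (hy : ¬ (y = 0 ∧ Φ 1 0 = 0)) (hsq : IsSquare (Φ x y)) : unitSign Φ x y = 1 := by
  rw [unitSign, centeredSign, if_neg hy, squareSign_eq_one hsq]
  have := (abs_le.1 (h.abs_rowMean_le_quarter hy)).2
  exact div_self (by linarith)

theorem sum_centeredSign (y : ZMod p) : ∑ x, centeredSign Φ x y = 0 := by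
  have hpR : (0 : ℝ) < p := by exact_mod_cast (Fact.out : p.Prime).pos
  simp only [centeredSign]
  split_ifs with hy
  · simp
  · rw [Finset.sum_sub_distrib, rowMean]
    simp only [Finset.sum_const, Finset.card_univ, ZMod.card, nsmul_eq_mul]
    field_simp
    ring

theorem sum_unitSign (y : ZMod p) : ∑ x, unitSign Φ x y = 0 := by
  simp only [unitSign, ← Finset.sum_div, sum_centeredSign, zero_div]

theorem abs_one_div_le (h : IsGoodReduction D f Φ) {y : ZMod p} (hy : ¬ (y = 0 ∧ Φ 1 0 = 0)) :
    |1 / (1 - rowMean Φ y)| ≤ 1 + 2 * (10 * ((D : ℝ) + 2) ^ 2 / √p) := by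
  have h1 := (abs_le.1 (h.abs_rowMean_le hy)).2
  have h2 := h.defect_le
  have h3 : 0 ≤ 10 * ((D : ℝ) + 2) ^ 2 / √p := by positivity
  set t := 10 * ((D : ℝ) + 2) ^ 2 / √p
  have h4 : 0 < 1 - rowMean Φ y := by linarith
  rw [abs_of_pos (by positivity), div_le_iff₀ h4]
  nlinarith

theorem sum_unitSign_sq_le (h : IsGoodReduction D f Φ) (y : ZMod p) :
    ∑ x, unitSign Φ x y ^ 2 ≤ p * (1 + 8 * (10 * ((D : ℝ) + 2) ^ 2 / √p)) := by
  have hpR : (0 : ℝ) < p := by exact_mod_cast (Fact.out : p.Prime).pos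
  have h2 := h.defect_le
  have h3 : 0 ≤ 10 * ((D : ℝ) + 2) ^ 2 / √p := by positivity
  by_cases hy : y = 0 ∧ Φ 1 0 = 0
  · simp only [unitSign, centeredSign, if_pos hy]
    simp only [zero_div, ne_eq, OfNat.ofNat_ne_zero, not_false_eq_true, zero_pow,
      Finset.sum_const_zero]
    positivity
  · have e1 : ∑ x, centeredSign Φ x y ^ 2 ≤ p := by
      have hm : ∑ x, squareSign Φ x y = p * rowMean Φ y := by
        rw [rowMean]; field_simp
      simp only [centeredSign, if_neg hy, sub_sq, squareSign_sq, Finset.sum_add_distrib,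
        Finset.sum_sub_distrib, ← Finset.sum_mul, ← Finset.mul_sum, hm]
      simp only [Finset.sum_const, Finset.card_univ, ZMod.card, nsmul_eq_mul]
      nlinarith [mul_nonneg hpR.le (sq_nonneg (rowMean Φ y))]
    have e2 : ∀ x, unitSign Φ x y ^ 2 = (1 / (1 - rowMean Φ y)) ^ 2 * centeredSign Φ x y ^ 2 := by
      intro x; rw [unitSign]; ring
    simp_rw [e2, ← Finset.mul_sum]
    have e3 := h.abs_one_div_le hy
    rw [← sq_abs (1 / (1 - rowMean Φ y))]
    set t := 10 * ((D : ℝ) + 2) ^ 2 / √p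
    calc _ ≤ (1 + 2 * t) ^ 2 * p := by gcongr
      _ ≤ _ := by
        rw [mul_comm]
        gcongr
        nlinarith

/-- The Fourier coefficients at `a` of the rows `y ≠ 0` of the quadratic character of the form. By
homogeneity they are, up to sign, the Fourier coefficients of the quadratic character of `f` at the
frequencies `a * y`, so that Parseval's identity applies. -/
theorem sum_norm_row_sq_le (h : IsGoodReduction D f Φ) {a : ZMod p} (ha : a ≠ 0) :
    ∑ y : ZMod p, (if y = 0 then 0 else ‖(1 / (p : ℂ)) * ∑ x, (quadraticChar (ZMod p) (Φ x y) : ℂ) *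
      ZMod.stdAddChar (-(a * x))‖ ^ 2) ≤ 1 := by
  have hpR : (0 : ℝ) < p := by exact_mod_cast (Fact.out : p.Prime).pos
  set T : ZMod p → ℝ := fun c =>
    ‖∑ x, (quadraticChar (ZMod p) (f.eval x) : ℂ) * ZMod.stdAddChar (c * x)‖ ^ 2 with hT
  have h1 : ∀ y : ZMod p, (if y = 0 then 0 else ‖(1 / (p : ℂ)) *
      ∑ x, (quadraticChar (ZMod p) (Φ x y) : ℂ) * ZMod.stdAddChar (-(a * x))‖ ^ 2) ≤
      (1 / p) ^ 2 * T (-a * y) := by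
    intro y
    split_ifs with hy
    · positivity
    · rw [sum_row hy, norm_mul, mul_pow]
      have e1 : ‖(1 / (p : ℂ))‖ = 1 / p := by simp
      rw [e1]
      refine mul_le_mul_of_nonneg_left ?_ (by positivity)
      rw [hT]
      have e2 : ∑ x : ZMod p, (quadraticChar (ZMod p) (Φ (y * x) y) : ℂ) *
          ZMod.stdAddChar (-(a * (y * x))) = (quadraticChar (ZMod p) y : ℂ) *
          ∑ x, (quadraticChar (ZMod p) (f.eval x) : ℂ) * ZMod.stdAddChar (-a * y * x) := by
        rw [Finset.mul_sum]
        refine Finset.sum_congr rfl fun x _ => ?_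
        rw [h.quadraticChar_apply_mul, show -(a * (y * x)) = -a * y * x by ring]
        push_cast
        ring
      rw [e2, norm_mul, mul_pow]
      have := norm_quadraticChar_le_one y
      refine (mul_le_of_le_one_left (by positivity) ?_)
      exact pow_le_one₀ (norm_nonneg _) this
  refine (Finset.sum_le_sum fun y _ => h1 y).trans ?_
  rw [← Finset.mul_sum]
  have h2 : ∑ y, T (-a * y) = ∑ c, T c :=
    Equiv.sum_comp (Equiv.mulLeft₀ (-a) (neg_ne_zero.2 ha)) T
  rw [h2, hT, zmod_parseval]
  have h3 : ∑ x : ZMod p, ‖(quadraticChar (ZMod p) (f.eval x) : ℂ)‖ ^ 2 ≤ p := by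
    calc _ ≤ ∑ x : ZMod p, (1 : ℝ) := Finset.sum_le_sum fun x _ =>
          pow_le_one₀ (norm_nonneg _) (norm_quadraticChar_le_one _)
      _ = p := by simp [ZMod.card]
  calc (1 / (p : ℝ)) ^ 2 * (p * ∑ x : ZMod p, ‖(quadraticChar (ZMod p) (f.eval x) : ℂ)‖ ^ 2)
      ≤ (1 / (p : ℝ)) ^ 2 * (p * p) := by gcongr
    _ = 1 := by field_simp

theorem sum_centeredSign_mul {a : ZMod p} (ha : a ≠ 0) {y : ZMod p}
    (hy : ¬ (y = 0 ∧ Φ 1 0 = 0)) : ∑ x, (centeredSign Φ x y : ℂ) * ZMod.stdAddChar (-(a * x)) =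
      ∑ x, (squareSign Φ x y : ℂ) * ZMod.stdAddChar (-(a * x)) := by
  simp only [centeredSign, if_neg hy]
  push_cast
  simp_rw [sub_mul]
  rw [Finset.sum_sub_distrib, ← Finset.mul_sum]
  simp_rw [← neg_mul]
  rw [sum_stdAddChar_mul, if_neg (neg_ne_zero.2 ha), mul_zero, sub_zero]

theorem norm_squareSign_row_le (h : IsGoodReduction D f Φ) (a y : ZMod p)
    (hy : ¬ (y = 0 ∧ Φ 1 0 = 0)) :
    ‖(1 / (p : ℂ)) * ∑ x, (squareSign Φ x y : ℂ) * ZMod.stdAddChar (-(a * x))‖ ≤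
      ‖(1 / (p : ℂ)) * ∑ x, (quadraticChar (ZMod p) (Φ x y) : ℂ) *
        ZMod.stdAddChar (-(a * x))‖ + D / p := by
  have hpR : (0 : ℝ) < p := by exact_mod_cast (Fact.out : p.Prime).pos
  have hD := h.two_le_D
  have e1 : ∑ x, (squareSign Φ x y : ℂ) * ZMod.stdAddChar (-(a * x)) =
      ∑ x, (quadraticChar (ZMod p) (Φ x y) : ℂ) * ZMod.stdAddChar (-(a * x)) +
      ∑ x, (if Φ x y = 0 then (1 : ℂ) else 0) * ZMod.stdAddChar (-(a * x)) := by
    rw [← Finset.sum_add_distrib]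
    refine Finset.sum_congr rfl fun x _ => ?_
    rw [squareSign]
    rw [Complex.ofReal_add, add_mul]
    split_ifs <;> simp
  rw [e1, mul_add]
  refine (norm_add_le _ _).trans ?_
  gcongr
  rw [norm_mul]
  have e2 : ‖(1 / (p : ℂ))‖ = 1 / p := by simp
  rw [e2, div_eq_mul_one_div (D : ℝ), mul_comm (D : ℝ)]
  refine mul_le_mul_of_nonneg_left ?_ (by positivity)
  refine (norm_sum_le _ _).trans ?_
  have e3 : ∀ x : ZMod p, ‖(if Φ x y = 0 then (1 : ℂ) else 0) * ZMod.stdAddChar (-(a * x))‖ =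
      if Φ x y = 0 then (1 : ℝ) else 0 := by
    intro x
    rw [norm_mul, norm_stdAddChar, mul_one]
    split_ifs <;> simp
  simp_rw [e3]
  by_cases hy0 : y = 0
  · subst hy0
    have ha : Φ 1 0 ≠ 0 := fun ha => hy ⟨rfl, ha⟩
    have : ∀ x : ZMod p, Φ x 0 = 0 ↔ x = 0 := by
      intro x
      rw [h.apply_zero, mul_eq_zero, or_iff_left ha, pow_eq_zero_iff h.odd.pos.ne']
    simp only [this, Finset.sum_ite_eq', Finset.mem_univ, if_true]
    linarith
  · exact h.sum_zero_row_le hy0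

theorem norm_quadraticChar_zero_row_le (h : IsGoodReduction D f Φ) (a : ZMod p) :
    ‖(1 / (p : ℂ)) * ∑ x, (quadraticChar (ZMod p) (Φ x 0) : ℂ) *
        ZMod.stdAddChar (-(a * x))‖ ≤ 1 / √p := by
  have hpR : (0 : ℝ) < p := by exact_mod_cast (Fact.out : p.Prime).pos
  have hss : √(p : ℝ) * √p = p := Real.mul_self_sqrt hpR.le
  have e1 : ∑ x, (quadraticChar (ZMod p) (Φ x 0) : ℂ) * ZMod.stdAddChar (-(a * x)) =
      quadraticChar (ZMod p) (Φ 1 0) *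
      ∑ x, (quadraticChar (ZMod p) x : ℂ) * ZMod.stdAddChar (-a * x) := by
    rw [Finset.mul_sum]
    refine Finset.sum_congr rfl fun x _ => ?_
    rw [h.apply_zero, map_mul (quadraticChar (ZMod p)), quadraticChar_pow_odd h.odd, neg_mul]
    push_cast
    ring
  rw [e1, norm_mul, norm_mul]
  have e2 : ‖(1 / (p : ℂ))‖ = 1 / p := by simp
  rw [e2]
  calc _ ≤ 1 / (p : ℝ) * (1 * √p) := by
        gcongr
        · exact norm_quadraticChar_le_one _
        · exact norm_sum_quadraticChar_mul_stdAddChar_le h.ne_two _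
    _ = 1 / √p := by
        have := h.sqrt_pos
        field_simp
        linarith

theorem sq_mul_le_sq_of_le_quarter {t : ℝ} (ht0 : 0 ≤ t) (ht : t ≤ 1 / 4) :
    (1 + 2 * t) ^ 2 * (1 + t / 10) ≤ (1 + 8 * t) ^ 2 := by
  have hb1 : (1 + 2 * t) ^ 2 ≤ 1 + 5 * t := by nlinarith
  have hb2 : (1 + 5 * t) * (1 + t / 10) ≤ 1 + 8 * t := by nlinarith
  have hb3 : (1 + 8 * t) * 1 ≤ (1 + 8 * t) * (1 + 8 * t) := by gcongr; linarith
  have hb4 : (1 + 2 * t) ^ 2 * (1 + t / 10) ≤ (1 + 5 * t) * (1 + t / 10) := by gcongr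
  rw [pow_two (1 + 8 * t)]
  linarith

/-- The absolute Fourier coefficients of `unitSign` over a line `a ≠ 0` have sum close to `1`. -/
theorem sum_norm_zmodHat_unitSign_le (h : IsGoodReduction D f Φ) {a : ZMod p} (ha : a ≠ 0) :
    ∑ b, ‖zmodHat (fun x y => (unitSign Φ x y : ℂ)) a b‖ ≤
      1 + 8 * (10 * ((D : ℝ) + 2) ^ 2 / √p) := by
  have hpR : (0 : ℝ) < p := by exact_mod_cast (Fact.out : p.Prime).pos
  have hss : √(p : ℝ) * √p = p := Real.mul_self_sqrt hpR.le
  have hs := h.sqrt_pos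
  have hD := h.two_le_D
  have ht := h.defect_le
  have ht0 : 0 ≤ 10 * ((D : ℝ) + 2) ^ 2 / √p := by positivity
  have hs1 : 1 ≤ √(p : ℝ) := by nlinarith [h.large]
  set ε := 1 / √(p : ℝ) with hε
  have hε0 : 0 < ε := by positivity
  have hε1 : ε ≤ 1 := by rw [hε, div_le_one hs]; exact hs1
  have hεp : 1 / (p : ℝ) = ε ^ 2 := by rw [hε, div_pow, one_pow, Real.sq_sqrt hpR.le]
  have hεs : ε * √p = 1 := by rw [hε]; field_simp
  have htε : 10 * ((D : ℝ) + 2) ^ 2 / √p = 10 * ((D : ℝ) + 2) ^ 2 * ε := by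
    rw [hε]; ring
  rw [htε] at ht ht0 ⊢
  set t := 10 * ((D : ℝ) + 2) ^ 2 * ε with htdef
  set u : ZMod p → ℝ := fun y => if y = 0 then ε else
    ‖(1 / (p : ℂ)) * ∑ x, (quadraticChar (ZMod p) (Φ x y) : ℂ) * ZMod.stdAddChar (-(a * x))‖
    with hu
  have hu0 : ∀ y, 0 ≤ u y := by
    intro y; rw [hu]; simp only; split_ifs <;> positivity
  have hu2 : ∑ y, u y ^ 2 ≤ 1 + ε ^ 2 := by
    have e : ∀ y, u y ^ 2 = (if y = 0 then 0 else ‖(1 / (p : ℂ)) *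
      ∑ x, (quadraticChar (ZMod p) (Φ x y) : ℂ) * ZMod.stdAddChar (-(a * x))‖ ^ 2) +
      (if y = 0 then ε ^ 2 else 0) := by
      intro y; rw [hu]; simp only; split_ifs <;> simp
    simp_rw [e, Finset.sum_add_distrib]
    have := h.sum_norm_row_sq_le ha
    simp only [Finset.sum_ite_eq', Finset.mem_univ, if_true]
    linarith
  have hu1 : ∑ y, u y ≤ 2 * √p := by
    have h1 := sq_sum_le_card_mul_sum_sq (s := (Finset.univ : Finset (ZMod p))) (f := u)
    rw [Finset.card_univ, ZMod.card] at h1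
    refine abs_le_of_sq_le_sq' (h1.trans ?_) (by positivity) |>.2
    have : (p : ℝ) * ∑ i, u i ^ 2 ≤ p * (1 + ε ^ 2) := by gcongr
    rw [mul_pow, Real.sq_sqrt hpR.le]
    nlinarith
  have hrow : ∀ y, ‖(1 / (p : ℂ)) * ∑ x, (unitSign Φ x y : ℂ) * ZMod.stdAddChar (-(a * x))‖ ≤
      (1 + 2 * t) * (u y + D / p) := by
    intro y
    by_cases hy : y = 0 ∧ Φ 1 0 = 0
    · simp only [unitSign, centeredSign, if_pos hy]
      simp only [zero_div, Complex.ofReal_zero, zero_mul, Finset.sum_const_zero, mul_zero,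
        norm_zero]
      have := hu0 y
      positivity
    · have e1 : (1 / (p : ℂ)) * ∑ x, (unitSign Φ x y : ℂ) * ZMod.stdAddChar (-(a * x)) =
          ((1 / (1 - rowMean Φ y) : ℝ) : ℂ) *
          ((1 / (p : ℂ)) * ∑ x, (squareSign Φ x y : ℂ) * ZMod.stdAddChar (-(a * x))) := by
        rw [← sum_centeredSign_mul ha hy, mul_left_comm,
            Finset.mul_sum (a := ((1 / (1 - rowMean Φ y) : ℝ) : ℂ))]
        congr 1
        refine Finset.sum_congr rfl fun x _ => ?_
        rw [unitSign]
        push_cast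
        ring
      rw [e1, norm_mul, Complex.norm_real, Real.norm_eq_abs]
      have e2 := h.abs_one_div_le hy
      rw [htε] at e2
      refine mul_le_mul e2 ((h.norm_squareSign_row_le a y hy).trans ?_) (norm_nonneg _)
        (by positivity)
      gcongr
      rw [hu]
      simp only
      split_ifs with hy0
      · rw [hy0]; exact h.norm_quadraticChar_zero_row_le a
      · exact le_rfl
  have hsq := sum_norm_zmodHat_sq_le (fun x y => (unitSign Φ x y : ℂ)) a
  clear_value ε
  have hfin : (∑ b, ‖zmodHat (fun x y => (unitSign Φ x y : ℂ)) a b‖) ^ 2 ≤ (1 + 8 * t) ^ 2 := by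
    refine hsq.trans ?_
    have e1 : ∑ y, ‖(1 / (p : ℂ)) * ∑ x, (unitSign Φ x y : ℂ) * ZMod.stdAddChar (-(a * x))‖ ^ 2
        ≤ ∑ y, ((1 + 2 * t) * (u y + D / p)) ^ 2 :=
      Finset.sum_le_sum fun y _ => pow_le_pow_left₀ (norm_nonneg _) (hrow y) 2
    have e2 : ∑ y, ((1 + 2 * t) * (u y + D / p)) ^ 2 = (1 + 2 * t) ^ 2 *
        (∑ y, u y ^ 2 + 2 * (D / p) * ∑ y, u y + p * (D / p) ^ 2) := by
      simp_rw [mul_pow, add_sq]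
      rw [← Finset.mul_sum, Finset.sum_add_distrib, Finset.sum_add_distrib]
      congr 2
      · congr 1
        rw [Finset.mul_sum]
        exact Finset.sum_congr rfl fun y _ => by ring
      · simp [ZMod.card]
    have hDp : (D : ℝ) / p = D * ε ^ 2 := by rw [← hεp]; ring
    have e3 : ∑ y, u y ^ 2 + 2 * (D / p) * ∑ y, u y + p * ((D : ℝ) / p) ^ 2 ≤ 1 + t / 10 := by
      have a1 : 2 * ((D : ℝ) / p) * ∑ y, u y ≤ 2 * (D / p) * (2 * √p) := by gcongr
      have a2 : 2 * ((D : ℝ) / p) * (2 * √p) = 4 * D * ε := by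
        rw [hDp]
        calc _ = 4 * D * ε * (ε * √p) := by ring
          _ = _ := by rw [hεs, mul_one]
      have a3 : p * ((D : ℝ) / p) ^ 2 = D ^ 2 * ε ^ 2 := by
        rw [← hεp]; field_simp
      have a4 : ε ^ 2 ≤ ε := by nlinarith
      have a5 : (D : ℝ) ^ 2 * ε ^ 2 ≤ D ^ 2 * ε := by gcongr
      rw [htdef]
      nlinarith
    rw [e2] at e1
    refine e1.trans ?_
    exact (mul_le_mul_of_nonneg_left e3 (sq_nonneg _)).trans (sq_mul_le_sq_of_le_quarter ht0 ht)
  exact (abs_le_of_sq_le_sq' hfin (by positivity)).2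

theorem zmodHat_zero_left_of_sum_eq_zero {φ : ZMod p → ZMod p → ℝ} (hφ : ∀ y, ∑ x, φ x y = 0)
    (b : ZMod p) : zmodHat (fun x y => (φ x y : ℂ)) 0 b = 0 := by
  rw [zmodHat]
  simp only [zero_mul, zero_add]
  simp_rw [← Finset.sum_mul, ← Complex.ofReal_sum, hφ]
  simp

/-- The square root cancellation in both variables: by homogeneity the sum over `y` is a Gauss sum,
and the remaining sum over `x` is one of the quadratic character of `f x * (a * x + b)`. -/
theorem norm_zmodHat_centeredSign_le (h : IsGoodReduction D f Φ) {a : ZMod p} (ha : a ≠ 0)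
    (b : ZMod p) : ‖zmodHat (fun x y => (centeredSign Φ x y : ℂ)) a b‖ ≤
      10 * ((D : ℝ) + 2) ^ 2 / p := by
  have hpR : (0 : ℝ) < p := by exact_mod_cast (Fact.out : p.Prime).pos
  have hss : √(p : ℝ) * √p = p := Real.mul_self_sqrt hpR.le
  have hs := h.sqrt_pos
  have hD := h.two_le_D
  set S : ZMod p → ℂ := fun y =>
    ∑ x, (centeredSign Φ x y : ℂ) * ZMod.stdAddChar (-(a * x + b * y)) with hS
  set τ := ∑ y : ZMod p, (quadraticChar (ZMod p) y : ℂ) * ZMod.stdAddChar y with hτ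
  have hτ1 : ‖τ‖ ≤ √p := by
    have := norm_sum_quadraticChar_mul_stdAddChar_le h.ne_two 1
    simpa only [one_mul] using this
  have hrow : ∀ y, y ≠ 0 → S y = ∑ x, ((quadraticChar (ZMod p) (f.eval x) : ℂ) *
      ((quadraticChar (ZMod p) y : ℂ) * ZMod.stdAddChar (-(a * x + b) * y)) +
      (if f.eval x = 0 then 1 else 0) * ZMod.stdAddChar (-(a * x + b) * y)) := by
    intro y hy
    have e1 : S y = ∑ x, (squareSign Φ x y : ℂ) * ZMod.stdAddChar (-(a * x + b * y)) := by
      have e2 : ∀ φ : ZMod p → ℂ, ∑ x, φ x * ZMod.stdAddChar (-(a * x + b * y)) =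
          (∑ x, φ x * ZMod.stdAddChar (-(a * x))) * ZMod.stdAddChar (-(b * y)) := by
        intro φ
        rw [Finset.sum_mul]
        refine Finset.sum_congr rfl fun x _ => ?_
        rw [neg_add, AddChar.map_add_eq_mul]
        ring
      rw [hS]
      simp only
      rw [e2, e2, sum_centeredSign_mul ha (by simp [hy])]
    rw [e1, sum_row hy]
    refine Finset.sum_congr rfl fun x _ => ?_
    rw [squareSign, h.quadraticChar_apply_mul, h.apply_mul,
      show -(a * (y * x) + b * y) = -(a * x + b) * y by ring]
    simp only [mul_eq_zero, pow_eq_zero_iff h.odd.pos.ne', hy, false_or]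
    split_ifs <;> push_cast <;> ring
  have hsplit : ∑ y, S y = S 0 + ∑ y ∈ Finset.univ.erase 0, S y := by
    rw [add_comm, Finset.sum_erase_add _ _ (Finset.mem_univ 0)]
  have hmain : ∑ y ∈ Finset.univ.erase 0, S y =
      ∑ x, (quadraticChar (ZMod p) (f.eval x) : ℂ) *
          ((quadraticChar (ZMod p) (-(a * x + b)) : ℂ) * τ)
      + ∑ x, (if f.eval x = 0 then (1 : ℂ) else 0) *
          ∑ y ∈ Finset.univ.erase 0, ZMod.stdAddChar (-(a * x + b) * y) := by
    rw [Finset.sum_congr rfl fun y hy => hrow y (Finset.ne_of_mem_erase hy), Finset.sum_comm,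
      ← Finset.sum_add_distrib]
    refine Finset.sum_congr rfl fun x _ => ?_
    rw [Finset.sum_add_distrib, ← Finset.mul_sum, ← Finset.mul_sum,
      ← sum_quadraticChar_mul_stdAddChar h.ne_two]
    congr 2
    rw [← Finset.sum_erase_add _ _ (Finset.mem_univ (0 : ZMod p))]
    simp
  have hS0 : ‖S 0‖ ≤ 2 * p := by
    refine (norm_sum_le _ _).trans ?_
    calc _ ≤ ∑ x : ZMod p, (2 : ℝ) := by
          refine Finset.sum_le_sum fun x _ => ?_
          rw [norm_mul, norm_stdAddChar, mul_one, Complex.norm_real]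
          exact h.abs_centeredSign_le x 0
      _ = 2 * p := by simp [ZMod.card, mul_comm]
  have hb1 : ‖∑ x, (quadraticChar (ZMod p) (f.eval x) : ℂ) *
      ((quadraticChar (ZMod p) (-(a * x + b)) : ℂ) * τ)‖ ≤ 9 * (D + 2) * p := by
    have e1 : ∑ x, (quadraticChar (ZMod p) (f.eval x) : ℂ) *
        ((quadraticChar (ZMod p) (-(a * x + b)) : ℂ) * τ) =
        ((∑ x, (quadraticChar (ZMod p) ((f * (C (-a) * X + C (-b))).eval x) : ℝ) : ℝ) : ℂ) * τ := by
      push_cast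
      rw [Finset.sum_mul]
      refine Finset.sum_congr rfl fun x _ => ?_
      rw [eval_mul, map_mul (quadraticChar (ZMod p))]
      simp only [eval_add, eval_mul, eval_C, eval_X]
      rw [show -a * x + -b = -(a * x + b) by ring]
      push_cast
      ring
    have hL : (C (-a) * X + C (-b)).natDegree = 1 :=
      natDegree_linear (neg_ne_zero.2 ha)
    have hL0 : C (-a) * X + C (-b) ≠ 0 := by
      intro h0; rw [h0] at hL; simp at hL
    have hdeg : (f * (C (-a) * X + C (-b))).natDegree = f.natDegree + 1 := by
      rw [natDegree_mul h.squarefree.ne_zero hL0, hL]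
    have hw := abs_sum_quadraticChar_le (f * (C (-a) * X + C (-b))) h.ne_two (by omega)
      (h.squarefree.eq_zero_of_mul_linear_mul_sq_eq h.two_le hL)
    rw [e1, norm_mul, Complex.norm_real, Real.norm_eq_abs]
    have hfD : (f.natDegree : ℝ) ≤ D := by exact_mod_cast h.le
    rw [hdeg] at hw
    push_cast at hw
    calc _ ≤ (9 * (f.natDegree + 1 + 1) * √p) * √p :=
          mul_le_mul hw hτ1 (norm_nonneg _) (by positivity)
      _ ≤ (9 * (D + 1 + 1) * √p) * √p := by gcongr
      _ = 9 * (D + 2) * p := by rw [mul_assoc, hss]; ring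
  have hb2 : ‖∑ x, (if f.eval x = 0 then (1 : ℂ) else 0) *
          ∑ y ∈ Finset.univ.erase 0, ZMod.stdAddChar (-(a * x + b) * y)‖ ≤ D * p := by
    refine (norm_sum_le _ _).trans ?_
    calc _ ≤ ∑ x : ZMod p, (if f.eval x = 0 then (1 : ℝ) else 0) * p := by
          refine Finset.sum_le_sum fun x _ => ?_
          rw [norm_mul]
          refine mul_le_mul (by split_ifs <;> simp) ?_ (norm_nonneg _) (by split_ifs <;> simp)
          refine (norm_sum_le _ _).trans ?_
          simp_rw [norm_stdAddChar]
          rw [Finset.sum_const, nsmul_eq_mul, mul_one]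
          have : (Finset.univ.erase (0 : ZMod p)).card ≤ p := by
            refine (Finset.card_le_univ _).trans (le_of_eq (ZMod.card p))
          exact_mod_cast this
      _ = (∑ x : ZMod p, (if f.eval x = 0 then (1 : ℝ) else 0)) * p := by rw [Finset.sum_mul]
      _ ≤ D * p := by gcongr; exact h.card_roots_le
  have htot : ‖∑ y, S y‖ ≤ 10 * ((D : ℝ) + 2) ^ 2 * p := by
    rw [hsplit, hmain]
    refine (norm_add_le _ _).trans ?_
    refine (add_le_add hS0 ((norm_add_le _ _).trans (add_le_add hb1 hb2))).trans ?_
    have : 0 ≤ (10 * ((D : ℝ) + 2) ^ 2 - 2 - 9 * (D + 2) - D) * p :=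
      mul_nonneg (by nlinarith) hpR.le
    linarith
  rw [zmodHat, norm_mul]
  have e2 : ‖(1 / (p : ℂ) ^ 2)‖ = 1 / p ^ 2 := by simp
  rw [e2]
  calc _ ≤ 1 / (p : ℝ) ^ 2 * (10 * ((D : ℝ) + 2) ^ 2 * p) := by gcongr
    _ = _ := by field_simp

end IsGoodReduction

end LocalWeights

/-! ### Fejér weights on `ZMod N` -/

section SieveWeight

variable {N : ℕ} [NeZero N]

/-- A nonnegative weight on `ZMod N`, a normalized Fejér kernel, whose Fourier transform is
nonnegative and supported on the frequencies `-J < h < J`. -/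
noncomputable def sieveWeight (J : ℕ) (x : ZMod N) : ℝ :=
  ‖∑ j ∈ Finset.range J, ZMod.stdAddChar ((j : ZMod N) * x)‖ ^ 2 / (J : ℝ) ^ 2

/-- The Fourier transform of `sieveWeight`. -/
noncomputable def freqWeight (J : ℕ) (h : ZMod N) : ℝ :=
  N / (J : ℝ) ^ 2 * ((Finset.range J ×ˢ Finset.range J).filter
    fun i : ℕ × ℕ => (i.1 : ZMod N) - (i.2 : ZMod N) + h = 0).card

theorem sieveWeight_nonneg (J : ℕ) (x : ZMod N) : 0 ≤ sieveWeight J x := by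
  unfold sieveWeight; positivity

omit [NeZero N] in
theorem freqWeight_nonneg (J : ℕ) (h : ZMod N) : 0 ≤ freqWeight J h := by
  unfold freqWeight; positivity

theorem sum_sieveWeight_mul_stdAddChar (J : ℕ) (h : ZMod N) :
    ∑ x, (sieveWeight J x : ℂ) * ZMod.stdAddChar (h * x) = freqWeight J h := by
  have h1 : ∀ x : ZMod N, (sieveWeight J x : ℂ) * ZMod.stdAddChar (h * x) =
      (1 / (J : ℂ) ^ 2) * ∑ i ∈ Finset.range J ×ˢ Finset.range J,
        ZMod.stdAddChar (((i.1 : ZMod N) - (i.2 : ZMod N) + h) * x) := by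
    intro x
    rw [sieveWeight, Complex.ofReal_div, Complex.ofReal_pow, ← Complex.mul_conj', map_sum,
      Finset.sum_mul_sum, ← Finset.sum_product', Finset.mul_sum, div_mul_eq_mul_div,
      Finset.sum_mul, Finset.sum_div]
    refine Finset.sum_congr rfl fun i _ => ?_
    rw [conj_stdAddChar, show ((i.1 : ZMod N) - (i.2 : ZMod N) + h) * x = i.1 * x + -(i.2 * x) +
        h * x by ring,
      AddChar.map_add_eq_mul, AddChar.map_add_eq_mul]
    push_cast
    ring
  simp_rw [h1, ← Finset.mul_sum]
  rw [Finset.sum_comm]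
  simp_rw [sum_stdAddChar_mul]
  rw [← Finset.sum_filter, freqWeight, Finset.sum_const]
  push_cast
  rw [nsmul_eq_mul]
  ring

theorem sum_stdAddChar_sub_mul (z w : ZMod N) :
    ∑ c : ZMod N, ZMod.stdAddChar ((w - z) * c) = if z = w then (N : ℂ) else 0 := by
  rw [sum_stdAddChar_mul]
  simp only [sub_eq_zero, eq_comm]

theorem card_filter_modEq_le {J d : ℕ} (hd : 0 < d) (j : ℕ) :
    (((Finset.range J).filter fun i => i ≡ j [MOD d]).card : ℝ) ≤ J / d + 1 := by
  rw [← Nat.count_eq_card_filter_range, Nat.count_modEq_card _ hd]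
  have h1 : ((J / d : ℕ) : ℝ) ≤ J / d := Nat.cast_div_le
  split_ifs <;> push_cast <;> linarith

/-- The frequency in `ZMod N` that corresponds to `c : ZMod q`, for `q ∣ N`. -/
def dilate (N : ℕ) {q : ℕ} (c : ZMod q) : ZMod N := ((N / q : ℕ) : ZMod N) * ((c.val : ℕ) : ZMod N)

/-- The characters of `ZMod q` are those of `ZMod N` at the frequencies `dilate N c`. -/
theorem stdAddChar_mul_val {q : ℕ} [NeZero q] (hq : q ∣ N) (c : ZMod q) (x : ZMod N) :
    ZMod.stdAddChar (c * ((x.val : ℕ) : ZMod q)) = ZMod.stdAddChar (dilate N c * x) := by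
  obtain ⟨d, hd⟩ := hq
  have hq0 : (q : ℂ) ≠ 0 := Nat.cast_ne_zero.2 (NeZero.ne q)
  have hN0 : (N : ℂ) ≠ 0 := Nat.cast_ne_zero.2 (NeZero.ne N)
  have hdiv : N / q = d :=
      by rw [hd]; exact Nat.mul_div_cancel_left _ (Nat.pos_of_ne_zero (NeZero.ne q))
  have e1 : c * ((x.val : ℕ) : ZMod q) = (((c.val * x.val : ℕ) : ℤ) : ZMod q) := by
    push_cast; simp
  have e2 : dilate N c * x = (((d * c.val * x.val : ℕ) : ℤ) : ZMod N) := by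
    rw [dilate, hdiv]; push_cast; simp
  rw [e1, e2, ZMod.stdAddChar_coe, ZMod.stdAddChar_coe]
  congr 1
  have hNd : (N : ℂ) = q * d := by rw [← Nat.cast_mul, ← hd]
  have hd0 : (d : ℂ) ≠ 0 := by
    intro h; rw [hNd, h, mul_zero] at hN0; exact hN0 rfl
  rw [hNd]
  push_cast
  field_simp

theorem sum_stdAddChar_dilate {q : ℕ} [NeZero q] (hq : q ∣ N) (x : ZMod N) :
    ∑ c : ZMod q, ZMod.stdAddChar (dilate N c * x) = if q ∣ x.val then (q : ℂ) else 0 := by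
  simp_rw [← stdAddChar_mul_val hq, mul_comm _ ((x.val : ℕ) : ZMod q)]
  rw [sum_stdAddChar_mul]
  simp only [ZMod.natCast_eq_zero_iff]

theorem dilate_injective {q : ℕ} [NeZero q] (hq : q ∣ N) :
    Function.Injective (dilate N : ZMod q → ZMod N) := by
  intro c c' h
  obtain ⟨d, hd⟩ := hq
  have hq0 : 0 < q := Nat.pos_of_ne_zero (NeZero.ne q)
  have hN0 : 0 < N := Nat.pos_of_ne_zero (NeZero.ne N)
  have hdiv : N / q = d := by rw [hd]; exact Nat.mul_div_cancel_left _ hq0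
  have hd0 : 0 < d := by
    rcases Nat.eq_zero_or_pos d with h0 | h0
    · subst h0; omega
    · exact h0
  have hlt : ∀ c : ZMod q, d * c.val < N := by
    intro c
    calc d * c.val < d * q := Nat.mul_lt_mul_of_pos_left (ZMod.val_lt c) hd0
      _ = N := by rw [hd, mul_comm]
  rw [dilate, dilate, hdiv, ← Nat.cast_mul, ← Nat.cast_mul, ZMod.natCast_eq_natCast_iff,
    Nat.ModEq, Nat.mod_eq_of_lt (hlt c), Nat.mod_eq_of_lt (hlt c')] at h
  exact ZMod.val_injective q (Nat.eq_of_mul_eq_mul_left hd0 h)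

omit [NeZero N] in
theorem modEq_of_sub_add_dilate_eq_zero {q : ℕ} [NeZero q] (hq : q ∣ N) {i j : ℕ} {c : ZMod q}
    (h : (i : ZMod N) - (j : ZMod N) + dilate N c = 0) : j ≡ i [MOD N / q] := by
  have hd : N / q ∣ N := Nat.div_dvd_of_dvd hq
  have h1 := congrArg (ZMod.castHom hd (ZMod (N / q))) h
  simp only [dilate, map_add, map_sub, map_mul, map_natCast, map_zero, ZMod.natCast_self, zero_mul,
    add_zero] at h1
  exact ((ZMod.natCast_eq_natCast_iff _ _ _).1 (sub_eq_zero.1 h1)).symm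

omit [NeZero N] in
theorem freqWeight_zero {J : ℕ} (hJ : 0 < J) (hJN : J ≤ N) : freqWeight J (0 : ZMod N) = N / J := by
  have h1 : ((Finset.range J ×ˢ Finset.range J).filter
      fun i : ℕ × ℕ => (i.1 : ZMod N) - (i.2 : ZMod N) + 0 = 0).card = J := by
    have : ((Finset.range J ×ˢ Finset.range J).filter
      fun i : ℕ × ℕ => (i.1 : ZMod N) - (i.2 : ZMod N) + 0 = 0) =
          (Finset.range J).image fun i => (i, i) := by
      ext ⟨i, j⟩
      simp only [Finset.mem_filter, Finset.mem_product, Finset.mem_range, add_zero, sub_eq_zero,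
        Finset.mem_image, Prod.mk.injEq]
      constructor
      · rintro ⟨⟨hi, hj⟩, h⟩
        rw [ZMod.natCast_eq_natCast_iff, Nat.ModEq, Nat.mod_eq_of_lt (by omega),
          Nat.mod_eq_of_lt (by omega)] at h
        exact ⟨i, hi, rfl, h⟩
      · rintro ⟨a, ha, rfl, rfl⟩
        exact ⟨⟨ha, ha⟩, rfl⟩
    rw [this, Finset.card_image_of_injective, Finset.card_range]
    intro a b h
    exact (Prod.mk.inj h).1
  rw [freqWeight, h1]
  have : (J : ℝ) ≠ 0 := by positivity
  field_simp

/-- The frequencies of small denominator lie outside the support of `freqWeight J`. -/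
theorem freqWeight_dilate_eq_zero {J q : ℕ} [NeZero q] (hq : q ∣ N) (hJN : q * J ≤ N) {c : ZMod q}
    (hc : c ≠ 0) : freqWeight J (dilate N c) = 0 := by
  rw [freqWeight]
  have : ((Finset.range J ×ˢ Finset.range J).filter
      fun i : ℕ × ℕ => (i.1 : ZMod N) - (i.2 : ZMod N) + dilate N c = 0) = ∅ := by
    rw [Finset.filter_eq_empty_iff]
    rintro ⟨i, j⟩ hij h
    simp only [Finset.mem_product, Finset.mem_range] at hij
    have h1 : j ≡ i [MOD N / q] := modEq_of_sub_add_dilate_eq_zero hq h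
    have hJd : J ≤ N / q := (Nat.le_div_iff_mul_le (Nat.pos_of_ne_zero (NeZero.ne q))).2
      (by rw [mul_comm]; exact hJN)
    rw [Nat.ModEq, Nat.mod_eq_of_lt (by omega), Nat.mod_eq_of_lt (by omega)] at h1
    subst h1
    simp only [sub_self, zero_add] at h
    apply hc
    apply dilate_injective hq
    rw [h]
    simp [dilate]
  rw [this]
  simp

/-- The sum of `q * sieveWeight` over the multiples of `q`. -/
noncomputable def dvdWeight (N J q : ℕ) [NeZero N] : ℝ :=
  q * ∑ x : ZMod N, if q ∣ x.val then sieveWeight J x else 0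

theorem dvdWeight_eq {J q : ℕ} [NeZero q] (hq : q ∣ N) :
    dvdWeight N J q = ∑ c : ZMod q, freqWeight J (dilate N c) := by
  have h : ((dvdWeight N J q : ℝ) : ℂ) = ((∑ c : ZMod q, freqWeight J (dilate N c) : ℝ) : ℂ) := by
    push_cast
    simp_rw [← sum_sieveWeight_mul_stdAddChar]
    rw [Finset.sum_comm]
    simp_rw [← Finset.mul_sum, sum_stdAddChar_dilate hq]
    rw [dvdWeight]
    push_cast
    rw [Finset.mul_sum]
    refine Finset.sum_congr rfl fun x _ => ?_
    split_ifs <;> simp [mul_comm]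
  exact_mod_cast h

/-- As `freqWeight` is nonnegative, multiples of `q` have at least the expected share of the weight.
-/
theorem le_dvdWeight {J q : ℕ} [NeZero q] (hq : q ∣ N) (hJ : 0 < J) (hJN : J ≤ N) :
    (N : ℝ) / J ≤ dvdWeight N J q := by
  rw [dvdWeight_eq hq, ← freqWeight_zero hJ hJN]
  have : (0 : ZMod N) = dilate N (0 : ZMod q) := by simp [dilate]
  rw [this]
  exact Finset.single_le_sum (f := fun c : ZMod q => freqWeight J (dilate N c))
    (fun c _ => freqWeight_nonneg _ _) (Finset.mem_univ 0)

theorem dvdWeight_le {J q : ℕ} [NeZero q] (hq : q ∣ N) (hJ : 0 < J) :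
    dvdWeight N J q ≤ (N : ℝ) / J + q := by
  rw [dvdWeight_eq hq]
  simp only [freqWeight]
  rw [← Finset.mul_sum]
  have hq0 : 0 < q := Nat.pos_of_ne_zero (NeZero.ne q)
  have hN0 : 0 < N := Nat.pos_of_ne_zero (NeZero.ne N)
  have hd0 : 0 < N / q := Nat.div_pos (Nat.le_of_dvd hN0 hq) hq0
  have hcount : (∑ c : ZMod q, (((Finset.range J ×ˢ Finset.range J).filter
      fun i : ℕ × ℕ => (i.1 : ZMod N) - (i.2 : ZMod N) + dilate N c = 0).card : ℝ)) ≤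
      J * (J / (N / q : ℕ) + 1) := by
    have h1 : ∀ i : ℕ × ℕ, (∑ c : ZMod q,
        if (i.1 : ZMod N) - (i.2 : ZMod N) + dilate N c = 0 then (1 : ℝ) else 0) ≤
        if i.2 ≡ i.1 [MOD N / q] then 1 else 0 := by
      intro i
      by_cases hex : ∃ c : ZMod q, (i.1 : ZMod N) - (i.2 : ZMod N) + dilate N c = 0
      · obtain ⟨c, hc⟩ := hex
        rw [if_pos (modEq_of_sub_add_dilate_eq_zero hq hc), Finset.sum_eq_single c]
        · split_ifs <;> norm_num
        · intro b _ hb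
          rw [if_neg]
          intro h
          apply hb
          apply dilate_injective hq
          exact add_left_cancel (h.trans hc.symm)
        · simp
      · push Not at hex
        simp only [hex, if_false, Finset.sum_const_zero]
        split_ifs <;> norm_num
    calc _ = ∑ i ∈ Finset.range J ×ˢ Finset.range J, ∑ c : ZMod q,
          (if (i.1 : ZMod N) - (i.2 : ZMod N) + dilate N c = 0 then (1 : ℝ) else 0) := by
          rw [Finset.sum_comm]
          refine Finset.sum_congr rfl fun c _ => ?_
          rw [Finset.sum_boole]
      _ ≤ ∑ i ∈ Finset.range J ×ˢ Finset.range J, if i.2 ≡ i.1 [MOD N / q] then (1 : ℝ) else 0 :=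
          Finset.sum_le_sum fun i _ => h1 i
      _ = ∑ i ∈ Finset.range J, (((Finset.range J).filter fun j => j ≡ i [MOD N / q]).card : ℝ) :=
          by
          rw [Finset.sum_product]
          refine Finset.sum_congr rfl fun i _ => ?_
          rw [Finset.sum_boole]
      _ ≤ ∑ i ∈ Finset.range J, ((J : ℝ) / (N / q : ℕ) + 1) :=
          Finset.sum_le_sum fun i _ => card_filter_modEq_le hd0 i
      _ = _ := by simp; ring
  have hJ0 : (0 : ℝ) < J := by positivity
  calc _ ≤ (N : ℝ) / (J : ℝ) ^ 2 * (J * (J / (N / q : ℕ) + 1)) := by gcongr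
    _ = N / J + q := by
      have hq' : (q : ℝ) ≠ 0 := by positivity
      have hN' : (N : ℝ) ≠ 0 := by positivity
      rw [Nat.cast_div hq hq']
      field_simp
      ring

theorem dvdWeight_one {J : ℕ} (hJ : 0 < J) (hJN : J ≤ N) : dvdWeight N J 1 = N / J := by
  rw [dvdWeight_eq (one_dvd N), ← freqWeight_zero hJ hJN]
  have : ∀ c : ZMod 1, c = 0 := fun c => Subsingleton.elim _ _
  rw [Fintype.sum_subsingleton _ (0 : ZMod 1)]
  simp [dilate]

theorem sum_sieveWeight {J : ℕ} (hJ : 0 < J) (hJN : J ≤ N) :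
    ∑ x : ZMod N, sieveWeight J x = N / J := by
  rw [← dvdWeight_one hJ hJN, dvdWeight]
  simp

/-- `sieveWeight J` is equidistributed over the residue classes to small moduli. -/
theorem sum_sieveWeight_mul_val {J q : ℕ} [NeZero q] (hq : q ∣ N) (hJ : 0 < J) (hJN : q * J ≤ N)
    (φ : ZMod q → ℝ) :
    ∑ x : ZMod N, sieveWeight J x * φ ((x.val : ℕ) : ZMod q) = N / J * ((∑ z, φ z) / q) := by
  have hq0 : 0 < q := Nat.pos_of_ne_zero (NeZero.ne q)
  have hqC : (q : ℂ) ≠ 0 := Nat.cast_ne_zero.2 (NeZero.ne q)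
  have hJN' : J ≤ N := le_trans (Nat.le_mul_of_pos_left J hq0) hJN
  have hind : ∀ x : ZMod N, (φ ((x.val : ℕ) : ZMod q) : ℂ) =
      ∑ z : ZMod q, (φ z : ℂ) / q * ∑ c : ZMod q, ZMod.stdAddChar (-(z * c)) *
        ZMod.stdAddChar (dilate N c * x) := by
    intro x
    have h1 : ∀ z : ZMod q, ∑ c : ZMod q, ZMod.stdAddChar (-(z * c)) *
        ZMod.stdAddChar (dilate N c * x) = if z = ((x.val : ℕ) : ZMod q) then (q : ℂ) else 0 := by
      intro z
      simp_rw [← stdAddChar_mul_val hq, ← AddChar.map_add_eq_mul]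
      rw [← sum_stdAddChar_sub_mul z]
      refine Finset.sum_congr rfl fun c _ => ?_
      congr 1
      ring
    simp_rw [h1]
    simp only [mul_ite, mul_zero, Finset.sum_ite_eq', Finset.mem_univ, if_true]
    field_simp
  have hC : ((∑ x : ZMod N, sieveWeight J x * φ ((x.val : ℕ) : ZMod q) : ℝ) : ℂ) =
      ((N / J * ((∑ z, φ z) / q) : ℝ) : ℂ) := by
    push_cast
    simp_rw [hind, Finset.mul_sum]
    rw [Finset.sum_comm]
    rw [Finset.sum_div, Finset.mul_sum]
    refine Finset.sum_congr rfl fun z _ => ?_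
    rw [Finset.sum_comm]
    have h2 : ∀ c : ZMod q, ∑ x : ZMod N, (sieveWeight J x : ℂ) * ((φ z : ℂ) / q *
        (ZMod.stdAddChar (-(z * c)) * ZMod.stdAddChar (dilate N c * x))) =
        (φ z : ℂ) / q * ZMod.stdAddChar (-(z * c)) * freqWeight J (dilate N c) := by
      intro c
      rw [← sum_sieveWeight_mul_stdAddChar, Finset.mul_sum]
      refine Finset.sum_congr rfl fun x _ => ?_
      ring
    simp_rw [h2]
    rw [Finset.sum_eq_single 0]
    · have : dilate N (0 : ZMod q) = 0 := by simp [dilate]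
      rw [this, freqWeight_zero hJ hJN']
      simp
      ring
    · intro c _ hc
      rw [freqWeight_dilate_eq_zero hq hJN hc]
      simp
    · simp
  exact_mod_cast hC

end SieveWeight

/-! ### Majorization of Fourier coefficients -/

section Majorization

variable {N : ℕ} [NeZero N]

/-- `IsMajorized f F`: the function `f` of two variables is a sum of characters
`c i * e (h i * x + l i * y)`, and `F` is the sum of the characters `‖c i‖ * e (h i * x)` and of
further characters with nonnegative coefficients. -/
def IsMajorized (f : ZMod N → ZMod N → ℂ) (F : ZMod N → ℂ) : Prop :=
  ∃ (ι κ : Type) (_ : Fintype ι) (_ : Fintype κ) (c : ι → ℂ) (h l : ι → ZMod N) (d : κ → ℝ)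
    (η : κ → ZMod N), (∀ k, 0 ≤ d k) ∧
    (∀ x y, f x y = ∑ i, c i * ZMod.stdAddChar (h i * x + l i * y)) ∧
    ∀ x, F x = ∑ i, (‖c i‖ : ℂ) * ZMod.stdAddChar (h i * x) +
      ∑ k, (d k : ℂ) * ZMod.stdAddChar (η k * x)

theorem IsMajorized.one : IsMajorized (N := N) (fun _ _ => 1) (fun _ => 1) :=
  ⟨Unit, Empty, inferInstance, inferInstance, fun _ => 1, fun _ => 0, fun _ => 0, fun _ => 0,
    fun _ => 0, fun _ => le_rfl, by simp, by simp⟩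

theorem IsMajorized.mul {f g : ZMod N → ZMod N → ℂ} {F G : ZMod N → ℂ} (hf : IsMajorized f F)
    (hg : IsMajorized g G) :
    IsMajorized (fun x y => f x y * g x y) (fun x => F x * G x) := by
  obtain ⟨ι, κ, _, _, c, h, l, d, η, hd, hfe, hFe⟩ := hf
  obtain ⟨ι', κ', _, _, c', h', l', d', η', hd', hge, hGe⟩ := hg
  refine ⟨ι × ι', (ι × κ') ⊕ (κ × ι') ⊕ (κ × κ'), inferInstance, inferInstance,
    fun i => c i.1 * c' i.2, fun i => h i.1 + h' i.2, fun i => l i.1 + l' i.2,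
    Sum.elim (fun i => ‖c i.1‖ * d' i.2)
      (Sum.elim (fun i => d i.1 * ‖c' i.2‖) (fun i => d i.1 * d' i.2)),
    Sum.elim (fun i => h i.1 + η' i.2)
      (Sum.elim (fun i => η i.1 + h' i.2) (fun i => η i.1 + η' i.2)), ?_, ?_, ?_⟩
  · rintro (i | i | i)
    · exact mul_nonneg (norm_nonneg _) (hd' _)
    · exact mul_nonneg (hd _) (norm_nonneg _)
    · exact mul_nonneg (hd _) (hd' _)
  · intro x y
    beta_reduce
    rw [hfe, hge, Finset.sum_mul_sum, Fintype.sum_prod_type]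
    refine Finset.sum_congr rfl fun i _ => Finset.sum_congr rfl fun j _ => ?_
    rw [show (h i + h' j) * x + (l i + l' j) * y = (h i * x + l i * y) + (h' j * x + l' j * y) by
      ring, AddChar.map_add_eq_mul _ (h i * x + l i * y)]
    ring
  · intro x
    beta_reduce
    rw [hFe, hGe, add_mul, mul_add, mul_add, Finset.sum_mul_sum, Finset.sum_mul_sum,
      Finset.sum_mul_sum, Finset.sum_mul_sum, Fintype.sum_prod_type, Fintype.sum_sum_type,
      Fintype.sum_sum_type, Fintype.sum_prod_type, Fintype.sum_prod_type, Fintype.sum_prod_type]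
    rw [add_assoc]
    congr 1
    · refine Finset.sum_congr rfl fun i _ => Finset.sum_congr rfl fun j _ => ?_
      rw [add_mul, AddChar.map_add_eq_mul, norm_mul]
      push_cast
      ring
    · congr 1
      · refine Finset.sum_congr rfl fun i _ => Finset.sum_congr rfl fun j _ => ?_
        simp only [Sum.elim_inl]
        rw [add_mul, AddChar.map_add_eq_mul]
        push_cast
        ring
      · congr 1
        · refine Finset.sum_congr rfl fun i _ => Finset.sum_congr rfl fun j _ => ?_
          simp only [Sum.elim_inl, Sum.elim_inr]
          rw [add_mul, AddChar.map_add_eq_mul]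
          push_cast
          ring
        · refine Finset.sum_congr rfl fun i _ => Finset.sum_congr rfl fun j _ => ?_
          simp only [Sum.elim_inr]
          rw [add_mul, AddChar.map_add_eq_mul]
          push_cast
          ring

theorem IsMajorized.prod {ι : Type*} (S : Finset ι) (f : ι → ZMod N → ZMod N → ℂ)
    (F : ι → ZMod N → ℂ) (h : ∀ i ∈ S, IsMajorized (f i) (F i)) :
    IsMajorized (fun x y => ∏ i ∈ S, f i x y) (fun x => ∏ i ∈ S, F i x) := by
  classical
  induction S using Finset.induction_on with
  | empty => simpa using IsMajorized.one
  | insert a S ha ih =>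
    simp_rw [Finset.prod_insert ha]
    exact (h a (Finset.mem_insert_self _ _)).mul
      (ih fun i hi => h i (Finset.mem_insert_of_mem hi))

/-- The Fourier expansion on `ZMod N` of a function on `(ZMod r)²`, for `r ∣ N`. -/
theorem eq_sum_dilate {r : ℕ} [NeZero r] (hr : r ∣ N) (u : ZMod r → ZMod r → ℂ) (x y : ZMod N) :
    u ((x.val : ℕ) : ZMod r) ((y.val : ℕ) : ZMod r) =
      ∑ i : ZMod r × ZMod r, zmodHat u i.1 i.2 *
        ZMod.stdAddChar (dilate N i.1 * x + dilate N i.2 * y) := by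
  rw [zmodHat_inversion u, Fintype.sum_prod_type]
  refine Finset.sum_congr rfl fun a _ => Finset.sum_congr rfl fun b _ => ?_
  rw [AddChar.map_add_eq_mul, AddChar.map_add_eq_mul, stdAddChar_mul_val hr, stdAddChar_mul_val hr]

/-- The majorant of a function on `(ZMod r)²` is `A * r` times the indicator of the multiples of
`r`, if `A` bounds the sums of its absolute Fourier coefficients over the second frequency. -/
theorem isMajorized_local {r : ℕ} [NeZero r] (hr : r ∣ N) (u : ZMod r → ZMod r → ℂ) (A : ℝ)
    (hA : ∀ a, ∑ b, ‖zmodHat u a b‖ ≤ A) :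
    IsMajorized (N := N) (fun x y => u ((x.val : ℕ) : ZMod r) ((y.val : ℕ) : ZMod r))
      (fun x => (A : ℂ) * if r ∣ x.val then (r : ℂ) else 0) := by
  refine ⟨ZMod r × ZMod r, ZMod r, inferInstance, inferInstance, fun i => zmodHat u i.1 i.2,
    fun i => dilate N i.1, fun i => dilate N i.2, fun a => A - ∑ b, ‖zmodHat u a b‖,
    fun a => dilate N a, fun a => sub_nonneg.2 (hA a), eq_sum_dilate hr u, ?_⟩
  intro x
  beta_reduce
  rw [← sum_stdAddChar_dilate hr, Fintype.sum_prod_type, ← Finset.sum_add_distrib, Finset.mul_sum]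
  refine Finset.sum_congr rfl fun a _ => ?_
  simp only
  rw [← Finset.sum_mul]
  push_cast
  ring

theorem prod_ite_dvd {S : Finset ℕ} (hS : ∀ r ∈ S, r.Prime) (n : ℕ) (A : ℕ → ℝ) :
    ∏ r ∈ S, ((A r : ℂ) * if r ∣ n then (r : ℂ) else 0) =
      ((∏ r ∈ S, A r : ℝ) : ℂ) * if (∏ r ∈ S, r) ∣ n then ((∏ r ∈ S, r : ℕ) : ℂ) else 0 := by
  rw [Finset.prod_mul_distrib]
  push_cast
  congr 1
  by_cases h : ∀ r ∈ S, r ∣ n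
  · rw [if_pos (Finset.prod_primes_dvd n (fun r hr => (hS r hr).prime) h)]
    exact Finset.prod_congr rfl fun r hr => if_pos (h r hr)
  · push Not at h
    obtain ⟨r, hr, hrn⟩ := h
    rw [if_neg fun h => hrn ((Finset.dvd_prod_of_mem _ hr).trans h)]
    exact Finset.prod_eq_zero hr (if_neg hrn)

/-- The weighted sum of `f` against two functions `u` and `v` of mean zero with small Fourier
coefficients. Since the weights have nonnegative Fourier transforms, all Fourier coefficients may be
replaced by larger ones: `f` by its majorant, and `u` and `v` by multiples of `p * 1_{p ∣ x} - 1`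
and `q * 1_{q ∣ x} - 1`. -/
theorem norm_sum_mul_le_of_isMajorized {p q : ℕ} [NeZero p] [NeZero q] (hp : p ∣ N) (hq : q ∣ N)
    (hpq : p.Coprime q) (J J' : ℕ)
    (u : ZMod p → ZMod p → ℂ) (v : ZMod q → ZMod q → ℂ) (C C' : ℝ)
    (hu0 : ∀ b, zmodHat u 0 b = 0) (hu : ∀ a ≠ 0, ∀ b, ‖zmodHat u a b‖ ≤ C)
    (hv0 : ∀ b, zmodHat v 0 b = 0) (hv : ∀ a ≠ 0, ∀ b, ‖zmodHat v a b‖ ≤ C')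
    (hC : 0 ≤ C) (hC' : 0 ≤ C') (f : ZMod N → ZMod N → ℂ) (F : ZMod N → ℂ)
    (hf : IsMajorized f F) :
    ‖∑ x : ZMod N, ∑ y : ZMod N, (sieveWeight J x : ℂ) * sieveWeight J' y * f x y *
      u ((x.val : ℕ) : ZMod p) ((y.val : ℕ) : ZMod p) *
      v ((x.val : ℕ) : ZMod q) ((y.val : ℕ) : ZMod q)‖ ≤
    C * C' * (∑ x : ZMod N, (sieveWeight J x : ℂ) * F x * ((if p ∣ x.val then (p : ℂ) else 0) - 1) *
      ((if q ∣ x.val then (q : ℂ) else 0) - 1)).re * dvdWeight N J' (p * q) := by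
  classical
  obtain ⟨ι, κ, _, _, c, h, l, d, η, hd, hfe, hFe⟩ := hf
  set Y : ZMod N → ℝ := fun m => ∑ b : ZMod p, ∑ b' : ZMod q,
    freqWeight J' (m + dilate N b + dilate N b') with hY
  set Z : ZMod N → ℝ := fun m => ∑ a ∈ (Finset.univ : Finset (ZMod p)).erase 0,
    ∑ a' ∈ (Finset.univ : Finset (ZMod q)).erase 0,
    freqWeight J (m + dilate N a + dilate N a') with hZ
  have hZ0 : ∀ m, 0 ≤ Z m := fun m => Finset.sum_nonneg fun a _ => Finset.sum_nonneg fun a' _ =>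
    freqWeight_nonneg _ _
  -- `Y` is the Fourier transform of a nonnegative function, hence largest at `0`
  have hYle : ∀ m, Y m ≤ dvdWeight N J' (p * q) := by
    intro m
    have e1 : ((Y m : ℝ) : ℂ) = ∑ y : ZMod N, (sieveWeight J' y : ℂ) *
        (if p * q ∣ y.val then ((p * q : ℕ) : ℂ) else 0) * ZMod.stdAddChar (m * y) := by
      rw [hY]
      push_cast
      simp_rw [← sum_sieveWeight_mul_stdAddChar]
      calc _ = ∑ b : ZMod p, ∑ x : ZMod N, ∑ b' : ZMod q, (sieveWeight J' x : ℂ) *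
            ZMod.stdAddChar ((m + dilate N b + dilate N b') * x) :=
            Finset.sum_congr rfl fun b _ => Finset.sum_comm
        _ = ∑ x : ZMod N, ∑ b : ZMod p, ∑ b' : ZMod q, (sieveWeight J' x : ℂ) *
            ZMod.stdAddChar ((m + dilate N b + dilate N b') * x) := Finset.sum_comm
        _ = _ := by
          refine Finset.sum_congr rfl fun x _ => ?_
          have e2 : (if p * q ∣ x.val then ((p : ℂ) * (q : ℂ)) else 0) =
              (if p ∣ x.val then (p : ℂ) else 0) * (if q ∣ x.val then (q : ℂ) else 0) := by
            by_cases h1 : p ∣ x.val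
            · by_cases h2 : q ∣ x.val
              · rw [if_pos h1, if_pos h2, if_pos (hpq.mul_dvd_of_dvd_of_dvd h1 h2)]
              · rw [if_neg h2, if_neg fun h => h2 ((dvd_mul_left q p).trans h), mul_zero]
            · rw [if_neg h1, if_neg fun h => h1 ((dvd_mul_right p q).trans h), zero_mul]
          rw [e2, ← sum_stdAddChar_dilate hp, ← sum_stdAddChar_dilate hq, Finset.sum_mul_sum,
            Finset.mul_sum, Finset.sum_mul]
          refine Finset.sum_congr rfl fun b _ => ?_
          rw [Finset.mul_sum, Finset.sum_mul]
          refine Finset.sum_congr rfl fun b' _ => ?_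
          rw [add_mul, add_mul, AddChar.map_add_eq_mul, AddChar.map_add_eq_mul]
          ring
    calc Y m ≤ ‖((Y m : ℝ) : ℂ)‖ := by rw [Complex.norm_real]; exact le_abs_self _
      _ ≤ ∑ y : ZMod N, ‖(sieveWeight J' y : ℂ) *
        (if p * q ∣ y.val then ((p * q : ℕ) : ℂ) else 0) * ZMod.stdAddChar (m * y)‖ := by
          rw [e1]; exact norm_sum_le _ _
      _ = dvdWeight N J' (p * q) := by
          rw [dvdWeight, Finset.mul_sum]
          refine Finset.sum_congr rfl fun y _ => ?_
          rw [norm_mul, norm_stdAddChar, mul_one, norm_mul, Complex.norm_real, Real.norm_eq_abs,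
            abs_of_nonneg (sieveWeight_nonneg _ _)]
          split_ifs
          · rw [Complex.norm_natCast]; ring
          · simp
  have hY0 : 0 ≤ dvdWeight N J' (p * q) := by
    refine le_trans ?_ (hYle 0)
    exact Finset.sum_nonneg fun a _ => Finset.sum_nonneg fun a' _ => freqWeight_nonneg _ _
  -- `p * 1_{p ∣ x} - 1` is the sum of the nontrivial characters modulo `p`
  have hZeq : ∀ m, ((Z m : ℝ) : ℂ) = ∑ x : ZMod N, (sieveWeight J x : ℂ) *
      ZMod.stdAddChar (m * x) * ((if p ∣ x.val then (p : ℂ) else 0) - 1) *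
      ((if q ∣ x.val then (q : ℂ) else 0) - 1) := by
    intro m
    have er : ∀ {r : ℕ} [NeZero r] (hr : r ∣ N) (x : ZMod N),
        (if r ∣ x.val then (r : ℂ) else 0) - 1 = ∑ a ∈ (Finset.univ : Finset (ZMod r)).erase 0,
          ZMod.stdAddChar (dilate N a * x) := by
      intro r _ hr x
      rw [← sum_stdAddChar_dilate hr, ← Finset.sum_erase_add _ _ (Finset.mem_univ (0 : ZMod r))]
      simp [dilate]
    rw [hZ]
    push_cast
    simp_rw [← sum_sieveWeight_mul_stdAddChar]
    calc _ = ∑ a ∈ (Finset.univ : Finset (ZMod p)).erase 0, ∑ x : ZMod N,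
          ∑ a' ∈ (Finset.univ : Finset (ZMod q)).erase 0, (sieveWeight J x : ℂ) *
            ZMod.stdAddChar ((m + dilate N a + dilate N a') * x) :=
          Finset.sum_congr rfl fun b _ => Finset.sum_comm
      _ = ∑ x : ZMod N, ∑ a ∈ (Finset.univ : Finset (ZMod p)).erase 0,
          ∑ a' ∈ (Finset.univ : Finset (ZMod q)).erase 0, (sieveWeight J x : ℂ) *
            ZMod.stdAddChar ((m + dilate N a + dilate N a') * x) := Finset.sum_comm
      _ = _ := by
          refine Finset.sum_congr rfl fun x _ => ?_
          rw [er hp, er hq, mul_assoc, Finset.sum_mul_sum, Finset.mul_sum]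
          refine Finset.sum_congr rfl fun b _ => ?_
          rw [Finset.mul_sum]
          refine Finset.sum_congr rfl fun b' _ => ?_
          rw [add_mul, add_mul, AddChar.map_add_eq_mul, AddChar.map_add_eq_mul]
          ring
  -- the contribution of a single character of `f`
  have hE : ∀ m n : ZMod N, ‖∑ x : ZMod N, ∑ y : ZMod N, (sieveWeight J x : ℂ) *
      sieveWeight J' y * ZMod.stdAddChar (m * x + n * y) *
      u ((x.val : ℕ) : ZMod p) ((y.val : ℕ) : ZMod p) *
      v ((x.val : ℕ) : ZMod q) ((y.val : ℕ) : ZMod q)‖ ≤ C * C' * Z m * dvdWeight N J' (p * q) := by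
    intro m n
    have e1 : ∑ x : ZMod N, ∑ y : ZMod N, (sieveWeight J x : ℂ) *
        sieveWeight J' y * ZMod.stdAddChar (m * x + n * y) *
        u ((x.val : ℕ) : ZMod p) ((y.val : ℕ) : ZMod p) *
        v ((x.val : ℕ) : ZMod q) ((y.val : ℕ) : ZMod q) =
        ∑ i : ZMod p × ZMod p, ∑ j : ZMod q × ZMod q, zmodHat u i.1 i.2 * zmodHat v j.1 j.2 *
          freqWeight J (m + dilate N i.1 + dilate N j.1) *
          freqWeight J' (n + dilate N i.2 + dilate N j.2) := by
      simp_rw [← sum_sieveWeight_mul_stdAddChar]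
      have e2 : ∀ x y : ZMod N, (sieveWeight J x : ℂ) *
          sieveWeight J' y * ZMod.stdAddChar (m * x + n * y) *
          u ((x.val : ℕ) : ZMod p) ((y.val : ℕ) : ZMod p) *
          v ((x.val : ℕ) : ZMod q) ((y.val : ℕ) : ZMod q) =
          ∑ i : ZMod p × ZMod p, ∑ j : ZMod q × ZMod q, zmodHat u i.1 i.2 * zmodHat v j.1 j.2 *
          (((sieveWeight J x : ℂ) * ZMod.stdAddChar ((m + dilate N i.1 + dilate N j.1) * x)) *
          ((sieveWeight J' y : ℂ) * ZMod.stdAddChar ((n + dilate N i.2 + dilate N j.2) * y))) := by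
        intro x y
        rw [eq_sum_dilate hp u, eq_sum_dilate hq v, mul_assoc _ (∑ i : ZMod p × ZMod p, _),
          Finset.sum_mul_sum, Finset.mul_sum]
        refine Finset.sum_congr rfl fun i _ => ?_
        rw [Finset.mul_sum]
        refine Finset.sum_congr rfl fun j _ => ?_
        have e3 : ZMod.stdAddChar ((m + dilate N i.1 + dilate N j.1) * x) *
            ZMod.stdAddChar ((n + dilate N i.2 + dilate N j.2) * y) =
            ZMod.stdAddChar (m * x + n * y) *
            (ZMod.stdAddChar (dilate N i.1 * x + dilate N i.2 * y) *
            ZMod.stdAddChar (dilate N j.1 * x + dilate N j.2 * y)) := by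
          rw [← AddChar.map_add_eq_mul, ← AddChar.map_add_eq_mul, ← AddChar.map_add_eq_mul]
          congr 1
          ring
        calc _ = zmodHat u i.1 i.2 * zmodHat v j.1 j.2 * ((sieveWeight J x : ℂ) *
              sieveWeight J' y) * (ZMod.stdAddChar (m * x + n * y) *
            (ZMod.stdAddChar (dilate N i.1 * x + dilate N i.2 * y) *
            ZMod.stdAddChar (dilate N j.1 * x + dilate N j.2 * y))) := by ring
          _ = _ := by rw [← e3]; ring
      simp_rw [e2]
      calc _ = ∑ x : ZMod N, ∑ i : ZMod p × ZMod p, ∑ j : ZMod q × ZMod q, ∑ y : ZMod N,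
            zmodHat u i.1 i.2 * zmodHat v j.1 j.2 *
          (((sieveWeight J x : ℂ) * ZMod.stdAddChar ((m + dilate N i.1 + dilate N j.1) * x)) *
          ((sieveWeight J' y : ℂ) * ZMod.stdAddChar ((n + dilate N i.2 + dilate N j.2) * y))) := by
            refine Finset.sum_congr rfl fun x _ => ?_
            rw [Finset.sum_comm]
            refine Finset.sum_congr rfl fun i _ => ?_
            rw [Finset.sum_comm]
        _ = _ := by
            rw [Finset.sum_comm]
            refine Finset.sum_congr rfl fun i _ => ?_
            rw [Finset.sum_comm]
            refine Finset.sum_congr rfl fun j _ => ?_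
            rw [mul_assoc, Finset.sum_mul_sum, Finset.mul_sum]
            refine Finset.sum_congr rfl fun x _ => ?_
            rw [Finset.mul_sum]
    rw [e1]
    have e4 : ∀ (i : ZMod p × ZMod p) (j : ZMod q × ZMod q),
        ‖zmodHat u i.1 i.2 * zmodHat v j.1 j.2 *
          freqWeight J (m + dilate N i.1 + dilate N j.1) *
          freqWeight J' (n + dilate N i.2 + dilate N j.2)‖ ≤
        C * C' * ((if i.1 = 0 then 0 else if j.1 = 0 then 0 else
          freqWeight J (m + dilate N i.1 + dilate N j.1)) *
          freqWeight J' (n + dilate N i.2 + dilate N j.2)) := by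
      intro i j
      have f1 := freqWeight_nonneg J (m + dilate N i.1 + dilate N j.1)
      have f2 := freqWeight_nonneg J' (n + dilate N i.2 + dilate N j.2)
      rw [norm_mul, norm_mul, norm_mul, Complex.norm_real, Complex.norm_real, Real.norm_eq_abs,
        Real.norm_eq_abs, abs_of_nonneg f1, abs_of_nonneg f2]
      split_ifs with h1 h2
      · rw [h1, hu0]; simp
      · rw [h2, hv0]; simp
      · rw [mul_assoc (‖zmodHat u i.1 i.2‖ * ‖zmodHat v j.1 j.2‖)]
        refine mul_le_mul_of_nonneg_right ?_ (mul_nonneg f1 f2)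
        exact mul_le_mul (hu _ h1 _) (hv _ h2 _) (norm_nonneg _) hC
    have e5 : ∑ i : ZMod p × ZMod p, ∑ j : ZMod q × ZMod q, C * C' * ((if i.1 = 0 then 0 else
          if j.1 = 0 then 0 else freqWeight J (m + dilate N i.1 + dilate N j.1)) *
          freqWeight J' (n + dilate N i.2 + dilate N j.2)) = C * C' * (Z m * Y n) := by
      have z1 : Z m = ∑ a : ZMod p, ∑ a' : ZMod q, if a = 0 then 0 else
          if a' = 0 then 0 else freqWeight J (m + dilate N a + dilate N a') := by
        have zr : ∀ {r : ℕ} [NeZero r] (φ : ZMod r → ℝ), ∑ a ∈ Finset.univ.erase 0, φ a =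
            ∑ a, if a = 0 then 0 else φ a := by
          intro r _ φ
          rw [← Finset.sum_erase_add (a := (0 : ZMod r)) _ _ (Finset.mem_univ _), if_pos rfl,
            add_zero]
          exact Finset.sum_congr rfl fun a ha => (if_neg (Finset.ne_of_mem_erase ha)).symm
        rw [hZ]
        simp only
        rw [zr]
        refine Finset.sum_congr rfl fun a _ => ?_
        split_ifs
        · simp
        · rw [zr]
      rw [z1, hY]
      simp_rw [← Finset.mul_sum]
      congr 1
      rw [Fintype.sum_prod_type, Finset.sum_mul]
      refine Finset.sum_congr rfl fun a _ => ?_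
      rw [Finset.mul_sum]
      refine Finset.sum_congr rfl fun b _ => ?_
      rw [Fintype.sum_prod_type, Finset.sum_mul]
      refine Finset.sum_congr rfl fun a' _ => ?_
      rw [Finset.mul_sum]
    calc _ ≤ ∑ i : ZMod p × ZMod p, ∑ j : ZMod q × ZMod q, C * C' * ((if i.1 = 0 then 0 else
          if j.1 = 0 then 0 else freqWeight J (m + dilate N i.1 + dilate N j.1)) *
          freqWeight J' (n + dilate N i.2 + dilate N j.2)) :=
          (norm_sum_le _ _).trans (Finset.sum_le_sum fun i _ =>
            (norm_sum_le _ _).trans (Finset.sum_le_sum fun j _ => e4 i j))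
      _ = C * C' * (Z m * Y n) := e5
      _ ≤ C * C' * (Z m * dvdWeight N J' (p * q)) := by
          have := hZ0 m
          have := hYle n
          gcongr
      _ = _ := by ring
  have hsumE : ∑ x : ZMod N, ∑ y : ZMod N, (sieveWeight J x : ℂ) * sieveWeight J' y * f x y *
      u ((x.val : ℕ) : ZMod p) ((y.val : ℕ) : ZMod p) *
      v ((x.val : ℕ) : ZMod q) ((y.val : ℕ) : ZMod q) = ∑ i, c i *
      ∑ x : ZMod N, ∑ y : ZMod N, (sieveWeight J x : ℂ) *
      sieveWeight J' y * ZMod.stdAddChar (h i * x + l i * y) *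
      u ((x.val : ℕ) : ZMod p) ((y.val : ℕ) : ZMod p) *
      v ((x.val : ℕ) : ZMod q) ((y.val : ℕ) : ZMod q) := by
    simp_rw [Finset.mul_sum]
    rw [Finset.sum_comm (s := (Finset.univ : Finset ι))]
    refine Finset.sum_congr rfl fun x _ => ?_
    rw [Finset.sum_comm]
    refine Finset.sum_congr rfl fun y _ => ?_
    rw [hfe, Finset.mul_sum, Finset.sum_mul, Finset.sum_mul]
    refine Finset.sum_congr rfl fun i _ => ?_
    ring
  have hsumZ : (∑ x : ZMod N, (sieveWeight J x : ℂ) * F x *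
      ((if p ∣ x.val then (p : ℂ) else 0) - 1) *
      ((if q ∣ x.val then (q : ℂ) else 0) - 1)).re = ∑ i, ‖c i‖ * Z (h i) + ∑ k, d k * Z (η k) := by
    have : (∑ x : ZMod N, (sieveWeight J x : ℂ) * F x * ((if p ∣ x.val then (p : ℂ) else 0) - 1) *
      ((if q ∣ x.val then (q : ℂ) else 0) - 1)) =
        ((∑ i, ‖c i‖ * Z (h i) + ∑ k, d k * Z (η k) : ℝ) : ℂ) := by
      push_cast
      simp_rw [hZeq, Finset.mul_sum]
      rw [Finset.sum_comm (s := (Finset.univ : Finset ι)),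
        Finset.sum_comm (s := (Finset.univ : Finset κ)), ← Finset.sum_add_distrib]
      refine Finset.sum_congr rfl fun x _ => ?_
      rw [hFe, mul_add, add_mul, add_mul, Finset.mul_sum, Finset.mul_sum, Finset.sum_mul,
        Finset.sum_mul, Finset.sum_mul, Finset.sum_mul]
      congr 1
      · exact Finset.sum_congr rfl fun i _ => by ring
      · exact Finset.sum_congr rfl fun i _ => by ring
    rw [this, Complex.ofReal_re]
  rw [hsumE, hsumZ]
  calc _ ≤ ∑ i, ‖c i‖ * (C * C' * Z (h i) * dvdWeight N J' (p * q)) := by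
        refine (norm_sum_le _ _).trans (Finset.sum_le_sum fun i _ => ?_)
        rw [norm_mul]
        exact mul_le_mul_of_nonneg_left (hE _ _) (norm_nonneg _)
    _ = C * C' * (∑ i, ‖c i‖ * Z (h i)) * dvdWeight N J' (p * q) := by
        rw [Finset.mul_sum, Finset.sum_mul]
        exact Finset.sum_congr rfl fun i _ => by ring
    _ ≤ _ := by
        have : 0 ≤ ∑ k, d k * Z (η k) := Finset.sum_nonneg fun k _ => mul_nonneg (hd k) (hZ0 _)
        gcongr
        linarith

end Majorization

/-! ### Products of local functions over several primes -/

section Lift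

/-- The product over the primes `r ∣ k` of the functions `u r`, read at residues of integers. -/
noncomputable def liftProd {N : ℕ} (u : ∀ r : ℕ, ZMod r → ZMod r → ℝ) (k : ℕ) (x y : ZMod N) : ℝ :=
  ∏ r ∈ k.primeFactors, u r ((x.val : ℕ) : ZMod r) ((y.val : ℕ) : ZMod r)

theorem ZMod.sum_eq_sum_range {n : ℕ} [NeZero n] (φ : ZMod n → ℝ) :
    ∑ z, φ z = ∑ i ∈ Finset.range n, φ (i : ZMod n) := by
  symm
  refine Finset.sum_bij (fun i _ => (i : ZMod n)) (fun _ _ => Finset.mem_univ _) ?_ ?_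
    (fun _ _ => rfl)
  · intro i hi j hj h
    rw [Finset.mem_range] at hi hj
    rw [ZMod.natCast_eq_natCast_iff'] at h
    rwa [Nat.mod_eq_of_lt hi, Nat.mod_eq_of_lt hj] at h
  · intro z _
    exact ⟨z.val, Finset.mem_range.2 (ZMod.val_lt z), by simp⟩

/-- The Chinese remainder theorem for sums of products. -/
theorem sum_range_prod {S : Finset ℕ} (hS : ∀ r ∈ S, r.Prime) (v : ∀ r : ℕ, ZMod r → ℝ) :
    ∑ i ∈ Finset.range (∏ r ∈ S, r), ∏ r ∈ S, v r (i : ZMod r) =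
      ∏ r ∈ S, ∑ i ∈ Finset.range r, v r (i : ZMod r) := by
  classical
  have hne : ∀ i : S, NeZero (i : ℕ) := fun i => ⟨(hS i i.2).ne_zero⟩
  have hne' : NeZero (∏ i : S, (i : ℕ)) := ⟨Finset.prod_ne_zero_iff.2 fun i _ => (hne i).ne⟩
  have hco : Pairwise (Function.onFun Nat.Coprime fun i : S => (i : ℕ)) := by
    intro i j hij
    exact (Nat.coprime_primes (hS i i.2) (hS j j.2)).2 fun h => hij (Subtype.ext h)
  rw [← Finset.prod_coe_sort S (fun r => r),
    ← Finset.prod_coe_sort S (fun r => ∑ i ∈ Finset.range r, v r (i : ZMod r))]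
  simp_rw [← ZMod.sum_eq_sum_range]
  rw [Finset.prod_univ_sum, Fintype.piFinset_univ]
  rw [← (ZMod.prodEquivPi _ hco).toEquiv.sum_comp, ZMod.sum_eq_sum_range]
  refine Finset.sum_congr rfl fun i _ => ?_
  rw [← Finset.prod_coe_sort S (fun r => v r (i : ZMod r))]
  refine Finset.prod_congr rfl fun r _ => ?_
  have e := ZMod.prodEquivPi_apply (fun i : S => (i : ℕ)) hco (i : ZMod _) r
  exact congrArg (v r) ((map_natCast (ZMod.castHom _ (ZMod (r : ℕ))) i).symm.trans e.symm)

variable {N : ℕ} [NeZero N]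

theorem sum_sieveWeight_mul_prod {J : ℕ} {S : Finset ℕ} (hS : ∀ r ∈ S, r.Prime)
    (v : ∀ r : ℕ, ZMod r → ℝ) (hN : (∏ r ∈ S, r) ∣ N) (hJ : 0 < J) (hJN : (∏ r ∈ S, r) * J ≤ N) :
    ∑ x : ZMod N, sieveWeight J x * ∏ r ∈ S, v r ((x.val : ℕ) : ZMod r) =
      N / J * ∏ r ∈ S, ((∑ i ∈ Finset.range r, v r (i : ZMod r)) / r) := by
  have : NeZero (∏ r ∈ S, r) := ⟨Finset.prod_ne_zero_iff.2 fun i hi => (hS i hi).ne_zero⟩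
  have h := sum_sieveWeight_mul_val hN hJ hJN
    (fun z => ∏ r ∈ S, v r ((z.val : ℕ) : ZMod r))
  have h1 : ∀ x : ZMod N, ∏ r ∈ S, v r (((((x.val : ℕ) : ZMod (∏ r ∈ S, r)).val : ℕ)) : ZMod r) =
      ∏ r ∈ S, v r ((x.val : ℕ) : ZMod r) := by
    intro x
    refine Finset.prod_congr rfl fun r hr => ?_
    congr 1
    rw [ZMod.natCast_eq_natCast_iff, ZMod.val_natCast]
    exact (Nat.mod_modEq _ _).of_dvd (Finset.dvd_prod_of_mem _ hr)
  simp_rw [h1] at h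
  rw [h, Finset.prod_div_distrib, ← sum_range_prod hS, ZMod.sum_eq_sum_range]
  congr 2
  · refine Finset.sum_congr rfl fun i hi => ?_
    rw [ZMod.val_natCast, Nat.mod_eq_of_lt (Finset.mem_range.1 hi)]
  · push_cast; rfl

end Lift

/-- The local properties at the prime `r` of the pair of functions `u` and `G` used in the sieve.
The function `u` enters products over many primes, so that the constant `h` has to be close to `1`.
The function `G` occurs only once in a product, for which a constant `C` is good enough, but it has
to have square root cancellation in both variables. -/
structure IsSievePair (r : ℕ) [NeZero r] (u G : ZMod r → ZMod r → ℝ) (h C : ℝ) : Prop where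
  sum_left : ∀ y, ∑ x, u x y = 0
  sum_left_sq : ∀ y, ∑ x, u x y ^ 2 ≤ r * h
  norm_hat_left : ∀ a, ∑ b, ‖zmodHat (fun x y => (u x y : ℂ)) a b‖ ≤ h
  abs_right : ∀ x y, |G x y| ≤ 2
  hat_right_zero : ∀ b, zmodHat (fun x y => (G x y : ℂ)) 0 b = 0
  norm_hat_right : ∀ a ≠ 0, ∀ b, ‖zmodHat (fun x y => (G x y : ℂ)) a b‖ ≤ C / r

theorem IsSievePair.nonneg {r : ℕ} [NeZero r] {u G : ZMod r → ZMod r → ℝ} {h C : ℝ}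
    (hu : IsSievePair r u G h C) : 0 ≤ h :=
  (Finset.sum_nonneg fun _ _ => norm_nonneg _).trans (hu.norm_hat_left 0)

/-- The multiplicative extension of `h` to squarefree numbers. -/
noncomputable def prodPrimes (h : ℕ → ℝ) (k : ℕ) : ℝ := ∏ r ∈ k.primeFactors, h r

section Pairs

variable {N : ℕ} [NeZero N] {P : Finset ℕ} {u G : ∀ r : ℕ, ZMod r → ZMod r → ℝ} {h : ℕ → ℝ} {C : ℝ}

theorem prodPrimes_nonneg (hu : ∀ r ∈ P, ∀ _ : NeZero r, IsSievePair r (u r) (G r) (h r) C)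
    {k : ℕ} (hk : k.primeFactors ⊆ P) : 0 ≤ prodPrimes h k :=
  Finset.prod_nonneg fun r hr => by
    have : NeZero r := ⟨(Nat.prime_of_mem_primeFactors hr).ne_zero⟩
    exact (hu r (hk hr) this).nonneg

theorem sum_sieveWeight_mul_liftProd_sq_le {J : ℕ}
    (hu : ∀ r ∈ P, ∀ _ : NeZero r, IsSievePair r (u r) (G r) (h r) C)
    {k : ℕ} (hk : k.primeFactors ⊆ P) (hsq : Squarefree k) (hN : k ∣ N) (hJ : 0 < J)
    (hJN : k * J ≤ N) (y : ZMod N) :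
    ∑ x : ZMod N, sieveWeight J x * (liftProd u k x y * liftProd u k x y) ≤
      N / J * prodPrimes h k := by
  have hP := Nat.prod_primeFactors_of_squarefree hsq
  simp_rw [liftProd, ← Finset.prod_mul_distrib]
  rw [sum_sieveWeight_mul_prod (fun r hr => Nat.prime_of_mem_primeFactors hr)
    (fun r x => u r x ((y.val : ℕ) : ZMod r) * u r x ((y.val : ℕ) : ZMod r))
    (by rwa [hP]) hJ (by rwa [hP])]
  refine mul_le_mul_of_nonneg_left ?_ (by positivity)
  refine Finset.prod_le_prod (fun r hr => ?_) fun r hr => ?_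
  · exact div_nonneg (Finset.sum_nonneg fun i _ => mul_self_nonneg _) (by positivity)
  · have : NeZero r := ⟨(Nat.prime_of_mem_primeFactors hr).ne_zero⟩
    have hr0 : (0 : ℝ) < r := by exact_mod_cast Nat.pos_of_ne_zero this.ne
    rw [← ZMod.sum_eq_sum_range (fun x : ZMod r => u r x ((y.val : ℕ) : ZMod r) *
      u r x ((y.val : ℕ) : ZMod r)), div_le_iff₀ hr0, mul_comm]
    simpa only [sq] using (hu r (hk hr) this).sum_left_sq ((y.val : ℕ) : ZMod r)

/-- The products for `k ≠ k'` are orthogonal on each row: some prime `r` divides just one of the two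
numbers, and `u r` has mean zero. -/
theorem sum_sieveWeight_mul_liftProd_mul_eq_zero {J : ℕ}
    (hu : ∀ r ∈ P, ∀ _ : NeZero r, IsSievePair r (u r) (G r) (h r) C)
    {k k' : ℕ} (hk : k.primeFactors ⊆ P) (hk' : k'.primeFactors ⊆ P) (hsq : Squarefree k)
    (hsq' : Squarefree k') (hne : k ≠ k') (hN : k.lcm k' ∣ N) (hJ : 0 < J)
    (hJN : k.lcm k' * J ≤ N) (y : ZMod N) :
    ∑ x : ZMod N, sieveWeight J x * (liftProd u k x y * liftProd u k' x y) = 0 := by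
  classical
  have hP := Nat.prod_primeFactors_of_squarefree hsq
  have hP' := Nat.prod_primeFactors_of_squarefree hsq'
  have hpr : ∀ r ∈ k.primeFactors ∪ k'.primeFactors, r.Prime := fun r hr =>
    (Finset.mem_union.1 hr).elim Nat.prime_of_mem_primeFactors Nat.prime_of_mem_primeFactors
  have hl : (∏ r ∈ k.primeFactors ∪ k'.primeFactors, r) = k.lcm k' := by
    refine Nat.dvd_antisymm (Finset.prod_primes_dvd _ (fun r hr => (hpr r hr).prime) fun r hr => ?_)
      (Nat.lcm_dvd ?_ ?_)
    · rcases Finset.mem_union.1 hr with h | h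
      · exact (Nat.dvd_of_mem_primeFactors h).trans (Nat.dvd_lcm_left _ _)
      · exact (Nat.dvd_of_mem_primeFactors h).trans (Nat.dvd_lcm_right _ _)
    · nth_rw 1 [← hP]
      exact Finset.prod_dvd_prod_of_subset _ _ _ Finset.subset_union_left
    · nth_rw 1 [← hP']
      exact Finset.prod_dvd_prod_of_subset _ _ _ Finset.subset_union_right
  have e : ∀ x : ZMod N, liftProd u k x y * liftProd u k' x y =
      ∏ r ∈ k.primeFactors ∪ k'.primeFactors,
        ((if r ∈ k.primeFactors then u r ((x.val : ℕ) : ZMod r) ((y.val : ℕ) : ZMod r) else 1) *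
        (if r ∈ k'.primeFactors then u r ((x.val : ℕ) : ZMod r) ((y.val : ℕ) : ZMod r) else 1)) :=
            by
    intro x
    rw [Finset.prod_mul_distrib, Finset.prod_ite_mem, Finset.prod_ite_mem,
      Finset.inter_eq_right.2 Finset.subset_union_left,
      Finset.inter_eq_right.2 Finset.subset_union_right]
    rfl
  simp_rw [e]
  rw [sum_sieveWeight_mul_prod hpr (fun r x =>
    ((if r ∈ k.primeFactors then u r x ((y.val : ℕ) : ZMod r) else 1) *
      (if r ∈ k'.primeFactors then u r x ((y.val : ℕ) : ZMod r) else 1)))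
    (by rwa [hl]) hJ (by rwa [hl])]
  obtain ⟨r, hr⟩ : ∃ r, ¬ (r ∈ k.primeFactors ↔ r ∈ k'.primeFactors) := by
    by_contra hall
    push Not at hall
    exact hne (by rw [← hP, ← hP', Finset.ext hall])
  have hrm : r ∈ k.primeFactors ∪ k'.primeFactors := by
    rw [Finset.mem_union]; tauto
  have : NeZero r := ⟨(hpr r hrm).ne_zero⟩
  have hrP : r ∈ P := (Finset.mem_union.1 hrm).elim (fun h => hk h) (fun h => hk' h)
  refine mul_eq_zero_of_right _ (Finset.prod_eq_zero hrm ?_)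
  have h0 := (hu r hrP this).sum_left ((y.val : ℕ) : ZMod r)
  rw [ZMod.sum_eq_sum_range] at h0
  by_cases h1 : r ∈ k.primeFactors
  · have h2 : r ∉ k'.primeFactors := by tauto
    simp only [if_pos h1, if_neg h2, mul_one, h0, zero_div]
  · have h2 : r ∈ k'.primeFactors := by tauto
    simp only [if_neg h1, if_pos h2, one_mul, h0, zero_div]

/-- The product over the primes dividing `k` is majorized by `k` times the indicator of the
multiples of `k`, up to the factor `prodPrimes h k`. -/
theorem isMajorized_liftProd
    (hu : ∀ r ∈ P, ∀ _ : NeZero r, IsSievePair r (u r) (G r) (h r) C)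
    {k : ℕ} (hk : k.primeFactors ⊆ P) (hsq : Squarefree k) (hN : k ∣ N) :
    IsMajorized (N := N) (fun x y => (liftProd u k x y : ℂ))
      (fun x => (prodPrimes h k : ℂ) * if k ∣ x.val then (k : ℂ) else 0) := by
  have hP := Nat.prod_primeFactors_of_squarefree hsq
  have h1 := IsMajorized.prod (N := N) k.primeFactors
    (fun r x y => (u r ((x.val : ℕ) : ZMod r) ((y.val : ℕ) : ZMod r) : ℂ))
    (fun r x => (h r : ℂ) * if r ∣ x.val then (r : ℂ) else 0) (fun r hr => by
      have : NeZero r := ⟨(Nat.prime_of_mem_primeFactors hr).ne_zero⟩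
      exact isMajorized_local ((Nat.dvd_of_mem_primeFactors hr).trans hN)
        (fun x y => (u r x y : ℂ)) (h r) (hu r (hk hr) this).norm_hat_left)
  convert h1 using 2 with x x
  · funext y
    rw [liftProd]; push_cast; rfl
  · rw [prod_ite_dvd (fun r hr => Nat.prime_of_mem_primeFactors hr), hP, prodPrimes]

/-- The weighted sum of the product of two distinct terms of the sieve. -/
theorem abs_sum_liftProd_le {J J' : ℕ}
    (hu : ∀ r ∈ P, ∀ _ : NeZero r, IsSievePair r (u r) (G r) (h r) C) (hC : 0 ≤ C)
    {k k' p p' : ℕ} (hk : k.primeFactors ⊆ P) (hk' : k'.primeFactors ⊆ P) (hsq : Squarefree k)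
    (hsq' : Squarefree k') (hp : p.Prime) (hp' : p'.Prime) (hpP : p ∈ P) (hpP' : p' ∈ P)
    (hpp : p ≠ p') (hpk : ¬ p ∣ k.lcm k') (hpk' : ¬ p' ∣ k.lcm k')
    (hN : k.lcm k' * (p * p') ∣ N) (hJ : 0 < J) (hJN : J ≤ N) (hJ' : 0 < J') :
    |∑ x : ZMod N, ∑ y : ZMod N, sieveWeight J x * sieveWeight J' y *
      (liftProd u k x y * G p ((x.val : ℕ) : ZMod p) ((y.val : ℕ) : ZMod p)) *
      (liftProd u k' x y * G p' ((x.val : ℕ) : ZMod p') ((y.val : ℕ) : ZMod p'))| ≤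
    2 * C ^ 2 * prodPrimes h k * prodPrimes h k' * (k * k') * (N / J' + p * p') := by
  have : NeZero p := ⟨hp.ne_zero⟩
  have : NeZero p' := ⟨hp'.ne_zero⟩
  have hk0 : 0 < k := Nat.pos_of_ne_zero hsq.ne_zero
  have hk0' : 0 < k' := Nat.pos_of_ne_zero hsq'.ne_zero
  have hM0 : 0 < k.lcm k' := Nat.lcm_pos hk0 hk0'
  have : NeZero (k.lcm k') := ⟨hM0.ne'⟩
  have : NeZero (k.lcm k' * p) := ⟨(Nat.mul_pos hM0 hp.pos).ne'⟩
  have : NeZero (k.lcm k' * p') := ⟨(Nat.mul_pos hM0 hp'.pos).ne'⟩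
  have : NeZero (p * p') := ⟨(Nat.mul_pos hp.pos hp'.pos).ne'⟩
  have : NeZero (k.lcm k' * (p * p')) := ⟨(Nat.mul_pos hM0 (Nat.mul_pos hp.pos hp'.pos)).ne'⟩
  have hMN : k.lcm k' ∣ N := (Dvd.intro _ rfl).trans hN
  have hMpN : k.lcm k' * p ∣ N := (mul_dvd_mul_left _ (Dvd.intro _ rfl)).trans hN
  have hMpN' : k.lcm k' * p' ∣ N := (mul_dvd_mul_left _ (Dvd.intro_left _ rfl)).trans hN
  have hppN : p * p' ∣ N := (Dvd.intro_left _ rfl).trans hN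
  have hpN : p ∣ N := (Dvd.intro _ rfl).trans hppN
  have hpN' : p' ∣ N := (Dvd.intro_left _ rfl).trans hppN
  have hkN : k ∣ N := (Nat.dvd_lcm_left k k').trans hMN
  have hkN' : k' ∣ N := (Nat.dvd_lcm_right k k').trans hMN
  have hcop : p.Coprime p' := (Nat.coprime_primes hp hp').2 hpp
  have hcM : (k.lcm k').Coprime p := ((Nat.Prime.coprime_iff_not_dvd hp).2 hpk).symm
  have hcM' : (k.lcm k').Coprime p' := ((Nat.Prime.coprime_iff_not_dvd hp').2 hpk').symm
  have hup := hu p hpP inferInstance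
  have hup' := hu p' hpP' inferInstance
  have key := norm_sum_mul_le_of_isMajorized hpN hpN' hcop J J' (fun x y => (G p x y : ℂ))
    (fun x y => (G p' x y : ℂ)) (C / p) (C / p') hup.hat_right_zero hup.norm_hat_right
    hup'.hat_right_zero hup'.norm_hat_right (by positivity) (by positivity) _ _
    ((isMajorized_liftProd hu hk hsq hkN).mul (isMajorized_liftProd hu hk' hsq' hkN'))
  have e1 : |∑ x : ZMod N, ∑ y : ZMod N, sieveWeight J x * sieveWeight J' y *
      (liftProd u k x y * G p ((x.val : ℕ) : ZMod p) ((y.val : ℕ) : ZMod p)) *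
      (liftProd u k' x y * G p' ((x.val : ℕ) : ZMod p') ((y.val : ℕ) : ZMod p'))| =
      ‖∑ x : ZMod N, ∑ y : ZMod N, (sieveWeight J x : ℂ) * sieveWeight J' y *
        ((liftProd u k x y : ℂ) * (liftProd u k' x y : ℂ)) *
        (G p ((x.val : ℕ) : ZMod p) ((y.val : ℕ) : ZMod p) : ℂ) *
        (G p' ((x.val : ℕ) : ZMod p') ((y.val : ℕ) : ZMod p') : ℂ)‖ := by
    rw [← Real.norm_eq_abs, ← Complex.norm_real]
    push_cast
    congr 1
    refine Finset.sum_congr rfl fun x _ => Finset.sum_congr rfl fun y _ => ?_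
    ring
  rw [e1]
  refine key.trans ?_
  set H := prodPrimes h k with hH
  set H' := prodPrimes h k' with hH'
  have hH0 : 0 ≤ H := prodPrimes_nonneg hu hk
  have hH0' : 0 ≤ H' := prodPrimes_nonneg hu hk'
  have e2 : (∑ x : ZMod N, (sieveWeight J x : ℂ) * (((H : ℂ) * if k ∣ x.val then (k : ℂ) else 0) *
      ((H' : ℂ) * if k' ∣ x.val then (k' : ℂ) else 0)) * ((if p ∣ x.val then (p : ℂ) else 0) - 1) *
      ((if p' ∣ x.val then (p' : ℂ) else 0) - 1)).re = H * H' * (k.gcd k') *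
      (dvdWeight N J (k.lcm k' * (p * p')) - dvdWeight N J (k.lcm k' * p) -
        dvdWeight N J (k.lcm k' * p') + dvdWeight N J (k.lcm k')) := by
    have hgl : (k : ℝ) * k' = k.gcd k' * k.lcm k' := by exact_mod_cast (Nat.gcd_mul_lcm k k').symm
    have hx : ∀ x : ZMod N, ((sieveWeight J x : ℂ) * (((H : ℂ) * if k ∣ x.val then (k : ℂ) else 0) *
        ((H' : ℂ) * if k' ∣ x.val then (k' : ℂ) else 0)) *
        ((if p ∣ x.val then (p : ℂ) else 0) - 1) *
        ((if p' ∣ x.val then (p' : ℂ) else 0) - 1)).re = H * H' * (k.gcd k') *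
        ((k.lcm k' * (p * p') : ℕ) * (if k.lcm k' * (p * p') ∣ x.val then sieveWeight J x else 0) -
          (k.lcm k' * p : ℕ) * (if k.lcm k' * p ∣ x.val then sieveWeight J x else 0) -
          (k.lcm k' * p' : ℕ) * (if k.lcm k' * p' ∣ x.val then sieveWeight J x else 0) +
          (k.lcm k' : ℕ) * (if k.lcm k' ∣ x.val then sieveWeight J x else 0)) := by
      intro x
      have hre : ((sieveWeight J x : ℂ) * (((H : ℂ) * if k ∣ x.val then (k : ℂ) else 0) *
        ((H' : ℂ) * if k' ∣ x.val then (k' : ℂ) else 0)) *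
        ((if p ∣ x.val then (p : ℂ) else 0) - 1) *
        ((if p' ∣ x.val then (p' : ℂ) else 0) - 1)) = ((sieveWeight J x *
        ((H * if k ∣ x.val then (k : ℝ) else 0) * (H' * if k' ∣ x.val then (k' : ℝ) else 0)) *
        ((if p ∣ x.val then (p : ℝ) else 0) - 1) *
        ((if p' ∣ x.val then (p' : ℝ) else 0) - 1) : ℝ) : ℂ) := by
        simp only [Complex.ofReal_mul, Complex.ofReal_sub, Complex.ofReal_one,
            apply_ite Complex.ofReal,
          Complex.ofReal_natCast, Complex.ofReal_zero]
      rw [hre, Complex.ofReal_re]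
      have d1 : k.lcm k' * p ∣ x.val ↔ k.lcm k' ∣ x.val ∧ p ∣ x.val :=
        ⟨fun h => ⟨(Dvd.intro _ rfl).trans h, (Dvd.intro_left _ rfl).trans h⟩,
          fun h => hcM.mul_dvd_of_dvd_of_dvd h.1 h.2⟩
      have d2 : k.lcm k' * p' ∣ x.val ↔ k.lcm k' ∣ x.val ∧ p' ∣ x.val :=
        ⟨fun h => ⟨(Dvd.intro _ rfl).trans h, (Dvd.intro_left _ rfl).trans h⟩,
          fun h => hcM'.mul_dvd_of_dvd_of_dvd h.1 h.2⟩
      have d3 : k.lcm k' * (p * p') ∣ x.val ↔ k.lcm k' ∣ x.val ∧ p ∣ x.val ∧ p' ∣ x.val := by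
        exact ⟨fun h => ⟨(Dvd.intro _ rfl).trans h, (Dvd.intro _ rfl).trans
          ((Dvd.intro_left _ rfl).trans h), (Dvd.intro_left p rfl).trans
          ((Dvd.intro_left _ rfl).trans h)⟩,
              fun h => (Nat.Coprime.mul_right hcM hcM').mul_dvd_of_dvd_of_dvd h.1
          (hcop.mul_dvd_of_dvd_of_dvd h.2.1 h.2.2)⟩
      have d4 : k.lcm k' ∣ x.val ↔ k ∣ x.val ∧ k' ∣ x.val := Nat.lcm_dvd_iff
      simp only [d1, d2, d3, d4]
      push_cast
      by_cases h1 : k ∣ x.val ∧ k' ∣ x.val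
      · simp only [h1.1, h1.2, and_self, true_and, if_true]
        by_cases h3 : p ∣ x.val <;> by_cases h4 : p' ∣ x.val <;>
          simp only [h3, h4, and_self, and_true, and_false, if_true, if_false]
        · linear_combination (H * H' * sieveWeight J x * (p - 1) * (p' - 1)) * hgl
        · linear_combination (H * H' * sieveWeight J x * (p - 1) * (0 - 1)) * hgl
        · linear_combination (H * H' * sieveWeight J x * (0 - 1) * (p' - 1)) * hgl
        · linear_combination (H * H' * sieveWeight J x * (0 - 1) * (0 - 1)) * hgl
      · simp only [h1, false_and, if_false]
        rcases not_and_or.1 h1 with h2 | h2 <;> simp [h2]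
    simp only [Complex.re_sum, hx, ← Finset.mul_sum, Finset.sum_add_distrib,
      Finset.sum_sub_distrib, dvdWeight]
  rw [e2]
  have b1 := dvdWeight_le (J := J) hN hJ
  have b2 := le_dvdWeight hMpN hJ hJN
  have b3 := le_dvdWeight hMpN' hJ hJN
  have b4 := dvdWeight_le (J := J) hMN hJ
  have b5 := dvdWeight_le (J := J') hppN hJ'
  have hgl : (k : ℝ) * k' = k.gcd k' * k.lcm k' := by exact_mod_cast (Nat.gcd_mul_lcm k k').symm
  push_cast at b1 b4 b5
  have hp1 : (1 : ℝ) ≤ p := by exact_mod_cast hp.one_le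
  have hp1' : (1 : ℝ) ≤ p' := by exact_mod_cast hp'.one_le
  have hpp1 : (1 : ℝ) ≤ p * p' := one_le_mul_of_one_le_of_one_le hp1 hp1'
  have hl0 : (0 : ℝ) ≤ k.lcm k' := by positivity
  -- the main terms `N / J` of the four weights cancel
  have b6 : dvdWeight N J (k.lcm k' * (p * p')) - dvdWeight N J (k.lcm k' * p) -
        dvdWeight N J (k.lcm k' * p') + dvdWeight N J (k.lcm k') ≤ 2 * (k.lcm k' * (p * p')) := by
    nlinarith
  have b7 : H * H' * (k.gcd k') *
      (dvdWeight N J (k.lcm k' * (p * p')) - dvdWeight N J (k.lcm k' * p) -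
        dvdWeight N J (k.lcm k' * p') + dvdWeight N J (k.lcm k')) ≤
      2 * H * H' * (k * k') * (p * p') := by
    calc _ ≤ H * H' * (k.gcd k') * (2 * (k.lcm k' * (p * p'))) := by gcongr
      _ = _ := by rw [hgl]; ring
  have b8 : (0 : ℝ) ≤ N / J' + p * p' := by positivity
  have b9 : 0 ≤ dvdWeight N J' (p * p') := by
    refine mul_nonneg (by positivity) (Finset.sum_nonneg fun x _ => ?_)
    split_ifs
    · exact sieveWeight_nonneg _ _
    · exact le_rfl
  calc _ ≤ C / p * (C / p') * (2 * H * H' * (k * k') * (p * p')) * (N / J' + p * p') := by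
        gcongr
    _ = _ := by
        field_simp

end Pairs

/-! ### The square sieve -/

section SumSquares

theorem sum_sum_ite_mul_eq {ι : Type*} (M : Finset (ι × ℕ)) (T : ι × ℕ → ℝ) :
    ∑ i ∈ M, ∑ j ∈ M, (if i.2 = j.2 then T i * T j else 0) =
      ∑ p ∈ M.image Prod.snd, (∑ i ∈ M with i.2 = p, T i) ^ 2 := by
  rw [← Finset.sum_fiberwise_of_maps_to (g := Prod.snd) (t := M.image Prod.snd)
    fun i hi => Finset.mem_image_of_mem _ hi]
  refine Finset.sum_congr rfl fun p _ => ?_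
  rw [sq, Finset.sum_mul_sum]
  refine Finset.sum_congr rfl fun i hi => ?_
  obtain ⟨-, rfl⟩ := Finset.mem_filter.1 hi
  rw [Finset.sum_filter]
  exact Finset.sum_congr rfl fun j _ => by simp only [eq_comm]

variable {N : ℕ} [NeZero N] {P : Finset ℕ} {u G : ∀ r : ℕ, ZMod r → ZMod r → ℝ} {h : ℕ → ℝ} {C : ℝ}

/-- The second moment of the sieve, over moduli `k * p` that are represented by the pairs `(k, p)`
in `M`. The pairs with equal primes `p` are treated by orthogonality, after estimating `G p`
trivially, the others by `abs_sum_liftProd_le`. -/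
theorem sum_sum_liftProd_mul_sq_le {J J' K : ℕ} {R : ℝ} (hP : ∀ r ∈ P, r.Prime)
    (hN : (∏ r ∈ P, r) ∣ N)
    (hu : ∀ r ∈ P, ∀ _ : NeZero r, IsSievePair r (u r) (G r) (h r) C) (hC : 0 ≤ C)
    (M : Finset (ℕ × ℕ)) (hsq : ∀ i ∈ M, Squarefree i.1) (hk : ∀ i ∈ M, i.1.primeFactors ⊆ P)
    (hp : ∀ i ∈ M, i.2 ∈ P) (hK : ∀ i ∈ M, i.1 ≤ K) (hKp : ∀ i ∈ M, K < i.2)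
    (hR : ∀ i ∈ M, (i.1 : ℝ) * i.2 ≤ R) (hJ : 0 < J) (hJN : K * K * J ≤ N)
    (hJ' : 0 < J') (hJN' : J' ≤ N) (hKN : (K : ℝ) ^ 2 * (N / J') ≤ R ^ 2) :
    ∑ x : ZMod N, ∑ y : ZMod N, sieveWeight J x * sieveWeight J' y *
      (∑ i ∈ M, liftProd u i.1 x y * G i.2 ((x.val : ℕ) : ZMod i.2) ((y.val : ℕ) : ZMod i.2)) ^ 2 ≤
    4 * (N / J) * (N / J') * (∑ i ∈ M, prodPrimes h i.1) +
      4 * C ^ 2 * R ^ 2 * (∑ i ∈ M, prodPrimes h i.1) ^ 2 := by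
  classical
  set T : ℕ × ℕ → ZMod N → ZMod N → ℝ := fun i x y =>
    liftProd u i.1 x y * G i.2 ((x.val : ℕ) : ZMod i.2) ((y.val : ℕ) : ZMod i.2) with hT
  have hlcm : ∀ i ∈ M, ∀ j ∈ M, (i.1.lcm j.1) ∣ N ∧ i.1.lcm j.1 * J ≤ N := by
    intro i hi j hj
    have hdvd : ∀ i ∈ M, i.1 ∣ ∏ r ∈ P, r := by
      intro i hi
      nth_rw 1 [← Nat.prod_primeFactors_of_squarefree (hsq i hi)]
      exact Finset.prod_dvd_prod_of_subset _ _ _ (hk i hi)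
    refine ⟨(Nat.lcm_dvd (hdvd i hi) (hdvd j hj)).trans hN, le_trans ?_ hJN⟩
    refine Nat.mul_le_mul_right J (le_trans (Nat.le_of_dvd ?_ (Nat.lcm_dvd_mul _ _))
      (Nat.mul_le_mul (hK i hi) (hK j hj)))
    exact Nat.mul_pos (Nat.pos_of_ne_zero (hsq i hi).ne_zero)
        (Nat.pos_of_ne_zero (hsq j hj).ne_zero)
  have hh0 : ∀ i ∈ M, 0 ≤ prodPrimes h i.1 := fun i hi => prodPrimes_nonneg hu (hk i hi)
  have hpt : ∀ x y, (∑ i ∈ M, T i x y) ^ 2 ≤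
      4 * ∑ i ∈ M, ∑ j ∈ M, (if i.2 = j.2 then liftProd u i.1 x y * liftProd u j.1 x y else 0) +
      ∑ i ∈ M, ∑ j ∈ M, (if i.2 = j.2 then 0 else T i x y * T j x y) := by
    intro x y
    have e1 : (∑ i ∈ M, T i x y) ^ 2 =
        ∑ i ∈ M, ∑ j ∈ M, (if i.2 = j.2 then T i x y * T j x y else 0) +
        ∑ i ∈ M, ∑ j ∈ M, (if i.2 = j.2 then 0 else T i x y * T j x y) := by
      rw [sq, Finset.sum_mul_sum, ← Finset.sum_add_distrib]
      refine Finset.sum_congr rfl fun i _ => ?_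
      rw [← Finset.sum_add_distrib]
      refine Finset.sum_congr rfl fun j _ => ?_
      split_ifs <;> ring
    rw [e1]
    refine add_le_add_left ?_ _
    rw [sum_sum_ite_mul_eq M (fun i => T i x y), sum_sum_ite_mul_eq M (fun i => liftProd u i.1 x y),
      Finset.mul_sum]
    refine Finset.sum_le_sum fun p hpm => ?_
    have e2 : ∑ i ∈ M with i.2 = p, T i x y = (∑ i ∈ M with i.2 = p, liftProd u i.1 x y) *
        G p ((x.val : ℕ) : ZMod p) ((y.val : ℕ) : ZMod p) := by
      rw [Finset.sum_mul]
      refine Finset.sum_congr rfl fun i hi => ?_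
      obtain ⟨-, rfl⟩ := Finset.mem_filter.1 hi
      rfl
    obtain ⟨i, hi, rfl⟩ := Finset.mem_image.1 hpm
    have : NeZero i.2 := ⟨(hP _ (hp i hi)).ne_zero⟩
    have hG := (hu i.2 (hp i hi) this).abs_right ((x.val : ℕ) : ZMod i.2) ((y.val : ℕ) : ZMod i.2)
    have hG2 := sq_le_sq' (neg_le_of_abs_le hG) (le_of_abs_le hG)
    rw [e2, mul_pow, mul_comm]
    exact mul_le_mul_of_nonneg_right (by linarith) (sq_nonneg _)
  have hw : ∀ x y : ZMod N, 0 ≤ sieveWeight J x * sieveWeight J' y := fun x y =>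
    mul_nonneg (sieveWeight_nonneg _ _) (sieveWeight_nonneg _ _)
  have hswap : ∀ Z : ℕ × ℕ → ℕ × ℕ → ZMod N → ZMod N → ℝ,
      ∑ x : ZMod N, ∑ y : ZMod N, sieveWeight J x * sieveWeight J' y *
        ∑ i ∈ M, ∑ j ∈ M, Z i j x y = ∑ i ∈ M, ∑ j ∈ M, ∑ x : ZMod N, ∑ y : ZMod N,
          sieveWeight J x * sieveWeight J' y * Z i j x y := by
    intro Z
    simp_rw [Finset.mul_sum]
    calc _ = ∑ x : ZMod N, ∑ i ∈ M, ∑ j ∈ M, ∑ y : ZMod N,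
          sieveWeight J x * sieveWeight J' y * Z i j x y := by
          refine Finset.sum_congr rfl fun x _ => ?_
          rw [Finset.sum_comm]
          exact Finset.sum_congr rfl fun i _ => Finset.sum_comm
      _ = _ := by
          rw [Finset.sum_comm]
          exact Finset.sum_congr rfl fun i _ => Finset.sum_comm
  calc _ ≤ ∑ x : ZMod N, ∑ y : ZMod N, sieveWeight J x * sieveWeight J' y *
      (4 * ∑ i ∈ M, ∑ j ∈ M, (if i.2 = j.2 then liftProd u i.1 x y * liftProd u j.1 x y else 0) +
      ∑ i ∈ M, ∑ j ∈ M, (if i.2 = j.2 then 0 else T i x y * T j x y)) :=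
        Finset.sum_le_sum fun x _ => Finset.sum_le_sum fun y _ =>
          mul_le_mul_of_nonneg_left (hpt x y) (hw x y)
    _ = 4 * (∑ i ∈ M, ∑ j ∈ M, ∑ x : ZMod N, ∑ y : ZMod N, sieveWeight J x * sieveWeight J' y *
        (if i.2 = j.2 then liftProd u i.1 x y * liftProd u j.1 x y else 0)) +
        ∑ i ∈ M, ∑ j ∈ M, ∑ x : ZMod N, ∑ y : ZMod N, sieveWeight J x * sieveWeight J' y *
        (if i.2 = j.2 then 0 else T i x y * T j x y) := by
        rw [← hswap fun i j x y => if i.2 = j.2 then liftProd u i.1 x y * liftProd u j.1 x y else 0,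
          ← hswap fun i j x y => if i.2 = j.2 then 0 else T i x y * T j x y, Finset.mul_sum,
          ← Finset.sum_add_distrib]
        refine Finset.sum_congr rfl fun x _ => ?_
        rw [Finset.mul_sum, ← Finset.sum_add_distrib]
        exact Finset.sum_congr rfl fun y _ => by ring
    _ ≤ 4 * (∑ i ∈ M, N / J * (N / J') * prodPrimes h i.1) +
        ∑ i ∈ M, ∑ j ∈ M, 4 * C ^ 2 * R ^ 2 * (prodPrimes h i.1 * prodPrimes h j.1) := by
        refine add_le_add (mul_le_mul_of_nonneg_left ?_ (by norm_num)) ?_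
        · refine Finset.sum_le_sum fun i hi => ?_
          have hdiag : ∀ j ∈ M, j ≠ i → ∑ x : ZMod N, ∑ y : ZMod N,
              sieveWeight J x * sieveWeight J' y *
              (if i.2 = j.2 then liftProd u i.1 x y * liftProd u j.1 x y else 0) = 0 := by
            intro j hj hji
            by_cases h2 : i.2 = j.2
            · have h1 : i.1 ≠ j.1 := fun h1 => hji (Prod.ext h1 h2).symm
              simp only [if_pos h2]
              rw [Finset.sum_comm]
              refine Finset.sum_eq_zero fun y _ => ?_
              have := sum_sieveWeight_mul_liftProd_mul_eq_zero hu (hk i hi) (hk j hj) (hsq i hi)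
                (hsq j hj) h1 (hlcm i hi j hj).1 hJ (hlcm i hi j hj).2 y
              calc _ = sieveWeight J' y * ∑ x : ZMod N, sieveWeight J x *
                    (liftProd u i.1 x y * liftProd u j.1 x y) := by
                    rw [Finset.mul_sum]
                    exact Finset.sum_congr rfl fun x _ => by ring
                _ = 0 := by rw [this, mul_zero]
            · simp [h2]
          rw [Finset.sum_eq_single_of_mem i hi hdiag]
          simp only [if_true]
          have hl := hlcm i hi i hi
          rw [Nat.lcm_self] at hl
          rw [Finset.sum_comm]
          calc _ = ∑ y : ZMod N, sieveWeight J' y * ∑ x : ZMod N, sieveWeight J x *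
                    (liftProd u i.1 x y * liftProd u i.1 x y) := by
                refine Finset.sum_congr rfl fun y _ => ?_
                rw [Finset.mul_sum]
                exact Finset.sum_congr rfl fun x _ => by ring
            _ ≤ ∑ y : ZMod N, sieveWeight J' y * (N / J * prodPrimes h i.1) :=
                Finset.sum_le_sum fun y _ => mul_le_mul_of_nonneg_left
                  (sum_sieveWeight_mul_liftProd_sq_le hu (hk i hi) (hsq i hi) hl.1 hJ hl.2 y)
                  (sieveWeight_nonneg _ _)
            _ = _ := by rw [← Finset.sum_mul, sum_sieveWeight hJ' hJN']; ring
        · refine Finset.sum_le_sum fun i hi => Finset.sum_le_sum fun j hj => ?_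
          have hi0 := hh0 i hi
          have hj0 := hh0 j hj
          by_cases h2 : i.2 = j.2
          · simp only [if_pos h2, mul_zero, Finset.sum_const_zero]
            positivity
          · simp only [if_neg h2]
            have hnd : ∀ q, q.Prime → K < q → ¬ q ∣ i.1.lcm j.1 := by
              intro q hq hKq hd
              have hd' := hd.trans (Nat.lcm_dvd_mul _ _)
              rcases (Nat.Prime.dvd_mul hq).1 hd' with hd' | hd'
              · have := Nat.le_of_dvd (Nat.pos_of_ne_zero (hsq i hi).ne_zero) hd'
                have := hK i hi
                omega
              · have := Nat.le_of_dvd (Nat.pos_of_ne_zero (hsq j hj).ne_zero) hd'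
                have := hK j hj
                omega
            have hpi := hP _ (hp i hi)
            have hpj := hP _ (hp j hj)
            have hni := hnd _ hpi (hKp i hi)
            have hnj := hnd _ hpj (hKp j hj)
            have hcop : (i.2).Coprime j.2 := (Nat.coprime_primes hpi hpj).2 h2
            have hN2 : i.1.lcm j.1 * (i.2 * j.2) ∣ N := by
              refine Nat.Coprime.mul_dvd_of_dvd_of_dvd (Nat.Coprime.mul_right
                ((Nat.Prime.coprime_iff_not_dvd hpi).2 hni).symm
                ((Nat.Prime.coprime_iff_not_dvd hpj).2 hnj).symm) (hlcm i hi j hj).1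
                (hcop.mul_dvd_of_dvd_of_dvd ((Finset.dvd_prod_of_mem _ (hp i hi)).trans hN)
                  ((Finset.dvd_prod_of_mem _ (hp j hj)).trans hN))
            have hJN1 : J ≤ N := le_trans (Nat.le_mul_of_pos_left J
              (Nat.lcm_pos (Nat.pos_of_ne_zero (hsq i hi).ne_zero)
                (Nat.pos_of_ne_zero (hsq j hj).ne_zero))) (hlcm i hi j hj).2
            have key := (le_abs_self _).trans (abs_sum_liftProd_le (J' :=
                J') hu hC (hk i hi) (hk j hj) (hsq i hi)
              (hsq j hj) hpi hpj (hp i hi) (hp j hj) h2 hni hnj hN2 hJ hJN1 hJ')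
            have hKi : (i.1 : ℝ) ≤ K := by exact_mod_cast hK i hi
            have hKj : (j.1 : ℝ) ≤ K := by exact_mod_cast hK j hj
            have b1 : (i.1 * j.1 : ℝ) * (N / J') ≤ R ^ 2 := by
              refine le_trans ?_ hKN
              rw [sq]
              gcongr
            have b2 : (i.1 * j.1 : ℝ) * (i.2 * j.2) ≤ R ^ 2 := by
              calc (i.1 * j.1 : ℝ) * (i.2 * j.2) = (i.1 * i.2) * (j.1 * j.2) := by ring
                _ ≤ R * R := mul_le_mul (hR i hi) (hR j hj) (by positivity)
                    (le_trans (by positivity) (hR i hi))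
                _ = R ^ 2 := by ring
            calc _ = ∑ x : ZMod N, ∑ y : ZMod N, sieveWeight J x * sieveWeight J' y * T i x y *
                  T j x y := Finset.sum_congr rfl fun x _ => Finset.sum_congr rfl fun y _ => by ring
              _ ≤ 2 * C ^ 2 * prodPrimes h i.1 * prodPrimes h j.1 * (i.1 * j.1) *
                  (N / J' + i.2 * j.2) := key
              _ = 2 * C ^ 2 * (prodPrimes h i.1 * prodPrimes h j.1) * ((i.1 * j.1) * (N / J') +
                  (i.1 * j.1) * (i.2 * j.2)) := by ring
              _ ≤ 2 * C ^ 2 * (prodPrimes h i.1 * prodPrimes h j.1) * (R ^ 2 + R ^ 2) := by gcongr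
              _ = _ := by ring
    _ = _ := by
        simp_rw [← Finset.mul_sum]
        rw [← Finset.sum_mul]
        ring

/-- The weight is not small on integers up to `N / (8 J)`: all terms of the exponential sum have
argument at most `π / 3`. -/
theorem quarter_le_sieveWeight {J : ℕ} (hJ : 0 < J) (n : ℤ) (hn : 8 * J * |(n : ℝ)| ≤ N) :
    1 / 4 ≤ sieveWeight J (n : ZMod N) := by
  have hN0 : (0 : ℝ) < N := by exact_mod_cast Nat.pos_of_ne_zero (NeZero.ne N)
  have hJ0 : (0 : ℝ) < J := by exact_mod_cast hJ
  have hre : ∀ j ∈ Finset.range J, 1 / 2 ≤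
      (ZMod.stdAddChar ((j : ZMod N) * (n : ZMod N)) : ℂ).re := by
    intro j hj
    have hjJ : (j : ℝ) ≤ J := by exact_mod_cast (Finset.mem_range.1 hj).le
    have e : (j : ZMod N) * (n : ZMod N) = ((j * n : ℤ) : ZMod N) := by push_cast; rfl
    rw [e, ZMod.stdAddChar_coe]
    have e2 : (2 * Real.pi * Complex.I * ((j * n : ℤ) : ℂ) / N : ℂ) =
        ((2 * Real.pi * (j * n) / N : ℝ) : ℂ) * Complex.I := by push_cast; ring
    rw [e2, Complex.exp_ofReal_mul_I_re, ← Real.cos_pi_div_three,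
        ← Real.cos_abs (2 * Real.pi * _ / _)]
    have hpi := Real.pi_pos
    have hle : |2 * Real.pi * (j * n) / N| ≤ Real.pi / 3 := by
      rw [abs_div, abs_of_pos hN0, div_le_iff₀ hN0, abs_mul, abs_mul (j : ℝ),
          abs_of_pos (by positivity),
        abs_of_nonneg (Nat.cast_nonneg j)]
      have : (j : ℝ) * |(n : ℝ)| ≤ J * |(n : ℝ)| := by gcongr
      nlinarith
    exact Real.cos_le_cos_of_nonneg_of_le_pi (abs_nonneg _) (by linarith) hle
  have h1 : (J : ℝ) / 2 ≤ ‖∑ j ∈ Finset.range J,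
      (ZMod.stdAddChar ((j : ZMod N) * (n : ZMod N)) : ℂ)‖ := by
    refine le_trans ?_ (Complex.re_le_norm _)
    rw [Complex.re_sum]
    refine le_trans ?_ (Finset.sum_le_sum hre)
    simp [div_eq_mul_inv]
  rw [sieveWeight, le_div_iff₀ (by positivity)]
  nlinarith [norm_nonneg (∑ j ∈ Finset.range J,
      (ZMod.stdAddChar ((j : ZMod N) * (n : ZMod N)) : ℂ))]

/-- The square sieve. If the functions `u r` are `1` and the functions `G r` are at least `1 / 2` at
all points of `A`, then `A` is small. -/
theorem card_mul_card_sq_le {P : Finset ℕ} {u G : ∀ r : ℕ, ZMod r → ZMod r → ℝ} {h : ℕ → ℝ}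
    {C R U V : ℝ} {K : ℕ} (hP : ∀ r ∈ P, r.Prime)
    (hu : ∀ r ∈ P, ∀ _ : NeZero r, IsSievePair r (u r) (G r) (h r) C) (hC : 0 ≤ C)
    (A : Finset (ℤ × ℤ)) (hU : 1 ≤ U) (hV : 1 ≤ V) (hAU : ∀ z ∈ A, |(z.1 : ℝ)| ≤ U)
    (hAV : ∀ z ∈ A, |(z.2 : ℝ)| ≤ V) (hAu : ∀ z ∈ A, ∀ r ∈ P, u r z.1 z.2 = 1)
    (hAG : ∀ z ∈ A, ∀ r ∈ P, 1 / 2 ≤ G r z.1 z.2)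
    (M : Finset (ℕ × ℕ)) (hsq : ∀ i ∈ M, Squarefree i.1) (hk : ∀ i ∈ M, i.1.primeFactors ⊆ P)
    (hp : ∀ i ∈ M, i.2 ∈ P) (hK : ∀ i ∈ M, i.1 ≤ K) (hKp : ∀ i ∈ M, K < i.2)
    (hR : ∀ i ∈ M, (i.1 : ℝ) * i.2 ≤ R) (hKU : (K : ℝ) ^ 2 ≤ 8 * U)
    (hKV : (K : ℝ) ^ 2 * (16 * V) ≤ R ^ 2) :
    (A.card : ℝ) * M.card ^ 2 ≤ 64 * (4 * (16 * U) * (16 * V) * (∑ i ∈ M, prodPrimes h i.1) +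
      4 * C ^ 2 * R ^ 2 * (∑ i ∈ M, prodPrimes h i.1) ^ 2) := by
  classical
  obtain ⟨T, hT⟩ := exists_nat_ge (8 * U + 8 * V)
  have hPpos : 0 < ∏ r ∈ P, r := Finset.prod_pos fun r hr => (hP r hr).pos
  have hTpos : 0 < T := by
    have : (0 : ℝ) < T := by linarith
    exact_mod_cast this
  -- the period `N` is a multiple of all primes of the sieve and long enough to separate `A`
  obtain ⟨N, hNdef⟩ : ∃ N, N = T * ∏ r ∈ P, r := ⟨_, rfl⟩
  have hNpos : 0 < N := hNdef ▸ Nat.mul_pos hTpos hPpos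
  have : NeZero N := ⟨hNpos.ne'⟩
  have hN0 : (0 : ℝ) < N := by exact_mod_cast hNpos
  have hTN : (T : ℝ) ≤ N := by
    have : T ≤ N := hNdef ▸ Nat.le_mul_of_pos_right T hPpos
    exact_mod_cast this
  have hPN : (∏ r ∈ P, r) ∣ N := hNdef ▸ Dvd.intro_left _ rfl
  -- the lengths of the two weights
  have hlen : ∀ W : ℝ, 1 ≤ W → 8 * W ≤ N → ∃ J : ℕ, 0 < J ∧ 8 * J * W ≤ N ∧
      (N : ℝ) / J ≤ 16 * W := by
    intro W hW hWN
    have hx : 1 ≤ (N : ℝ) / (8 * W) := by rwa [le_div_iff₀ (by linarith), one_mul]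
    have h1 : 0 < ⌊(N : ℝ) / (8 * W)⌋₊ := Nat.floor_pos.2 hx
    have h1R : (1 : ℝ) ≤ ⌊(N : ℝ) / (8 * W)⌋₊ := by exact_mod_cast h1
    have h2 := Nat.floor_le (show 0 ≤ (N : ℝ) / (8 * W) by positivity)
    have h3 := Nat.lt_floor_add_one ((N : ℝ) / (8 * W))
    rw [le_div_iff₀ (by linarith)] at h2
    rw [div_lt_iff₀ (by linarith)] at h3
    refine ⟨_, h1, by linarith, ?_⟩
    rw [div_le_iff₀ (by linarith)]
    nlinarith
  obtain ⟨J, hJ, hJU, hJ16⟩ := hlen U hU (by linarith)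
  obtain ⟨J', hJ', hJV, hJ16'⟩ := hlen V hV (by linarith)
  have hJ0 : (0 : ℝ) < J := by exact_mod_cast hJ
  have hJ0' : (0 : ℝ) < J' := by exact_mod_cast hJ'
  have hJN : K * K * J ≤ N := by
    have : (K : ℝ) * K * J ≤ N := by nlinarith
    exact_mod_cast this
  have hJN' : J' ≤ N := by
    have : (J' : ℝ) ≤ N := by nlinarith
    exact_mod_cast this
  have key := sum_sum_liftProd_mul_sq_le hP hPN hu hC M hsq hk hp hK hKp hR hJ hJN hJ' hJN'
    ((mul_le_mul_of_nonneg_left hJ16' (sq_nonneg _)).trans hKV)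
  have hH0 : 0 ≤ ∑ i ∈ M, prodPrimes h i.1 :=
    Finset.sum_nonneg fun i hi => prodPrimes_nonneg hu (hk i hi)
  set S : ZMod N × ZMod N → ℝ := fun z => sieveWeight J z.1 * sieveWeight J' z.2 *
      (∑ i ∈ M, liftProd u i.1 z.1 z.2 * G i.2 ((z.1.val : ℕ) : ZMod i.2)
        ((z.2.val : ℕ) : ZMod i.2)) ^ 2 with hS
  have hS0 : ∀ z, 0 ≤ S z := fun z =>
    mul_nonneg (mul_nonneg (sieveWeight_nonneg _ _) (sieveWeight_nonneg _ _)) (sq_nonneg _)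
  have hcast : ∀ (n : ℤ) (r : ℕ), r ∈ P → ((((n : ZMod N)).val : ℕ) : ZMod r) = (n : ZMod r) := by
    intro n r hr
    rw [ZMod.natCast_val, ZMod.cast_intCast ((Finset.dvd_prod_of_mem _ hr).trans hPN)]
  have hpoint : ∀ z ∈ A, (M.card : ℝ) ^ 2 / 64 ≤ S ((z.1 : ZMod N), (z.2 : ZMod N)) := by
    intro z hz
    have w1 := quarter_le_sieveWeight (N := N) hJ z.1
      (le_trans (mul_le_mul_of_nonneg_left (hAU z hz) (by positivity)) hJU)
    have w2 := quarter_le_sieveWeight (N := N) hJ' z.2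
      (le_trans (mul_le_mul_of_nonneg_left (hAV z hz) (by positivity)) hJV)
    have w3 : (M.card : ℝ) / 2 ≤ ∑ i ∈ M, liftProd u i.1 (z.1 : ZMod N) (z.2 : ZMod N) *
        G i.2 (((z.1 : ZMod N).val : ℕ) : ZMod i.2) (((z.2 : ZMod N).val : ℕ) : ZMod i.2) := by
      have : ∀ i ∈ M, 1 / 2 ≤ liftProd u i.1 (z.1 : ZMod N) (z.2 : ZMod N) *
        G i.2 (((z.1 : ZMod N).val : ℕ) : ZMod i.2) (((z.2 : ZMod N).val : ℕ) : ZMod i.2) := by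
        intro i hi
        rw [liftProd, Finset.prod_eq_one, one_mul, hcast _ _ (hp i hi), hcast _ _ (hp i hi)]
        · exact hAG z hz _ (hp i hi)
        · intro r hr
          rw [hcast _ _ (hk i hi hr), hcast _ _ (hk i hi hr)]
          exact hAu z hz r (hk i hi hr)
      refine le_trans ?_ (Finset.sum_le_sum this)
      simp [div_eq_mul_inv]
    have w4 : (M.card : ℝ) ^ 2 / 4 ≤ (∑ i ∈ M, liftProd u i.1 (z.1 : ZMod N) (z.2 : ZMod N) *
        G i.2 (((z.1 : ZMod N).val : ℕ) : ZMod i.2) (((z.2 : ZMod N).val : ℕ) : ZMod i.2)) ^ 2 := by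
      calc (M.card : ℝ) ^ 2 / 4 = ((M.card : ℝ) / 2) ^ 2 := by ring
        _ ≤ _ := pow_le_pow_left₀ (by positivity) w3 2
    calc (M.card : ℝ) ^ 2 / 64 = 1 / 4 * (1 / 4) * ((M.card : ℝ) ^ 2 / 4) := by ring
      _ ≤ _ := by
        rw [hS]
        exact mul_le_mul (mul_le_mul w1 w2 (by norm_num) (by linarith)) w4 (by positivity)
          (mul_nonneg (by linarith) (by linarith))
  have hinj : Set.InjOn (fun z : ℤ × ℤ => ((z.1 : ZMod N), (z.2 : ZMod N))) A := by
    have hone : ∀ W : ℝ, 8 * W ≤ N → 1 ≤ W → ∀ a b : ℤ, |(a : ℝ)| ≤ W → |(b : ℝ)| ≤ W →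
        (a : ZMod N) = (b : ZMod N) → a = b := by
      intro W hW hW1 a b ha hb hab
      have hd := (ZMod.intCast_eq_intCast_iff_dvd_sub _ _ _).1 hab
      by_contra hne
      have h1 := Int.le_of_dvd (abs_pos.2 (sub_ne_zero.2 (Ne.symm hne))) ((dvd_abs _ _).2 hd)
      have h2 : (N : ℝ) ≤ |(b : ℝ) - a| := by exact_mod_cast h1
      have h3 := abs_sub (b : ℝ) a
      linarith
    intro z hz z' hz' h
    exact Prod.ext (hone U (by linarith) hU _ _ (hAU z hz) (hAU z' hz') (congrArg Prod.fst h))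
      (hone V (by linarith) hV _ _ (hAV z hz) (hAV z' hz') (congrArg Prod.snd h))
  have hsum : (A.card : ℝ) * (M.card ^ 2 / 64) ≤ ∑ x : ZMod N, ∑ y : ZMod N, S (x, y) := by
    calc (A.card : ℝ) * (M.card ^ 2 / 64) = ∑ z ∈ A, (M.card : ℝ) ^ 2 / 64 := by simp
      _ ≤ ∑ z ∈ A, S ((z.1 : ZMod N), (z.2 : ZMod N)) := Finset.sum_le_sum hpoint
      _ = ∑ z ∈ A.image fun z : ℤ × ℤ => ((z.1 : ZMod N), (z.2 : ZMod N)), S z :=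
          (Finset.sum_image hinj).symm
      _ ≤ ∑ z, S z := Finset.sum_le_sum_of_subset_of_nonneg (Finset.subset_univ _)
          fun z _ _ => hS0 z
      _ = _ := Fintype.sum_prod_type _
  have hfin : (A.card : ℝ) * (M.card ^ 2 / 64) ≤ 4 * (16 * U) * (16 * V) *
      (∑ i ∈ M, prodPrimes h i.1) + 4 * C ^ 2 * R ^ 2 * (∑ i ∈ M, prodPrimes h i.1) ^ 2 := by
    refine hsum.trans (key.trans (add_le_add_left ?_ _))
    gcongr
  linarith

end SumSquares

/-! ### Counting the moduli of the sieve -/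

section Counting

/-- The product is largest for `S = {2, …, s + 1}`, where it telescopes. -/
theorem prod_one_add_inv_le (S : Finset ℕ) (hS : ∀ p ∈ S, 2 ≤ p) :
    ∏ p ∈ S, (1 + (p : ℝ)⁻¹) ≤ S.card + 1 := by
  induction S using Finset.induction_on_max with
  | empty => simp
  | insert a s hlt ih =>
    have ha : a ∉ s := fun h => lt_irrefl _ (hlt a h)
    have ih' := ih fun p hp => hS p (Finset.mem_insert_of_mem hp)
    have h2 : 2 ≤ a := hS a (Finset.mem_insert_self _ _)
    have hcard : s.card + 2 ≤ a := by
      have : s ⊆ Finset.Ico 2 a := fun p hp =>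
        Finset.mem_Ico.2 ⟨hS p (Finset.mem_insert_of_mem hp), hlt p hp⟩
      have := Finset.card_le_card this
      rw [Nat.card_Ico] at this
      omega
    have hcardR : (s.card : ℝ) + 2 ≤ a := by exact_mod_cast hcard
    have ha0 : (0 : ℝ) < a := by positivity
    rw [Finset.prod_insert ha, Finset.card_insert_of_notMem ha]
    push_cast
    calc (1 + (a : ℝ)⁻¹) * ∏ p ∈ s, (1 + (p : ℝ)⁻¹) ≤ (1 + (a : ℝ)⁻¹) * (s.card + 1) := by gcongr
      _ = s.card + 1 + (s.card + 1) / a := by field_simp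
      _ ≤ s.card + 1 + 1 := by
        gcongr
        rw [div_le_one ha0]
        linarith

/-- The squarefree numbers up to `K` without prime factors in `S`. -/
def sievingNumbers (S : Finset ℕ) (K : ℕ) : Finset ℕ :=
  (Finset.Icc 1 K).filter fun k => Squarefree k ∧ Disjoint k.primeFactors S

theorem sum_inv_sq_le (K : ℕ) : ∑ b ∈ Finset.Icc 1 K, ((b : ℝ) ^ 2)⁻¹ ≤ 2 := by
  have h : ∀ K : ℕ, ∑ b ∈ Finset.Icc 1 (K + 1), ((b : ℝ) ^ 2)⁻¹ ≤ 2 - ((K : ℝ) + 1)⁻¹ := by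
    intro K
    induction K with
    | zero => norm_num
    | succ K ih =>
      rw [Finset.sum_Icc_succ_top (by omega)]
      push_cast at ih ⊢
      have h1 : (((K : ℝ) + 1 + 1) ^ 2)⁻¹ ≤ ((K : ℝ) + 1)⁻¹ - ((K : ℝ) + 1 + 1)⁻¹ := by
        rw [inv_sub_inv (by positivity) (by positivity), inv_eq_one_div,
          div_le_div_iff₀ (by positivity) (by positivity)]
        nlinarith [(Nat.cast_nonneg K : (0 : ℝ) ≤ K)]
      linarith
  rcases K with _ | K
  · simp
  · exact (h K).trans (sub_le_self _ (by positivity))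

/-- Every number is a product `k * e * b ^ 2` with `k` among the sieving numbers and `e` a product
of distinct elements of `S`; so the sieving numbers are not too rare. -/
theorem log_le_sum_sievingNumbers (S : Finset ℕ) (hS : ∀ p ∈ S, 2 ≤ p) (K : ℕ) :
    Real.log (K + 1) ≤ 2 * (S.card + 1) * ∑ k ∈ sievingNumbers S K, (k : ℝ)⁻¹ := by
  classical
  have hex : ∀ n : ℕ, ∃ x : ℕ × Finset ℕ × ℕ, n ∈ Finset.Icc 1 K →
      x ∈ sievingNumbers S K ×ˢ S.powerset ×ˢ Finset.Icc 1 K ∧ n = x.1 * (∏ p ∈ x.2.1, p) *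
          x.2.2 ^ 2 := by
    intro n
    obtain ⟨a, b, hab, ha⟩ := Nat.sq_mul_squarefree n
    refine ⟨(∏ p ∈ a.primeFactors \ S, p, a.primeFactors ∩ S, b), fun hn => ?_⟩
    rw [Finset.mem_Icc] at hn
    have hprod : (∏ p ∈ a.primeFactors \ S, p) * ∏ p ∈ a.primeFactors ∩ S, p = a := by
      rw [mul_comm, Finset.prod_inter_mul_prod_sdiff, Nat.prod_primeFactors_of_squarefree ha]
    have hb0 : b ≠ 0 := by rintro rfl; simp at hab; omega
    have ha0 : a ≠ 0 := ha.ne_zero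
    have han : a ≤ n := by rw [← hab]; exact Nat.le_mul_of_pos_left a (by positivity)
    have hbn : b ≤ n := by
      rw [← hab, sq, mul_assoc]
      exact Nat.le_mul_of_pos_right b (Nat.mul_pos (Nat.pos_of_ne_zero hb0)
          (Nat.pos_of_ne_zero ha0))
    have hdvd : (∏ p ∈ a.primeFactors \ S, p) ∣ a := Dvd.intro _ hprod
    have hpf : (∏ p ∈ a.primeFactors \ S, p).primeFactors = a.primeFactors \ S :=
      Nat.primeFactors_prod fun p hp => Nat.prime_of_mem_primeFactors (Finset.mem_sdiff.1 hp).1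
    refine ⟨?_, by rw [hprod, mul_comm, hab]⟩
    simp only [Finset.mem_product, Finset.mem_powerset, sievingNumbers, Finset.mem_filter,
      Finset.mem_Icc]
    refine ⟨⟨⟨Nat.pos_of_dvd_of_pos hdvd (Nat.pos_of_ne_zero ha0),
      (Nat.le_of_dvd (Nat.pos_of_ne_zero ha0) hdvd).trans (han.trans hn.2)⟩,
      ha.squarefree_of_dvd hdvd, ?_⟩, Finset.inter_subset_right, Nat.pos_of_ne_zero hb0,
      hbn.trans hn.2⟩
    rw [hpf]
    exact Finset.sdiff_disjoint
  choose φ hφ using hex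
  set g : ℕ × Finset ℕ × ℕ → ℝ := fun x => (x.1 : ℝ)⁻¹ *
      ((∏ p ∈ x.2.1, (p : ℝ)⁻¹) * ((x.2.2 : ℝ) ^ 2)⁻¹)
    with hg
  have hg0 : ∀ x, 0 ≤ g x := fun x => mul_nonneg (by positivity)
    (mul_nonneg (Finset.prod_nonneg fun _ _ => by positivity) (by positivity))
  calc Real.log (K + 1) ≤ (harmonic K : ℝ) := by exact_mod_cast log_add_one_le_harmonic K
    _ = ∑ n ∈ Finset.Icc 1 K, (n : ℝ)⁻¹ := by
        rw [harmonic_eq_sum_Icc]; push_cast; rfl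
    _ = ∑ n ∈ Finset.Icc 1 K, g (φ n) := by
        refine Finset.sum_congr rfl fun n hn => ?_
        nth_rw 1 [(hφ n hn).2]
        rw [hg]
        push_cast
        rw [mul_inv, mul_inv, Finset.prod_inv_distrib, mul_assoc]
    _ = ∑ x ∈ (Finset.Icc 1 K).image φ, g x := by
        refine (Finset.sum_image fun n hn m hm h => ?_).symm
        rw [(hφ n hn).2, (hφ m hm).2, h]
    _ ≤ ∑ x ∈ sievingNumbers S K ×ˢ S.powerset ×ˢ Finset.Icc 1 K, g x := by
        refine Finset.sum_le_sum_of_subset_of_nonneg (fun x hx => ?_) fun x _ _ => hg0 x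
        obtain ⟨n, hn, rfl⟩ := Finset.mem_image.1 hx
        exact (hφ n hn).1
    _ = (∑ k ∈ sievingNumbers S K, (k : ℝ)⁻¹) * ((∏ p ∈ S, (1 + (p : ℝ)⁻¹)) *
        ∑ b ∈ Finset.Icc 1 K, ((b : ℝ) ^ 2)⁻¹) := by
        rw [Finset.prod_one_add, Finset.sum_mul_sum, ← Finset.sum_product', Finset.sum_mul_sum,
          ← Finset.sum_product']
    _ ≤ (∑ k ∈ sievingNumbers S K, (k : ℝ)⁻¹) * ((S.card + 1) * 2) := by
        gcongr
        · exact prod_one_add_inv_le S hS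
        · exact sum_inv_sq_le K
    _ = _ := by ring

/-- The constant of a sieve pair at `r`, which dominates the true value `1 + O(1 / √r)` for large
`r`. -/
noncomputable def localFactor (r : ℕ) : ℝ := 1 + (r : ℝ) ^ (-(1 / 4) : ℝ)

theorem prodPrimes_localFactor_eq {k : ℕ} (hk : Squarefree k) :
    prodPrimes localFactor k = ∑ d ∈ k.divisors, (d : ℝ) ^ (-(1 / 4) : ℝ) := by
  set f : ArithmeticFunction ℝ := ⟨fun d => (d : ℝ) ^ (-(1 / 4) : ℝ), by
    rw [Nat.cast_zero, Real.zero_rpow (by norm_num)]⟩ with hf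
  have hmul : f.IsMultiplicative := by
    refine ⟨by simp [hf], fun {m n} _ => ?_⟩
    simp only [hf, ArithmeticFunction.coe_mk]
    push_cast
    exact Real.mul_rpow (Nat.cast_nonneg m) (Nat.cast_nonneg n)
  exact hmul.prodPrimeFactors_one_add_of_squarefree hk

/-- The constants of the sieve pairs are so close to `1` that `prodPrimes localFactor` is bounded on
average. -/
theorem exists_sum_prodPrimes_div_le : ∃ B : ℝ, 0 < B ∧ ∀ (K : ℕ) (Q : Finset ℕ),
    Q ⊆ Finset.Icc 1 K → (∀ k ∈ Q, Squarefree k) →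
    ∑ k ∈ Q, prodPrimes localFactor k / k ≤ B * (1 + Real.log K) := by
  classical
  have hs : Summable fun d : ℕ => (d : ℝ) ^ (-(5 / 4) : ℝ) :=
    Real.summable_nat_rpow.2 (by norm_num)
  have hnn : ∀ d : ℕ, 0 ≤ (d : ℝ) ^ (-(5 / 4) : ℝ) := fun d => by positivity
  refine ⟨∑' d : ℕ, (d : ℝ) ^ (-(5 / 4) : ℝ), ?_, fun K Q hQ hsq => ?_⟩
  · exact lt_of_lt_of_le (by norm_num) (hs.le_tsum 1 fun d _ => hnn d)
  have hbound : ∑ d ∈ Finset.Icc 1 K, (d : ℝ) ^ (-(5 / 4) : ℝ) ≤ ∑' d : ℕ,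
      (d : ℝ) ^ (-(5 / 4) : ℝ) :=
    hs.sum_le_tsum _ fun d _ => hnn d
  have hharm : ∑ m ∈ Finset.Icc 1 K, (m : ℝ)⁻¹ ≤ 1 + Real.log K := by
    have := harmonic_le_one_add_log K
    rw [harmonic_eq_sum_Icc] at this
    push_cast at this
    exact this
  set F : ℕ × ℕ → ℝ := fun x => (x.1 : ℝ) ^ (-(5 / 4) : ℝ) * (x.2 : ℝ)⁻¹ with hF
  have hterm : ∀ k ∈ Q, prodPrimes localFactor k / k = ∑ x ∈ k.divisorsAntidiagonal, F x := by
    intro k hk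
    rw [prodPrimes_localFactor_eq (hsq k hk), Finset.sum_div,
      ← Nat.sum_divisorsAntidiagonal fun d _ => (d : ℝ) ^ (-(1 / 4) : ℝ) / (k : ℝ)]
    refine Finset.sum_congr rfl fun x hx => ?_
    obtain ⟨hx1, hx2⟩ := Nat.mem_divisorsAntidiagonal.1 hx
    have hx0 : 0 < x.1 := Nat.pos_of_ne_zero fun h => hx2 (by rw [← hx1, h, zero_mul])
    have hx0R : (0 : ℝ) < x.1 := by exact_mod_cast hx0
    rw [hF, ← hx1]
    push_cast
    rw [show (-(5 / 4) : ℝ) = -(1 / 4) - 1 by norm_num, Real.rpow_sub_one hx0R.ne',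
        div_mul_eq_div_div,
      div_eq_mul_inv _ (x.2 : ℝ)]
  have hdisj : (Q : Set ℕ).PairwiseDisjoint Nat.divisorsAntidiagonal := by
    intro k _ l _ hkl
    rw [Function.onFun, Finset.disjoint_left]
    intro x hx hx'
    exact hkl ((Nat.mem_divisorsAntidiagonal.1 hx).1.symm.trans (Nat.mem_divisorsAntidiagonal.1 hx').1)
  calc ∑ k ∈ Q, prodPrimes localFactor k / k = ∑ k ∈ Q, ∑ x ∈ k.divisorsAntidiagonal, F x :=
        Finset.sum_congr rfl hterm
    _ = ∑ x ∈ Q.biUnion Nat.divisorsAntidiagonal, F x := (Finset.sum_biUnion hdisj).symm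
    _ ≤ ∑ x ∈ Finset.Icc 1 K ×ˢ Finset.Icc 1 K, F x := by
        refine Finset.sum_le_sum_of_subset_of_nonneg (fun x hx => ?_) fun x _ _ =>
          mul_nonneg (hnn _) (by positivity)
        obtain ⟨k, hk, hxk⟩ := Finset.mem_biUnion.1 hx
        obtain ⟨hx1, hx2⟩ := Nat.mem_divisorsAntidiagonal.1 hxk
        have hkK := Finset.mem_Icc.1 (hQ hk)
        have h1 : 0 < x.1 := Nat.pos_of_ne_zero fun h => hx2 (by rw [← hx1, h, zero_mul])
        have h2 : 0 < x.2 := Nat.pos_of_ne_zero fun h => hx2 (by rw [← hx1, h, mul_zero])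
        have h3 : x.1 ≤ k := hx1 ▸ Nat.le_mul_of_pos_right _ h2
        have h4 : x.2 ≤ k := hx1 ▸ Nat.le_mul_of_pos_left _ h1
        rw [Finset.mem_product, Finset.mem_Icc, Finset.mem_Icc]
        exact ⟨⟨h1, h3.trans hkK.2⟩, h2, h4.trans hkK.2⟩
    _ = (∑ d ∈ Finset.Icc 1 K, (d : ℝ) ^ (-(5 / 4) : ℝ)) * ∑ m ∈ Finset.Icc 1 K, (m : ℝ)⁻¹ := by
        rw [Finset.sum_mul_sum, ← Finset.sum_product']
    _ ≤ _ := by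
        have : (0 : ℝ) ≤ ∑ m ∈ Finset.Icc 1 K, (m : ℝ)⁻¹ :=
            Finset.sum_nonneg fun _ _ => by positivity
        gcongr

theorem exists_primeCounting_ge : ∃ x₀ : ℝ, 2 ≤ x₀ ∧ ∀ x, x₀ ≤ x →
    1 / 4 * (x / Real.log x) ≤ Nat.primeCounting ⌊x⌋₊ := by
  have h := (Real.isLittleO_log_id_atTop.bound (show (0 : ℝ) < 1 / 16 by norm_num))
  obtain ⟨x₁, hx₁⟩ := Filter.eventually_atTop.1 h
  refine ⟨max (max x₁ 2) 16, by simp, fun x hx => ?_⟩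
  have hx1 : max x₁ 2 ≤ x := (le_max_left _ _).trans hx
  have hx16 : (16 : ℝ) ≤ x := (le_max_right _ _).trans hx
  have hl0 : 0 < Real.log x := Real.log_pos (by linarith)
  have hlog : Real.log (2 * x) ≤ Real.log 2 + x / 16 := by
    rw [Real.log_mul (by norm_num) (by linarith)]
    have := hx₁ x ((le_max_left _ _).trans hx1)
    rw [Real.norm_eq_abs, abs_of_pos hl0, id, Real.norm_eq_abs, abs_of_pos (by linarith)] at this
    linarith
  refine le_trans ?_ (Chebyshev.pi_ge' (show 1 < x by linarith))
  rw [mul_div_assoc', div_le_div_iff_of_pos_right hl0]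
  have h2 : Real.log (x + 2) ≤ Real.log (2 * x) := Real.log_le_log (by linarith) (by linarith)
  have h3 := Real.log_two_gt_d9
  have h4 := Real.log_two_lt_d9
  nlinarith

theorem exists_primeCounting_le : ∃ C : ℝ, 0 < C ∧ ∀ x, 2 ≤ x →
    (Nat.primeCounting ⌊x⌋₊ : ℝ) ≤ C * (x / Real.log x) := by
  refine ⟨2 * Real.log 4 + 2, by positivity, fun x hx => ?_⟩
  have hl0 : 0 < Real.log x := Real.log_pos (by linarith)
  have hs : √x * √x = x := Real.mul_self_sqrt (by linarith)
  have hs0 : 0 < √x := Real.sqrt_pos.2 (by linarith)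
  have h1 := Chebyshev.pi_le_log4_mul_div (show 1 < x by linarith)
  have h2 : Real.log √x = Real.log x / 2 := Real.log_sqrt (by linarith)
  have h3 : Real.log x ≤ 2 * √x := by
    have := Real.log_le_sub_one_of_pos hs0
    linarith
  have h4 : √x ≤ 2 * (x / Real.log x) := by
    rw [mul_div_assoc', le_div_iff₀ hl0]
    nlinarith
  rw [h2] at h1
  calc (Nat.primeCounting ⌊x⌋₊ : ℝ) ≤ _ := h1
    _ ≤ Real.log 4 * x / (Real.log x / 2) + 2 * (x / Real.log x) := by linarith
    _ = _ := by field_simp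

set_option maxHeartbeats 1000000 in
/-- The square sieve with its parameters chosen: the set `A` is small if outside a small set `S` of
primes the functions `u r` are `1` and the functions `G r` are at least `1 / 2` on `A`.

With `q = (U V) ^ (1 / 12)`, the moduli are the `k * p ≤ R = q ^ 4` with `k ≤ K` and `p > K` prime,
where `K` is about `q / 4`. The number of moduli exceeds `R / (128 (|S| + 1))`, as the logarithm
lost in the number of primes `p` is regained from the sum of `1 / k`. -/
theorem exists_card_le_of_isSievePair (C : ℝ) (hC : 0 ≤ C) : ∃ B : ℝ, 0 < B ∧
    ∀ (S : Finset ℕ) (u G : ∀ r : ℕ, ZMod r → ZMod r → ℝ) (A : Finset (ℤ × ℤ)) (U V : ℝ),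
      (∀ p ∈ S, 2 ≤ p) →
      (∀ r, r.Prime → r ∉ S → ∀ _ : NeZero r, IsSievePair r (u r) (G r) (localFactor r) C) →
      1 ≤ V → V ≤ U → (∀ z ∈ A, |(z.1 : ℝ)| ≤ U) → (∀ z ∈ A, |(z.2 : ℝ)| ≤ V) →
      (∀ z ∈ A, ∀ r, r.Prime → r ∉ S → u r z.1 z.2 = 1) →
      (∀ z ∈ A, ∀ r, r.Prime → r ∉ S → 1 / 2 ≤ G r z.1 z.2) →
      (A.card : ℝ) ≤ B * (S.card + 1) ^ 2 * (U * V) ^ (2 / 3 : ℝ) := by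
  classical
  obtain ⟨x₀, hx₀2, hx₀⟩ := exists_primeCounting_ge
  obtain ⟨C₁, hC₁, hπ⟩ := exists_primeCounting_le
  obtain ⟨B₁, hB₁, hsum⟩ := exists_sum_prodPrimes_div_le
  set q₀ : ℝ := max 1024 x₀ with hq₀
  have hq₀1 : 1024 ≤ q₀ := le_max_left _ _
  set C₃ : ℝ := 4 * C₁ * B₁ with hC₃
  have hC₃0 : 0 < C₃ := by positivity
  set B₂ : ℝ := 128 ^ 2 * 64 * (1024 * C₃ + 4 * C ^ 2 * C₃ ^ 2) with hB₂
  have hB₂0 : 0 < B₂ := by positivity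
  refine ⟨9 * q₀ ^ 4 + B₂, by positivity, fun S u G A U V hS hu hV hUV hAU hAV hAu hAG => ?_⟩
  have hU : 1 ≤ U := hV.trans hUV
  have hUV1 : 1 ≤ U * V := one_le_mul_of_one_le_of_one_le hU hV
  obtain ⟨q, hqdef⟩ : ∃ q : ℝ, q = (U * V) ^ (1 / 12 : ℝ) := ⟨_, rfl⟩
  have hq1 : 1 ≤ q := hqdef ▸ Real.one_le_rpow hUV1 (by norm_num)
  have hq12 : q ^ 12 = U * V := by
    rw [hqdef, ← Real.rpow_natCast, ← Real.rpow_mul (by linarith)]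
    norm_num
  have hq8 : (U * V) ^ (2 / 3 : ℝ) = q ^ 8 := by
    rw [hqdef, ← Real.rpow_natCast, ← Real.rpow_mul (by linarith)]
    norm_num
  rw [hq8]
  set W : ℝ := (S.card : ℝ) + 1 with hW
  have hW1 : 1 ≤ W := by rw [hW]; linarith [(Nat.cast_nonneg S.card : (0 : ℝ) ≤ S.card)]
  have hcount : ∀ T : ℝ, 1 ≤ T → (((Finset.Icc (-⌊T⌋) ⌊T⌋).card : ℕ) : ℝ) ≤ 3 * T := by
    intro T hT
    have h1 : 0 ≤ ⌊T⌋ := Int.floor_nonneg.2 (by linarith)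
    have h2 := Int.floor_le T
    rw [Int.card_Icc]
    have h3 : (((⌊T⌋ + 1 - -⌊T⌋).toNat : ℤ) : ℝ) = 2 * ⌊T⌋ + 1 := by
      rw [Int.toNat_of_nonneg (by omega)]; push_cast; ring
    have h4 : (((⌊T⌋ + 1 - -⌊T⌋).toNat : ℕ) : ℝ) = 2 * ⌊T⌋ + 1 := by rw [← h3]; norm_cast
    rw [h4]; linarith
  by_cases hsmall : q ^ 4 ≤ q₀ ^ 4 * W ^ 2
  · -- the trivial bound suffices
    have hA : A ⊆ Finset.Icc (-⌊U⌋) ⌊U⌋ ×ˢ Finset.Icc (-⌊V⌋) ⌊V⌋ := by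
      intro z hz
      have hb : ∀ (n : ℤ) (T : ℝ), |(n : ℝ)| ≤ T → n ∈ Finset.Icc (-⌊T⌋) ⌊T⌋ := by
        intro n T hn
        rw [Finset.mem_Icc]
        have h1 : n ≤ ⌊T⌋ := Int.le_floor.2 ((le_abs_self _).trans hn)
        have h2 : -n ≤ ⌊T⌋ := Int.le_floor.2 (by push_cast; exact (neg_le_abs _).trans hn)
        omega
      exact Finset.mem_product.2 ⟨hb _ _ (hAU z hz), hb _ _ (hAV z hz)⟩
    have h1 : (A.card : ℝ) ≤ 3 * U * (3 * V) := by
      refine (Nat.cast_le.2 (Finset.card_le_card hA)).trans ?_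
      rw [Finset.card_product]
      push_cast
      exact mul_le_mul (hcount U hU) (hcount V hV) (Nat.cast_nonneg _) (by linarith)
    calc (A.card : ℝ) ≤ 9 * q ^ 12 := by rw [hq12]; linarith
      _ = 9 * q ^ 4 * q ^ 8 := by ring
      _ ≤ 9 * (q₀ ^ 4 * W ^ 2) * q ^ 8 := by gcongr
      _ = 9 * q₀ ^ 4 * W ^ 2 * q ^ 8 := by ring
      _ ≤ _ := by gcongr; linarith
  push Not at hsmall
  have hqq₀ : q₀ ≤ q := by
    refine le_of_pow_le_pow_left₀ (n := 4) (by norm_num) (by linarith) (le_trans ?_ hsmall.le)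
    exact le_mul_of_one_le_right (by positivity) (one_le_pow₀ hW1)
  have hq1024 : 1024 ≤ q := hq₀1.trans hqq₀
  have hqx₀ : x₀ ≤ q := (le_max_right _ _).trans hqq₀
  have hWq : W ≤ q ^ 2 := by
    refine le_of_pow_le_pow_left₀ (n := 2) (by norm_num) (by positivity) ?_
    calc W ^ 2 ≤ q₀ ^ 4 * W ^ 2 := le_mul_of_one_le_left (by positivity)
          (one_le_pow₀ (by linarith))
      _ ≤ q ^ 4 := hsmall.le
      _ = _ := by ring
  set R : ℝ := q ^ 4 with hR
  set K : ℕ := ⌊q / 4⌋₊ with hKdef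
  have hq0 : 0 < q := by linarith
  have hK1 : (K : ℝ) ≤ q / 4 := Nat.floor_le (by linarith)
  have hK2 : q / 4 < K + 1 := Nat.lt_floor_add_one _
  have hR0 : 0 < R := by rw [hR]; positivity
  have hW0 : 0 < W := by linarith
  clear_value K R W C₃ B₂ q₀
  have hKpos : (1 : ℝ) ≤ K := by
    have : (0 : ℝ) < K := by linarith
    exact_mod_cast (by exact_mod_cast this : 0 < K)
  have hlq : 0 < Real.log q := Real.log_pos (by linarith)
  -- logarithms are small compared with powers of `q`
  have hlogq : 16 * Real.log q ≤ q := by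
    have hs : √q * √q = q := Real.mul_self_sqrt hq0.le
    have hs32 : 32 ≤ √q := Real.le_sqrt_of_sq_le (by linarith)
    have h1 := Real.log_le_sub_one_of_pos (show 0 < √q by linarith)
    rw [Real.log_sqrt hq0.le] at h1
    nlinarith
  have hlogK : Real.log q / 2 ≤ Real.log (K + 1) := by
    rw [← Real.log_sqrt hq0.le]
    have hs : √q * √q = q := Real.mul_self_sqrt hq0.le
    have hs32 : 32 ≤ √q := Real.le_sqrt_of_sq_le (by linarith)
    exact Real.log_le_log (by linarith) (by nlinarith)
  have hlogK' : Real.log K ≤ Real.log q := Real.log_le_log (by linarith) (by linarith)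
  have hlogR : Real.log R = 4 * Real.log q := by rw [hR, Real.log_pow]; norm_num
  have hlog1 : 1 ≤ Real.log q := by
    rw [Real.le_log_iff_exp_le hq0]
    linarith [Real.exp_one_lt_d9]
  have hqR : q ≤ R := by rw [hR]; exact le_self_pow₀ hq1 (by norm_num)
  set t : ℕ → Finset ℕ := fun k => (Finset.range (⌊R⌋₊ + 1)).filter
    fun p => p.Prime ∧ p ∉ S ∧ K < p ∧ (k : ℝ) * p ≤ R with ht
  set M : Finset (ℕ × ℕ) := (sievingNumbers S K ×ˢ Finset.range (⌊R⌋₊ + 1)).filter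
    fun i => i.2.Prime ∧ i.2 ∉ S ∧ K < i.2 ∧ (i.1 : ℝ) * i.2 ≤ R with hM
  have hMsum : ∀ F : ℕ → ℝ, ∑ i ∈ M, F i.1 = ∑ k ∈ sievingNumbers S K, F k * (t k).card := by
    intro F
    rw [hM, Finset.sum_filter, Finset.sum_product]
    refine Finset.sum_congr rfl fun k _ => ?_
    rw [← Finset.sum_filter]
    simp [ht, mul_comm]
  have hkmem : ∀ k ∈ sievingNumbers S K, 1 ≤ k ∧ k ≤ K ∧ Squarefree k ∧
      Disjoint k.primeFactors S := by
    intro k hk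
    obtain ⟨h1, h2⟩ := Finset.mem_filter.1 hk
    rw [Finset.mem_Icc] at h1
    exact ⟨h1.1, h1.2, h2⟩
  -- the number of primes that go with a given `k`
  have hxk : ∀ k ∈ sievingNumbers S K, 4 * q ^ 3 ≤ R / k ∧ R / k ≤ R := by
    intro k hk
    obtain ⟨h1, h2, -⟩ := hkmem k hk
    have h1R : (1 : ℝ) ≤ k := by exact_mod_cast h1
    have h2R : (k : ℝ) ≤ K := by exact_mod_cast h2
    refine ⟨?_, div_le_self (by positivity) h1R⟩
    rw [le_div_iff₀ (by linarith)]
    calc 4 * q ^ 3 * k ≤ 4 * q ^ 3 * (q / 4) := by gcongr; linarith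
      _ = R := by rw [hR]; ring
  have hπcard : ∀ n : ℕ, Nat.primeCounting n = ((Finset.range (n + 1)).filter Nat.Prime).card := by
    intro n
    rw [Nat.primeCounting, Nat.primeCounting', Nat.count_eq_card_filter_range]
  have hq3 : q ≤ q ^ 3 := le_self_pow₀ hq1 (by norm_num)
  have htle : ∀ k ∈ sievingNumbers S K, ((t k).card : ℝ) ≤ C₁ * (R / Real.log q) / k := by
    intro k hk
    obtain ⟨hx1, hx2⟩ := hxk k hk
    have hk0 : (0 : ℝ) < k := by exact_mod_cast (hkmem k hk).1
    have hsub : t k ⊆ (Finset.range (⌊R / k⌋₊ + 1)).filter Nat.Prime := by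
      intro p hp
      obtain ⟨-, hpp, -, -, hkp⟩ := Finset.mem_filter.1 hp
      rw [Finset.mem_filter, Finset.mem_range, Nat.lt_succ_iff]
      refine ⟨Nat.le_floor ?_, hpp⟩
      rw [le_div_iff₀ hk0]
      linarith
    have h1 : ((t k).card : ℝ) ≤ Nat.primeCounting ⌊R / k⌋₊ := by
      rw [hπcard]
      exact_mod_cast Finset.card_le_card hsub
    have h2 : Real.log q ≤ Real.log (R / k) := Real.log_le_log hq0 (by linarith)
    calc ((t k).card : ℝ) ≤ C₁ * (R / k / Real.log (R / k)) := h1.trans (hπ _ (by linarith))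
      _ ≤ C₁ * (R / k / Real.log q) := by gcongr
      _ = _ := by ring
  have hle_t : ∀ k ∈ sievingNumbers S K, R / (32 * Real.log q) * (k : ℝ)⁻¹ ≤ (t k).card := by
    intro k hk
    obtain ⟨hx1, hx2⟩ := hxk k hk
    have hk0 : (0 : ℝ) < k := by exact_mod_cast (hkmem k hk).1
    have hsub : (Finset.range (⌊R / k⌋₊ + 1)).filter Nat.Prime ⊆ t k ∪ (S ∪ Finset.Icc 1 K) := by
      intro p hp
      obtain ⟨hpr, hpp⟩ := Finset.mem_filter.1 hp
      rw [Finset.mem_range, Nat.lt_succ_iff, Nat.le_floor_iff (by positivity)] at hpr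
      rw [Finset.mem_union, Finset.mem_union]
      by_cases h1 : p ∈ S
      · exact Or.inr (Or.inl h1)
      by_cases h2 : p ≤ K
      · exact Or.inr (Or.inr (Finset.mem_Icc.2 ⟨hpp.one_le, h2⟩))
      · refine Or.inl (Finset.mem_filter.2 ⟨?_, hpp, h1, by omega, ?_⟩)
        · rw [Finset.mem_range, Nat.lt_succ_iff]
          exact Nat.le_floor (hpr.trans hx2)
        · rw [le_div_iff₀ hk0] at hpr
          linarith
    have h1 : (Nat.primeCounting ⌊R / k⌋₊ : ℝ) ≤ (t k).card + (S.card + K) := by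
      rw [hπcard]
      have h2 := (Finset.card_le_card hsub).trans (Finset.card_union_le _ _)
      have h3 := Finset.card_union_le S (Finset.Icc 1 K)
      rw [Nat.card_Icc, Nat.add_sub_cancel] at h3
      exact_mod_cast h2.trans (Nat.add_le_add_left h3 _)
    have h2 : Real.log (R / k) ≤ 4 * Real.log q := by
      rw [← hlogR]; exact Real.log_le_log (by positivity) hx2
    have hlx : 0 < Real.log (R / k) := Real.log_pos (by linarith)
    have h3 : 1 / 4 * (R / k / (4 * Real.log q)) ≤ Nat.primeCounting ⌊R / k⌋₊ := by
      refine le_trans ?_ (hx₀ _ (by linarith))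
      gcongr
    have h4 : (S.card : ℝ) + K ≤ R / k / (32 * Real.log q) := by
      rw [le_div_iff₀ (by positivity)]
      have e1 : (S.card : ℝ) + K ≤ 2 * q ^ 2 := by
        have : q ≤ q ^ 2 := le_self_pow₀ hq1 (by norm_num)
        rw [hW] at hWq
        linarith
      calc ((S.card : ℝ) + K) * (32 * Real.log q) ≤ 2 * q ^ 2 * (2 * q) := by
            refine mul_le_mul e1 (by linarith) (by positivity) (by positivity)
        _ = 4 * q ^ 3 := by ring
        _ ≤ _ := hx1
    have h5 : 1 / 4 * (R / k / (4 * Real.log q)) = 2 * (R / k / (32 * Real.log q)) := by ring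
    have h6 : R / (32 * Real.log q) * (k : ℝ)⁻¹ = R / k / (32 * Real.log q) := by ring
    linarith
  have hMcard : R / (128 * W) ≤ M.card := by
    have h1 : (M.card : ℝ) = ∑ k ∈ sievingNumbers S K, ((t k).card : ℝ) := by
      have := hMsum fun _ => 1
      simpa using this
    have h2 := log_le_sum_sievingNumbers S hS K
    have h3 : Real.log q / (4 * W) ≤ ∑ k ∈ sievingNumbers S K, (k : ℝ)⁻¹ := by
      rw [div_le_iff₀ (by positivity)]
      nlinarith
    rw [h1]
    calc R / (128 * W) = R / (32 * Real.log q) * (Real.log q / (4 * W)) := by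
          rw [div_mul_div_comm]; field_simp; ring
      _ ≤ R / (32 * Real.log q) * ∑ k ∈ sievingNumbers S K, (k : ℝ)⁻¹ := by gcongr
      _ ≤ _ := by
        rw [Finset.mul_sum]
        exact Finset.sum_le_sum hle_t
  have hloc0 : ∀ k, 0 ≤ prodPrimes localFactor k := fun k =>
    Finset.prod_nonneg fun r _ => by rw [localFactor]; positivity
  have hH : ∑ i ∈ M, prodPrimes localFactor i.1 ≤ C₃ * R := by
    rw [hMsum]
    calc ∑ k ∈ sievingNumbers S K, prodPrimes localFactor k * (t k).card ≤
        ∑ k ∈ sievingNumbers S K, prodPrimes localFactor k * (C₁ * (R / Real.log q) / k) :=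
          Finset.sum_le_sum fun k hk => mul_le_mul_of_nonneg_left (htle k hk) (hloc0 k)
      _ = C₁ * (R / Real.log q) * ∑ k ∈ sievingNumbers S K, prodPrimes localFactor k / k := by
          rw [Finset.mul_sum]
          exact Finset.sum_congr rfl fun k _ => by ring
      _ ≤ C₁ * (R / Real.log q) * (B₁ * (2 * Real.log q)) := by
          have h1 := hsum K (sievingNumbers S K) (Finset.filter_subset _ _)
            fun k hk => (hkmem k hk).2.2.1
          gcongr
          refine h1.trans ?_
          gcongr
          linarith
      _ = 2 * C₁ * B₁ * R := by field_simp
      _ ≤ C₃ * R := by rw [hC₃]; gcongr; norm_num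
  have hH0 : 0 ≤ ∑ i ∈ M, prodPrimes localFactor i.1 := Finset.sum_nonneg fun i _ => hloc0 _
  have hV6 : V ≤ q ^ 6 := by
    refine le_of_pow_le_pow_left₀ (n := 2) (by norm_num) (by positivity) ?_
    calc V ^ 2 ≤ U * V := by rw [sq]; gcongr
      _ = _ := by rw [← hq12]; ring
  have hU6 : q ^ 6 ≤ U := by
    refine le_of_pow_le_pow_left₀ (n := 2) (by norm_num) (by positivity) ?_
    calc (q ^ 6) ^ 2 = U * V := by rw [← hq12]; ring
      _ ≤ U ^ 2 := by rw [sq]; gcongr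
  have hKsq : (K : ℝ) ^ 2 ≤ q ^ 2 / 16 := by
    calc (K : ℝ) ^ 2 ≤ (q / 4) ^ 2 := by gcongr
      _ = _ := by ring
  set P : Finset ℕ := (Finset.range (⌊R⌋₊ + 1)).filter fun p => p.Prime ∧ p ∉ S with hP
  have hMmem : ∀ i ∈ M, i.1 ∈ sievingNumbers S K ∧ i.2 ∈ Finset.range (⌊R⌋₊ + 1) ∧ i.2.Prime ∧
      i.2 ∉ S ∧ K < i.2 ∧ (i.1 : ℝ) * i.2 ≤ R := by
    intro i hi
    obtain ⟨h1, h2⟩ := Finset.mem_filter.1 hi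
    exact ⟨(Finset.mem_product.1 h1).1, (Finset.mem_product.1 h1).2, h2⟩
  have key := card_mul_card_sq_le (P := P) (u := u) (G := G) (h := localFactor) (C := C) (R := R)
    (U := U) (V := V) (K := K) (fun r hr => (Finset.mem_filter.1 hr).2.1)
    (fun r hr => hu r (Finset.mem_filter.1 hr).2.1 (Finset.mem_filter.1 hr).2.2) hC A hU hV hAU hAV
    (fun z hz r hr => hAu z hz r (Finset.mem_filter.1 hr).2.1 (Finset.mem_filter.1 hr).2.2)
    (fun z hz r hr => hAG z hz r (Finset.mem_filter.1 hr).2.1 (Finset.mem_filter.1 hr).2.2) M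
    (fun i hi => (hkmem _ (hMmem i hi).1).2.2.1) (fun i hi r hr => by
      obtain ⟨h1, h2, -, h4⟩ := hkmem _ (hMmem i hi).1
      have hrp := Nat.prime_of_mem_primeFactors hr
      have hrk : r ≤ K := (Nat.le_of_dvd h1 (Nat.dvd_of_mem_primeFactors hr)).trans h2
      refine Finset.mem_filter.2 ⟨?_, hrp, Finset.disjoint_left.1 h4 hr⟩
      rw [Finset.mem_range, Nat.lt_succ_iff]
      refine Nat.le_floor ?_
      have : (r : ℝ) ≤ K := by exact_mod_cast hrk
      linarith)
    (fun i hi => Finset.mem_filter.2 ⟨(hMmem i hi).2.1, (hMmem i hi).2.2.1, (hMmem i hi).2.2.2.1⟩)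
    (fun i hi => (hkmem _ (hMmem i hi).1).2.1) (fun i hi => (hMmem i hi).2.2.2.2.1)
    (fun i hi => (hMmem i hi).2.2.2.2.2)
    (by
      have : q ^ 2 ≤ q ^ 6 := pow_le_pow_right₀ hq1 (by norm_num)
      nlinarith)
    (by
      calc (K : ℝ) ^ 2 * (16 * V) ≤ q ^ 2 / 16 * (16 * q ^ 6) := by gcongr
        _ = R ^ 2 := by rw [hR]; ring)
  have hM0 : 0 < R / (128 * W) := by positivity
  have h1 : (A.card : ℝ) * (R / (128 * W)) ^ 2 ≤
      64 * (1024 * C₃ + 4 * C ^ 2 * C₃ ^ 2) * R ^ 4 := by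
    calc (A.card : ℝ) * (R / (128 * W)) ^ 2 ≤ A.card * M.card ^ 2 := by gcongr
      _ ≤ _ := key
      _ ≤ 64 * (4 * (16 * U) * (16 * V) * (C₃ * R) + 4 * C ^ 2 * R ^ 2 * (C₃ * R) ^ 2) := by
        gcongr
      _ = 64 * (1024 * (U * V) * (C₃ * R) + 4 * C ^ 2 * R ^ 2 * (C₃ * R) ^ 2) := by ring
      _ = _ := by rw [← hq12, hR]; ring
  have h2 : (A.card : ℝ) * (R / (128 * W)) ^ 2 = A.card / (128 ^ 2 * W ^ 2) * R ^ 2 := by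
    rw [div_pow, mul_pow]; ring
  have h3 : (A.card : ℝ) / (128 ^ 2 * W ^ 2) ≤ 64 * (1024 * C₃ + 4 * C ^ 2 * C₃ ^ 2) * R ^ 2 := by
    have hR2 : 0 < R ^ 2 := by positivity
    refine le_of_mul_le_mul_right ?_ hR2
    rw [← h2]
    refine h1.trans (le_of_eq (by ring))
  rw [div_le_iff₀ (by positivity)] at h3
  calc (A.card : ℝ) ≤ _ := h3
    _ = B₂ * W ^ 2 * q ^ 8 := by rw [hB₂, hR]; ring
    _ ≤ _ := by gcongr; linarith [show 0 < 9 * q₀ ^ 4 by positivity]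

end Counting

/-! ### The sieve for a binary form -/

section Forms

open Polynomial

variable {R : Type*} [CommRing R]

/-- The value at `(x, y)` of the binary form of degree `D` which dehomogenizes to `f`. -/
def formEval (f : R[X]) (D : ℕ) (x y : R) : R :=
  ∑ i ∈ Finset.range (D + 1), f.coeff i * x ^ i * y ^ (D - i)

theorem formEval_mul_mul (f : R[X]) (D : ℕ) (t x y : R) :
    formEval f D (t * x) (t * y) = t ^ D * formEval f D x y := by
  rw [formEval, formEval, Finset.mul_sum]
  refine Finset.sum_congr rfl fun i hi => ?_
  have hi' : i ≤ D := Nat.lt_succ_iff.1 (Finset.mem_range.1 hi)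
  rw [mul_pow, mul_pow, ← Nat.add_sub_of_le hi', pow_add, Nat.add_sub_of_le hi']
  ring

theorem formEval_one_right {f : R[X]} {D : ℕ} (hf : f.natDegree ≤ D) (x : R) :
    formEval f D x 1 = f.eval x := by
  rw [formEval, Polynomial.eval_eq_sum_range' (Nat.lt_succ_iff.2 hf)]
  simp

theorem formEval_zero_right (f : R[X]) (D : ℕ) (x : R) : formEval f D x 0 = f.coeff D * x ^ D := by
  rw [formEval, Finset.sum_range_succ, Finset.sum_eq_zero]
  · simp
  · intro i hi
    have : D - i ≠ 0 := by have := Finset.mem_range.1 hi; omega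
    rw [zero_pow this, mul_zero]

theorem formEval_map {S : Type*} [CommRing S] (φ : R →+* S) (f : R[X]) (D : ℕ) (x y : R) :
    formEval (f.map φ) D (φ x) (φ y) = φ (formEval f D x y) := by
  simp [formEval]

theorem Squarefree.comp_C_mul_X {K : Type*} [Field K] {f : K[X]} (hf : Squarefree f) {c : K}
    (hc : c ≠ 0) : Squarefree (f.comp (C c * X)) := by
  intro g hg
  have hinv : (C c * X : K[X]).comp (C c⁻¹ * X) = X := by
    rw [mul_comp, C_comp, X_comp, ← mul_assoc, ← C_mul, mul_inv_cancel₀ hc, C_1, one_mul]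
  have h1 : g.comp (C c⁻¹ * X) * g.comp (C c⁻¹ * X) ∣ f := by
    obtain ⟨h, hh⟩ := hg
    refine ⟨h.comp (C c⁻¹ * X), ?_⟩
    rw [← mul_comp, ← mul_comp, ← hh, comp_assoc, hinv, comp_X]
  have h2 := hf _ h1
  have h3 := (natDegree_eq_zero_of_isUnit h2)
  rw [natDegree_comp, natDegree_C_mul_X _ (inv_ne_zero hc), mul_one] at h3
  rw [eq_C_of_natDegree_eq_zero h3, C_comp] at h2
  rw [eq_C_of_natDegree_eq_zero h3]
  exact h2

end Forms

section GoodPrimes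

open Polynomial

/-- A prime at which the form of degree `D` attached to `f` can be used in the sieve. The reduction
of `f` has the degree of `f`, which can be smaller than `D`. -/
structure IsGoodPrime (D : ℕ) (f : ℤ[X]) (r : ℕ) : Prop where
  not_dvd : ¬ (r : ℤ) ∣ f.leadingCoeff
  squarefree : Squarefree (f.map (Int.castRingHom (ZMod r)))
  large : 80 * ((D : ℝ) + 2) ^ 2 ≤ (r : ℝ) ^ (1 / 4 : ℝ)

variable {D : ℕ} {f : ℤ[X]} {r : ℕ}

theorem IsGoodPrime.natDegree_map (h : IsGoodPrime D f r) :
    (f.map (Int.castRingHom (ZMod r))).natDegree = f.natDegree := by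
  refine natDegree_map_of_leadingCoeff_ne_zero _ fun h0 => h.not_dvd ?_
  rwa [eq_intCast, ZMod.intCast_zmod_eq_zero_iff_dvd] at h0

/-- The factors `a` and `b` of the variables are units at `r`, and change the dehomogenization only
by a substitution. -/
theorem IsGoodPrime.isGoodReduction [Fact r.Prime] (h : IsGoodPrime D f r) (hodd : Odd D)
    (h2 : 2 ≤ f.natDegree) (hD : f.natDegree ≤ D) {a b : ZMod r} (ha : a ≠ 0) (hb : b ≠ 0) :
    IsGoodReduction D
      (C (b ^ D) * (f.map (Int.castRingHom (ZMod r))).comp (C (a / b) * X))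
      (fun x y => formEval (f.map (Int.castRingHom (ZMod r))) D (a * x) (b * y)) := by
  have hab : a / b ≠ 0 := div_ne_zero ha hb
  have hbD : b ^ D ≠ 0 := pow_ne_zero _ hb
  have hdeg : (C (b ^ D) * (f.map (Int.castRingHom (ZMod r))).comp (C (a / b) * X)).natDegree =
      f.natDegree := by
    rw [natDegree_C_mul hbD, natDegree_comp, natDegree_C_mul_X _ hab, mul_one, h.natDegree_map]
  have hr1 : (1 : ℝ) ≤ r := by exact_mod_cast (Fact.out : r.Prime).one_le
  have hsqrt : (r : ℝ) ^ (1 / 4 : ℝ) ≤ √r := by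
    rw [Real.sqrt_eq_rpow]
    exact Real.rpow_le_rpow_of_exponent_le hr1 (by norm_num)
  have hD0 : (0 : ℝ) ≤ D := Nat.cast_nonneg D
  refine ⟨hodd, ?_, fun t x y => ?_, fun x => ?_, ?_, by rwa [hdeg], by rwa [hdeg], ?_⟩
  · rintro rfl
    have h1 : ((2 : ℕ) : ℝ) ^ (1 / 4 : ℝ) ≤ ((2 : ℕ) : ℝ) ^ (1 : ℝ) :=
      Real.rpow_le_rpow_of_exponent_le (by norm_num) (by norm_num)
    have h3 := h.large
    rw [Real.rpow_one] at h1
    norm_num at h1 h3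
    nlinarith
  · rw [show a * (t * x) = t * (a * x) by ring, show b * (t * y) = t * (b * y) by ring,
      formEval_mul_mul]
  · have hx : a * x = b * (a / b * x) := by field_simp
    rw [hx, formEval_mul_mul, formEval_one_right (by rwa [h.natDegree_map])]
    simp
  · have hu : IsUnit (C (b ^ D) : (ZMod r)[X]) := isUnit_C.2 (IsUnit.mk0 _ hbD)
    exact (Associated.squarefree_iff (associated_unit_mul_left _ _ hu)).2
      (h.squarefree.comp_C_mul_X hab)
  · have := h.large
    nlinarith

theorem IsGoodReduction.isSievePair {p : ℕ} [Fact p.Prime] {f : (ZMod p)[X]}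
    {Φ : ZMod p → ZMod p → ZMod p} (h : IsGoodReduction D f Φ)
    (hp : 80 * ((D : ℝ) + 2) ^ 2 ≤ (p : ℝ) ^ (1 / 4 : ℝ)) :
    IsSievePair p (unitSign Φ) (centeredSign Φ) (localFactor p) (10 * ((D : ℝ) + 2) ^ 2) := by
  have hp0 : (0 : ℝ) < p := by exact_mod_cast (Fact.out : p.Prime).pos
  have hle : 1 + 8 * (10 * ((D : ℝ) + 2) ^ 2 / √p) ≤ localFactor p := by
    rw [localFactor]
    have e : (p : ℝ) ^ (-(1 / 4) : ℝ) = (p : ℝ) ^ (1 / 4 : ℝ) / √p := by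
      rw [Real.sqrt_eq_rpow, ← Real.rpow_sub hp0]
      norm_num
    rw [e]
    have : 8 * (10 * ((D : ℝ) + 2) ^ 2 / √p) = 80 * ((D : ℝ) + 2) ^ 2 / √p := by ring
    rw [this]
    gcongr
  have hloc : 0 ≤ localFactor p := by rw [localFactor]; positivity
  refine ⟨IsGoodReduction.sum_unitSign, fun y => ?_, fun a => ?_, h.abs_centeredSign_le,
    zmodHat_zero_left_of_sum_eq_zero IsGoodReduction.sum_centeredSign,
    fun a ha b => h.norm_zmodHat_centeredSign_le ha b⟩
  · exact (h.sum_unitSign_sq_le y).trans (mul_le_mul_of_nonneg_left hle hp0.le)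
  · by_cases ha : a = 0
    · subst ha
      rw [Finset.sum_eq_zero fun b _ => by
        rw [zmodHat_zero_left_of_sum_eq_zero IsGoodReduction.sum_unitSign, norm_zero]]
      exact hloc
    · exact (h.sum_norm_zmodHat_unitSign_le ha).trans hle

/-- The sieve bound for the points at which the form `F(a x, b y)` is a square, as long as no such
point lies on a row that degenerates at one of the primes of the sieve. -/
theorem exists_card_le_of_isSquare (D : ℕ) (hodd : Odd D) : ∃ B : ℝ, 0 < B ∧
    ∀ (S : Finset ℕ) (f : ℤ[X]) (a b : ℤ) (A : Finset (ℤ × ℤ)) (U V : ℝ),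
      2 ≤ f.natDegree → f.natDegree ≤ D → (∀ p ∈ S, 2 ≤ p) →
      (∀ r, r.Prime → r ∉ S → IsGoodPrime D f r ∧ ¬ (r : ℤ) ∣ a ∧ ¬ (r : ℤ) ∣ b) →
      1 ≤ V → V ≤ U → (∀ z ∈ A, |(z.1 : ℝ)| ≤ U) → (∀ z ∈ A, |(z.2 : ℝ)| ≤ V) →
      (∀ z ∈ A, IsSquare (formEval f D (a * z.1) (b * z.2))) →
      (∀ z ∈ A, ∀ r : ℕ, r.Prime → r ∉ S → (r : ℤ) ∣ z.2 → ¬ (r : ℤ) ∣ f.coeff D) →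
      (A.card : ℝ) ≤ B * (S.card + 1) ^ 2 * (U * V) ^ (2 / 3 : ℝ) := by
  classical
  obtain ⟨B, hB, key⟩ := exists_card_le_of_isSievePair (10 * ((D : ℝ) + 2) ^ 2) (by positivity)
  refine ⟨B, hB, fun S f a b A U V h2 hD hS hgood hV hUV hAU hAV hsq hnd => ?_⟩
  set Φ : ∀ r : ℕ, ZMod r → ZMod r → ZMod r := fun r x y =>
    formEval (f.map (Int.castRingHom (ZMod r))) D (a * x) (b * y) with hΦ
  have hred : ∀ r (hr : r.Prime), r ∉ S → haveI : Fact r.Prime := ⟨hr⟩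
      ∃ g, IsGoodReduction D g (Φ r) := by
    intro r hr hrS
    have : Fact r.Prime := ⟨hr⟩
    obtain ⟨h1, h3, h4⟩ := hgood r hr hrS
    rw [← ZMod.intCast_zmod_eq_zero_iff_dvd] at h3 h4
    exact ⟨_, h1.isGoodReduction hodd h2 hD h3 h4⟩
  set u : ∀ r : ℕ, ZMod r → ZMod r → ℝ := fun r => if hr : r.Prime then
    have : Fact r.Prime := ⟨hr⟩
    unitSign (Φ r) else fun _ _ => 0 with hu
  set G : ∀ r : ℕ, ZMod r → ZMod r → ℝ := fun r => if hr : r.Prime then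
    have : Fact r.Prime := ⟨hr⟩
    centeredSign (Φ r) else fun _ _ => 0 with hG
  have hpoint : ∀ z ∈ A, ∀ r, r.Prime → r ∉ S →
      ¬ (((z.2 : ZMod r)) = 0 ∧ Φ r 1 0 = 0) ∧ IsSquare (Φ r z.1 z.2) := by
    intro z hz r hr hrS
    have : Fact r.Prime := ⟨hr⟩
    constructor
    · rintro ⟨h0, h1⟩
      rw [ZMod.intCast_zmod_eq_zero_iff_dvd] at h0
      refine hnd z hz r hr hrS h0 ?_
      have ha : (a : ZMod r) ≠ 0 := by
        rw [Ne, ZMod.intCast_zmod_eq_zero_iff_dvd]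
        exact (hgood r hr hrS).2.1
      simp only [hΦ, mul_zero, mul_one, formEval_zero_right, coeff_map] at h1
      have h3 := (mul_eq_zero.1 h1).resolve_right (pow_ne_zero _ ha)
      rwa [eq_intCast, ZMod.intCast_zmod_eq_zero_iff_dvd] at h3
    · have h1 := (hsq z hz).map (Int.castRingHom (ZMod r))
      rw [← formEval_map] at h1
      simpa [hΦ] using h1
  refine key S u G A U V hS (fun r hr hrS hne => ?_) hV hUV hAU hAV (fun z hz r hr hrS => ?_)
    (fun z hz r hr hrS => ?_)
  · obtain ⟨g, hg⟩ := hred r hr hrS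
    have : Fact r.Prime := ⟨hr⟩
    simp only [hu, hG, dif_pos hr]
    exact hg.isSievePair (hgood r hr hrS).1.large
  · obtain ⟨g, hg⟩ := hred r hr hrS
    have : Fact r.Prime := ⟨hr⟩
    simp only [hu, dif_pos hr]
    exact hg.unitSign_eq_one (hpoint z hz r hr hrS).1 (hpoint z hz r hr hrS).2
  · obtain ⟨g, hg⟩ := hred r hr hrS
    have : Fact r.Prime := ⟨hr⟩
    simp only [hG, dif_pos hr]
    exact hg.half_le_centeredSign (hpoint z hz r hr hrS).1 (hpoint z hz r hr hrS).2

end GoodPrimes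

/-! ### The primes to avoid -/

section BadPrimes

open Polynomial

theorem Nat.two_pow_card_primeFactors_le {n : ℕ} (hn : n ≠ 0) : 2 ^ n.primeFactors.card ≤ n := by
  calc 2 ^ n.primeFactors.card ≤ ∏ p ∈ n.primeFactors, p :=
        Finset.pow_card_le_prod _ _ _ fun p hp => (Nat.prime_of_mem_primeFactors hp).two_le
    _ ≤ n := Nat.le_of_dvd (Nat.pos_of_ne_zero hn) (Nat.prod_primeFactors_dvd n)

/-- The entries of the Sylvester matrix are at most `D * H`. -/
theorem abs_resultant_derivative_le {f : ℤ[X]} {D H : ℕ} (hD : f.natDegree ≤ D) (hD1 : 1 ≤ D)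
    (hH : 1 ≤ H) (hf : ∀ i, (f.coeff i).natAbs ≤ H) :
    (f.resultant (derivative f)).natAbs ≤ (2 * D).factorial * (D * H) ^ (2 * D) := by
  have hDH : 1 ≤ D * H := Nat.one_le_iff_ne_zero.2 (by positivity)
  have hHD : H ≤ D * H := Nat.le_mul_of_pos_left H hD1
  have hder : ∀ i, ((derivative f).coeff i).natAbs ≤ D * H := by
    intro i
    rw [coeff_derivative]
    by_cases hi : f.natDegree < i + 1
    · rw [coeff_eq_zero_of_natDegree_lt hi, zero_mul]
      simp
    · rw [Int.natAbs_mul, mul_comm]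
      refine Nat.mul_le_mul ?_ (hf _)
      have : ((i : ℤ) + 1).natAbs = i + 1 := by omega
      omega
  have hentry : ∀ i j, AbsoluteValue.abs (f.sylvester (derivative f) f.natDegree
      (derivative f).natDegree i j) ≤ ((D * H : ℕ) : ℤ) := by
    intro i j
    have hn : ∀ z : ℤ, z.natAbs ≤ D * H → AbsoluteValue.abs z ≤ ((D * H : ℕ) : ℤ) := by
      intro z hz
      rw [AbsoluteValue.abs_apply, Int.abs_eq_natAbs]
      exact_mod_cast hz
    refine hn _ ?_
    rw [sylvester, Matrix.of_apply]
    induction j using Fin.addCases with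
    | left j =>
      rw [Fin.addCases_left]
      split_ifs
      · exact hder _
      · simp
    | right j =>
      rw [Fin.addCases_right]
      split_ifs
      · exact (hf _).trans hHD
      · simp
  have h1 := Matrix.det_le hentry
  rw [Fintype.card_fin, nsmul_eq_mul, AbsoluteValue.abs_apply, Int.abs_eq_natAbs] at h1
  have hn : f.natDegree + (derivative f).natDegree ≤ 2 * D := by
    have := natDegree_derivative_le f
    omega
  have h2 : (f.resultant (derivative f)).natAbs ≤
      (f.natDegree + (derivative f).natDegree).factorial *
      (D * H) ^ (f.natDegree + (derivative f).natDegree) := by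
    rw [resultant]
    exact_mod_cast h1
  exact h2.trans (Nat.mul_le_mul (Nat.factorial_le hn) (Nat.pow_le_pow_right hDH hn))

theorem resultant_derivative_ne_zero {f : ℤ[X]} (hsq : Squarefree (f.map (Int.castRingHom ℚ))) :
    f.resultant (derivative f) ≠ 0 := by
  have hinj : Function.Injective (Int.castRingHom ℚ) := Int.cast_injective
  have h1 := resultant_ne_zero _ _ (PerfectField.separable_iff_squarefree.2 hsq)
  rw [derivative_map, natDegree_map_eq_of_injective hinj, natDegree_map_eq_of_injective hinj,
    resultant_map_map] at h1
  exact fun h => h1 (by rw [h, map_zero])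

/-- The resultant is a combination of `f` and its derivative, so that `f` is separable modulo a
prime not dividing it. -/
theorem squarefree_map_of_not_dvd {f : ℤ[X]} {r : ℕ} (hr : r.Prime) (h1 : 1 ≤ f.natDegree)
    (h : ¬ (r : ℤ) ∣ f.resultant (derivative f)) :
    Squarefree (f.map (Int.castRingHom (ZMod r))) := by
  have : Fact r.Prime := ⟨hr⟩
  obtain ⟨p, q, -, -, hpq⟩ := exists_mul_add_mul_eq_C_resultant f (derivative f) le_rfl le_rfl
    (Or.inl (by omega))
  have hne : ((f.resultant (derivative f) : ℤ) : ZMod r) ≠ 0 := by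
    rwa [Ne, ZMod.intCast_zmod_eq_zero_iff_dvd]
  refine Separable.squarefree ?_
  have h2 := congrArg (Polynomial.map (Int.castRingHom (ZMod r))) hpq
  rw [Polynomial.map_add, Polynomial.map_mul, Polynomial.map_mul, map_C, ← derivative_map,
    eq_intCast] at h2
  set c : ZMod r := ((f.resultant (derivative f) : ℤ) : ZMod r)
  refine ⟨C c⁻¹ * p.map (Int.castRingHom (ZMod r)), C c⁻¹ * q.map (Int.castRingHom (ZMod r)), ?_⟩
  calc _ = C c⁻¹ * (f.map (Int.castRingHom (ZMod r)) * p.map (Int.castRingHom (ZMod r)) +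
        derivative (f.map (Int.castRingHom (ZMod r))) * q.map (Int.castRingHom (ZMod r))) := by ring
    _ = 1 := by rw [h2, ← C_mul, inv_mul_cancel₀ hne, C_1]

/-- All but `O(log ‖f‖)` primes are good. -/
theorem exists_bad_primes (D : ℕ) (hD1 : 1 ≤ D) : ∃ c : ℝ, 0 < c ∧ ∀ (f : ℤ[X]) (H : ℕ),
    1 ≤ f.natDegree → f.natDegree ≤ D → 1 ≤ H → (∀ i, (f.coeff i).natAbs ≤ H) →
    Squarefree (f.map (Int.castRingHom ℚ)) → ∃ T : Finset ℕ, (∀ p ∈ T, p.Prime) ∧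
      (T.card : ℝ) ≤ c * Real.log (2 * H) ∧ ∀ r, r.Prime → r ∉ T →
        ¬ (r : ℤ) ∣ f.leadingCoeff ∧ Squarefree (f.map (Int.castRingHom (ZMod r))) := by
  set c₁ : ℝ := Real.log ((2 * D).factorial * (D : ℝ) ^ (2 * D)) with hc₁
  have hD1R : (1 : ℝ) ≤ D := by exact_mod_cast hD1
  have hfac : (1 : ℝ) ≤ (2 * D).factorial := by exact_mod_cast Nat.factorial_pos _
  have hc₁0 : 0 ≤ c₁ := Real.log_nonneg (one_le_mul_of_one_le_of_one_le hfac (one_le_pow₀ hD1R))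
  have hl2 : 0 < Real.log 2 := Real.log_pos (by norm_num)
  refine ⟨(2 * D + 1 + c₁ / Real.log 2) / Real.log 2, by positivity,
    fun f H h1 hD hH hf hsq => ?_⟩
  -- the primes to avoid divide `n`, which is bounded by a power of `H`
  set n : ℕ := (f.leadingCoeff * f.resultant (derivative f)).natAbs with hn
  have hlc : f.leadingCoeff ≠ 0 := by
    rw [Ne, leadingCoeff_eq_zero]
    rintro rfl
    simp at h1
  have hn0 : n ≠ 0 := by
    rw [hn, Int.natAbs_ne_zero]
    exact mul_ne_zero hlc (resultant_derivative_ne_zero hsq)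
  refine ⟨n.primeFactors, fun p hp => Nat.prime_of_mem_primeFactors hp, ?_, fun r hr hrT => ?_⟩
  · have hb : 2 ^ n.primeFactors.card ≤ H * ((2 * D).factorial * (D * H) ^ (2 * D)) := by
      refine (Nat.two_pow_card_primeFactors_le hn0).trans ?_
      rw [hn, Int.natAbs_mul]
      exact Nat.mul_le_mul (hf _) (abs_resultant_derivative_le hD hD1 hH hf)
    have hbR : (2 : ℝ) ^ n.primeFactors.card ≤
        H ^ (2 * D + 1) * ((2 * D).factorial * (D : ℝ) ^ (2 * D)) := by
      have : (2 : ℝ) ^ n.primeFactors.card ≤ H * ((2 * D).factorial * (D * H) ^ (2 * D)) := by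
        exact_mod_cast hb
      refine this.trans (le_of_eq ?_)
      rw [mul_pow]; ring
    have hHR : (1 : ℝ) ≤ H := by exact_mod_cast hH
    have hlog := Real.log_le_log (by positivity) hbR
    rw [Real.log_pow, Real.log_mul (by positivity) (by positivity), Real.log_pow, ← hc₁] at hlog
    have hL : Real.log (2 * H) = Real.log 2 + Real.log H :=
      Real.log_mul (by norm_num) (by positivity)
    have hLH : 0 ≤ Real.log H := Real.log_nonneg hHR
    push_cast at hlog
    rw [hL, div_mul_eq_mul_div, le_div_iff₀ hl2]
    have h3 : c₁ ≤ c₁ / Real.log 2 * (Real.log 2 + Real.log H) := by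
      rw [mul_add, div_mul_cancel₀ _ hl2.ne']
      have : 0 ≤ c₁ / Real.log 2 * Real.log H := by positivity
      linarith
    nlinarith
  · have hd : ¬ (r : ℤ) ∣ f.leadingCoeff * f.resultant (derivative f) := by
      intro h
      refine hrT (Nat.mem_primeFactors.2 ⟨hr, ?_, hn0⟩)
      exact Int.natCast_dvd.1 h
    exact ⟨fun h => hd (h.mul_right _), squarefree_map_of_not_dvd hr h1 fun h => hd (h.mul_left _)⟩

end BadPrimes

/-! ### Descent for forms divisible by `Y` -/

section Descent

open Polynomial

theorem exists_formEval_eq {R : Type*} [CommRing R] {f : R[X]} {D : ℕ} (hD : 1 ≤ D)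
    (h0 : f.coeff D = 0) (x y : R) :
    ∃ w, formEval f D x y = y * (f.coeff (D - 1) * x ^ (D - 1) + y * w) := by
  obtain ⟨d, rfl⟩ : ∃ d, D = d + 1 := ⟨D - 1, by omega⟩
  have hdvd : y * y ∣ ∑ i ∈ Finset.range d, f.coeff i * x ^ i * y ^ (d + 1 - i) := by
    refine Finset.dvd_sum fun i hi => Dvd.dvd.mul_left ?_ _
    rw [← sq]
    exact pow_dvd_pow _ (by have := Finset.mem_range.1 hi; omega)
  obtain ⟨w, hw⟩ := hdvd
  refine ⟨w, ?_⟩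
  rw [formEval, Finset.sum_range_succ, Finset.sum_range_succ, hw, h0, Nat.add_sub_cancel,
    Nat.add_sub_cancel_left]
  ring

/-- If `Y` divides the form once, then at a prime dividing `y` the value of the form can be a
square only if a power of the prime can be removed from the variables. -/
theorem dvd_or_sq_dvd_of_isSquare {f : ℤ[X]} {D r : ℕ} (hr : r.Prime) (hD : 1 ≤ D)
    (h0 : f.coeff D = 0) (hc : ¬ (r : ℤ) ∣ f.coeff (D - 1)) {a b x y : ℤ} (ha : ¬ (r : ℤ) ∣ a)
    (hb : ¬ (r : ℤ) ∣ b) (hy : (r : ℤ) ∣ y) (hsq : IsSquare (formEval f D (a * x) (b * y))) :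
    (r : ℤ) ∣ x ∨ (r : ℤ) ^ 2 ∣ y := by
  have hp : Prime (r : ℤ) := Nat.prime_iff_prime_int.1 hr
  by_contra hcon
  push Not at hcon
  obtain ⟨w, hw⟩ := exists_formEval_eq hD h0 (a * x) (b * y)
  obtain ⟨k, hk⟩ := hsq
  rw [hk] at hw
  have hrk : (r : ℤ) ∣ k := by
    have : (r : ℤ) ∣ k * k := by rw [hw]; exact ((hy.mul_left b).mul_right _)
    exact (hp.dvd_mul.1 this).elim id id
  have hE : ¬ (r : ℤ) ∣ f.coeff (D - 1) * (a * x) ^ (D - 1) + b * y * w := by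
    intro h
    have h1 := (dvd_add_left ((hy.mul_left b).mul_right w)).1 h
    rcases hp.dvd_mul.1 h1 with h2 | h2
    · exact hc h2
    · exact (hp.dvd_mul.1 (hp.dvd_of_dvd_pow h2)).elim ha hcon.1
  have hcop : IsCoprime ((r : ℤ) ^ 2) (b * (f.coeff (D - 1) * (a * x) ^ (D - 1) + b * y * w)) := by
    refine IsCoprime.pow_left ((Prime.coprime_iff_not_dvd hp).2 fun h => ?_)
    exact (hp.dvd_mul.1 h).elim hb hE
  refine hcon.2 (hcop.dvd_of_dvd_mul_right ?_)
  rw [sq]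
  refine (mul_dvd_mul hrk hrk).trans (dvd_of_eq ?_)
  rw [hw]; ring

/-- Division of the coordinates by common factors. -/
theorem exists_card_eq_of_dvd {A : Finset (ℤ × ℤ)} {m n : ℤ}
    (hA : ∀ z ∈ A, m ∣ z.1 ∧ n ∣ z.2) :
    ∃ A' : Finset (ℤ × ℤ), A'.card = A.card ∧ ∀ z ∈ A', (m * z.1, n * z.2) ∈ A := by
  classical
  have h1 : ∀ z ∈ A, (m * (z.1 / m), n * (z.2 / n)) = z := fun z hz =>
    Prod.ext (Int.mul_ediv_cancel' (hA z hz).1) (Int.mul_ediv_cancel' (hA z hz).2)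
  refine ⟨A.image fun z => (z.1 / m, z.2 / n), Finset.card_image_of_injOn ?_, fun z hz => ?_⟩
  · intro z hz z' hz' h
    rw [← h1 z hz, ← h1 z' hz']
    have h2 := congrArg Prod.fst h
    have h3 := congrArg Prod.snd h
    simp only at h2 h3
    rw [h2, h3]
  · obtain ⟨z', hz', rfl⟩ := Finset.mem_image.1 hz
    simp only
    rw [h1 z' hz']
    exact hz'

/-- The bound for the forms divisible by `Y`. The points on rows that degenerate at a prime `r` lie,
after division of the variables by powers of `r`, in a box of area smaller by the factor `r ^ 2`,
and belong to a form for which `r` is the only new prime to avoid. The sum over `r` of the bounds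
for the smaller boxes converges, and is small if the primes in `s` are avoided. The induction is on
`n`, with `V < 2 ^ n`. -/
theorem exists_card_le_of_coeff_eq_zero (D : ℕ) (hodd : Odd D) (hD3 : 3 ≤ D) :
    ∃ (B : ℝ) (s : Finset ℕ), 0 < B ∧ ∀ (n : ℕ) (S : Finset ℕ) (f : ℤ[X]) (a b : ℤ)
      (A : Finset (ℤ × ℤ)) (U V : ℝ), f.natDegree = D - 1 → (∀ p ∈ S, 2 ≤ p) →
      (∀ r ∈ s, r.Prime → r ∈ S) →
      (∀ r, r.Prime → r ∉ S → IsGoodPrime D f r ∧ ¬ (r : ℤ) ∣ a ∧ ¬ (r : ℤ) ∣ b) →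
      0 < V → V ≤ U → V < 2 ^ n → (∀ z ∈ A, |(z.1 : ℝ)| ≤ U) → (∀ z ∈ A, |(z.2 : ℝ)| ≤ V) →
      (∀ z ∈ A, formEval f D (a * z.1) (b * z.2) ≠ 0 ∧
        IsSquare (formEval f D (a * z.1) (b * z.2))) →
      (A.card : ℝ) ≤ B * (S.card + 1) ^ 2 * (U * V) ^ (2 / 3 : ℝ) := by
  classical
  obtain ⟨B, hB, hmain⟩ := exists_card_le_of_isSquare D hodd
  have hs : Summable fun r : ℕ => (r : ℝ) ^ (-(4 / 3) : ℝ) :=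
    Real.summable_nat_rpow.2 (by norm_num)
  -- the tail is small enough to absorb the factor `2 * 2 * 2 ^ 2`,
  -- as `(|S| + 2) ^ 2 ≤ (2 (|S| + 1)) ^ 2`
  obtain ⟨s, hs⟩ := summable_iff_vanishing_norm.1 hs (1 / 16) (by norm_num)
  refine ⟨2 * B, s, by positivity, fun n => ?_⟩
  induction n with
  | zero =>
    intro S f a b A U V hdeg hS hsS hgood hV hUV hVn hAU hAV hsq
    have hA : A = ∅ := by
      refine Finset.eq_empty_of_forall_notMem fun z hz => (hsq z hz).1 ?_
      have h1 := (hAV z hz).trans_lt hVn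
      rw [pow_zero] at h1
      have h2 : |z.2| < 1 := by exact_mod_cast h1
      have h3 := Int.abs_lt_one_iff.1 h2
      rw [h3, mul_zero, formEval_zero_right, coeff_eq_zero_of_natDegree_lt (by omega), zero_mul]
    rw [hA, Finset.card_empty, Nat.cast_zero]
    have : 0 < U := hV.trans_le hUV
    positivity
  | succ n ih =>
    intro S f a b A U V hdeg hS hsS hgood hV hUV hVn hAU hAV hsq
    have hU : 0 < U := hV.trans_le hUV
    have hD0 : f.coeff D = 0 := coeff_eq_zero_of_natDegree_lt (by omega)
    have hy0 : ∀ z ∈ A, z.2 ≠ 0 := by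
      intro z hz h
      refine (hsq z hz).1 ?_
      rw [h, mul_zero, formEval_zero_right, hD0, zero_mul]
    by_cases hV1 : V < 1
    · have hA : A = ∅ := by
        refine Finset.eq_empty_of_forall_notMem fun z hz => hy0 z hz ?_
        have h1 := (hAV z hz).trans_lt hV1
        have h2 : |z.2| < 1 := by exact_mod_cast h1
        exact Int.abs_lt_one_iff.1 h2
      rw [hA, Finset.card_empty, Nat.cast_zero]
      positivity
    push Not at hV1
    set W : ℝ := (S.card : ℝ) + 1 with hW
    have hW1 : 1 ≤ W := by rw [hW]; linarith [(Nat.cast_nonneg S.card : (0 : ℝ) ≤ S.card)]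
    set Q : Finset ℕ := (Finset.range (⌊V⌋₊ + 1)).filter fun r => r.Prime ∧ r ∉ S with hQ
    set A₀ : Finset (ℤ × ℤ) := A.filter fun z => ∀ r : ℕ, r.Prime → r ∉ S → ¬ (r : ℤ) ∣ z.2 with hA₀
    set A₁ : ℕ → Finset (ℤ × ℤ) := fun r => A.filter fun z => (r : ℤ) ∣ z.1 ∧ (r : ℤ) ∣ z.2 with hA₁
    set A₂ : ℕ → Finset (ℤ × ℤ) := fun r => A.filter fun z => (1 : ℤ) ∣ z.1 ∧ (r : ℤ) ^ 2 ∣ z.2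
      with hA₂
    have hcover : A ⊆ A₀ ∪ Q.biUnion fun r => A₁ r ∪ A₂ r := by
      intro z hz
      rw [Finset.mem_union]
      by_cases h : ∀ r : ℕ, r.Prime → r ∉ S → ¬ (r : ℤ) ∣ z.2
      · exact Or.inl (Finset.mem_filter.2 ⟨hz, h⟩)
      · push Not at h
        obtain ⟨r, hr, hrS, hrz⟩ := h
        obtain ⟨hg, ha, hb⟩ := hgood r hr hrS
        refine Or.inr (Finset.mem_biUnion.2 ⟨r, Finset.mem_filter.2 ⟨?_, hr, hrS⟩, ?_⟩)
        · rw [Finset.mem_range, Nat.lt_succ_iff]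
          refine Nat.le_floor ?_
          have h1 := Int.le_of_dvd (abs_pos.2 (hy0 z hz)) ((dvd_abs _ _).2 hrz)
          have h2 : (r : ℝ) ≤ |(z.2 : ℝ)| := by exact_mod_cast h1
          exact h2.trans (hAV z hz)
        · have hc := hg.not_dvd
          rw [leadingCoeff, hdeg] at hc
          rw [Finset.mem_union]
          rcases dvd_or_sq_dvd_of_isSquare hr (by omega) hD0 hc ha hb hrz (hsq z hz).2 with h | h
          · exact Or.inl (Finset.mem_filter.2 ⟨hz, h, hrz⟩)
          · exact Or.inr (Finset.mem_filter.2 ⟨hz, one_dvd _, h⟩)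
    have h₀ : (A₀.card : ℝ) ≤ B * W ^ 2 * (U * V) ^ (2 / 3 : ℝ) := by
      refine hmain S f a b A₀ U V (by omega) (by omega) hS hgood hV1 hUV
        (fun z hz => hAU z (Finset.mem_filter.1 hz).1)
            (fun z hz => hAV z (Finset.mem_filter.1 hz).1)
        (fun z hz => (hsq z (Finset.mem_filter.1 hz).1).2)
        (fun z hz r hr hrS h => absurd h ((Finset.mem_filter.1 hz).2 r hr hrS))
    -- the induction hypothesis for the form with variables multiplied by `m` and `m'`
    have hstep : ∀ r ∈ Q, ∀ (A' : Finset (ℤ × ℤ)) (m m' : ℕ), A' ⊆ A → 0 < m → m ≤ m' → 2 ≤ m' →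
        (∀ q : ℕ, q.Prime → q ≠ r → ¬ (q : ℤ) ∣ m ∧ ¬ (q : ℤ) ∣ m') →
        (m : ℝ) * m' = (r : ℝ) ^ 2 → (∀ z ∈ A', (m : ℤ) ∣ z.1 ∧ (m' : ℤ) ∣ z.2) →
        (A'.card : ℝ) ≤ 2 * B * (2 * W) ^ 2 * ((U * V) ^ (2 / 3 : ℝ) * (r : ℝ) ^ (-(4 / 3) : ℝ)) :=
            by
      intro r hr A' m m' hA' hm hmm hm' hq hmr hdvd
      obtain ⟨-, hrp, hrS⟩ := Finset.mem_filter.1 hr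
      have hr0 : (0 : ℝ) < r := by exact_mod_cast hrp.pos
      have hm0 : (0 : ℝ) < m := by exact_mod_cast hm
      have hm2 : (2 : ℝ) ≤ m' := by exact_mod_cast hm'
      have hmmR : (m : ℝ) ≤ m' := by exact_mod_cast hmm
      obtain ⟨A'', hcard, hA''⟩ := exists_card_eq_of_dvd (A := A') (m := m) (n := m') hdvd
      have h := ih (insert r S) f (a * m) (b * m') A'' (U / m) (V / m') hdeg ?_ ?_ ?_
        (by positivity) ?_ ?_ ?_ ?_ ?_
      · rw [← hcard]
        refine h.trans ?_
        have e1 : U / m * (V / m') = U * V * ((r : ℝ) ^ 2)⁻¹ := by rw [← hmr]; field_simp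
        have e2 : (U * V * ((r : ℝ) ^ 2)⁻¹) ^ (2 / 3 : ℝ) =
            (U * V) ^ (2 / 3 : ℝ) * (r : ℝ) ^ (-(4 / 3) : ℝ) := by
          rw [Real.mul_rpow (by positivity) (by positivity)]
          congr 1
          rw [← Real.rpow_natCast, ← Real.rpow_neg hr0.le, ← Real.rpow_mul hr0.le]
          norm_num
        rw [e1, e2, Finset.card_insert_of_notMem hrS]
        push_cast
        gcongr
        linarith
      · intro p hp
        rcases Finset.mem_insert.1 hp with rfl | hp
        · exact hrp.two_le
        · exact hS p hp
      · exact fun q hq hqp => Finset.mem_insert_of_mem (hsS q hq hqp)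
      · intro q hqp hqS
        rw [Finset.mem_insert, not_or] at hqS
        obtain ⟨g1, g2, g3⟩ := hgood q hqp hqS.2
        have hpz : Prime (q : ℤ) := Nat.prime_iff_prime_int.1 hqp
        refine ⟨g1, fun h => ?_, fun h => ?_⟩
        · exact (hpz.dvd_mul.1 h).elim g2 (hq q hqp hqS.1).1
        · exact (hpz.dvd_mul.1 h).elim g3 (hq q hqp hqS.1).2
      · exact div_le_div₀ hU.le hUV hm0 hmmR
      · rw [div_lt_iff₀ (by linarith)]
        calc V < 2 ^ (n + 1) := hVn
          _ = 2 ^ n * 2 := pow_succ _ _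
          _ ≤ 2 ^ n * m' := by gcongr
      · intro z hz
        have h1 := hAU _ (hA' (hA'' z hz))
        push_cast at h1
        rw [abs_mul, abs_of_pos hm0] at h1
        rw [le_div_iff₀ hm0]
        linarith
      · intro z hz
        have h1 := hAV _ (hA' (hA'' z hz))
        push_cast at h1
        rw [abs_mul, abs_of_pos (show (0 : ℝ) < m' by linarith)] at h1
        rw [le_div_iff₀ (by linarith)]
        linarith
      · intro z hz
        have h1 := hsq _ (hA' (hA'' z hz))
        rwa [mul_assoc, mul_assoc]
    have hQp : ∀ r ∈ Q, r.Prime := fun r hr => (Finset.mem_filter.1 hr).2.1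
    have hprime : ∀ r ∈ Q, ∀ q : ℕ, q.Prime → q ≠ r → ¬ (q : ℤ) ∣ (r : ℤ) := by
      intro r hr q hq hne h
      exact hne ((Nat.prime_dvd_prime_iff_eq hq (hQp r hr)).1 (by exact_mod_cast h))
    have h₁ : ∀ r ∈ Q, ((A₁ r).card : ℝ) ≤
        2 * B * (2 * W) ^ 2 * ((U * V) ^ (2 / 3 : ℝ) * (r : ℝ) ^ (-(4 / 3) : ℝ)) := by
      intro r hr
      refine hstep r hr (A₁ r) r r (Finset.filter_subset _ _) (hQp r hr).pos le_rfl
        (hQp r hr).two_le (fun q hq hne => ⟨hprime r hr q hq hne, hprime r hr q hq hne⟩)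
        (by ring) fun z hz => (Finset.mem_filter.1 hz).2
    have h₂ : ∀ r ∈ Q, ((A₂ r).card : ℝ) ≤
        2 * B * (2 * W) ^ 2 * ((U * V) ^ (2 / 3 : ℝ) * (r : ℝ) ^ (-(4 / 3) : ℝ)) := by
      intro r hr
      have hr2 : 2 ≤ r ^ 2 := (hQp r hr).two_le.trans (Nat.le_self_pow (by norm_num) r)
      refine hstep r hr (A₂ r) 1 (r ^ 2) (Finset.filter_subset _ _) one_pos (by omega) hr2
        (fun q hq hne => ⟨fun h => hq.one_lt.ne' ?_, fun h => hprime r hr q hq hne ?_⟩)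
        (by push_cast; ring) fun z hz => ?_
      · exact Nat.dvd_one.1 (by exact_mod_cast h)
      · push_cast at h
        exact (Nat.prime_iff_prime_int.1 hq).dvd_of_dvd_pow h
      · have := (Finset.mem_filter.1 hz).2
        push_cast
        exact this
    have hQsum : ∑ r ∈ Q, (r : ℝ) ^ (-(4 / 3) : ℝ) ≤ 1 / 16 := by
      refine (le_abs_self _).trans (hs Q ?_).le
      rw [Finset.disjoint_left]
      intro r hr hrs
      exact (Finset.mem_filter.1 hr).2.2 (hsS r hrs (hQp r hr))
    have hcard : (A.card : ℝ) ≤ A₀.card + ∑ r ∈ Q, ((A₁ r).card + (A₂ r).card : ℝ) := by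
      have h1 := (Finset.card_le_card hcover).trans (Finset.card_union_le _ _)
      have h2 := Finset.card_biUnion_le (s := Q) (t := fun r => A₁ r ∪ A₂ r)
      have h3 := Finset.sum_le_sum fun r (_ : r ∈ Q) => Finset.card_union_le (A₁ r) (A₂ r)
      exact_mod_cast h1.trans (Nat.add_le_add_left (h2.trans h3) _)
    set X : ℝ := (U * V) ^ (2 / 3 : ℝ) with hX
    have hX0 : 0 ≤ X := by positivity
    calc (A.card : ℝ) ≤ _ := hcard
      _ ≤ B * W ^ 2 * X + ∑ r ∈ Q, 2 * (2 * B * (2 * W) ^ 2 * (X * (r : ℝ) ^ (-(4 / 3) : ℝ))) := by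
          refine add_le_add h₀ (Finset.sum_le_sum fun r hr => ?_)
          linarith [h₁ r hr, h₂ r hr]
      _ = B * W ^ 2 * X + 16 * B * W ^ 2 * X * ∑ r ∈ Q, (r : ℝ) ^ (-(4 / 3) : ℝ) := by
          rw [Finset.mul_sum]
          congr 1
          exact Finset.sum_congr rfl fun r _ => by ring
      _ ≤ B * W ^ 2 * X + 16 * B * W ^ 2 * X * (1 / 16) := by gcongr
      _ = _ := by ring

/-- The bound for the form of degree `D` attached to `f`. -/
theorem exists_card_le_log_sq (D : ℕ) (hodd : Odd D) (hD3 : 3 ≤ D) : ∃ B : ℝ, 0 < B ∧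
    ∀ (f : ℤ[X]) (H : ℕ) (A : Finset (ℤ × ℤ)) (U V : ℝ), D - 1 ≤ f.natDegree → f.natDegree ≤ D →
      1 ≤ H → (∀ i, (f.coeff i).natAbs ≤ H) → Squarefree (f.map (Int.castRingHom ℚ)) →
      1 ≤ V → V ≤ U → (∀ z ∈ A, |(z.1 : ℝ)| ≤ U) → (∀ z ∈ A, |(z.2 : ℝ)| ≤ V) →
      (∀ z ∈ A, formEval f D z.1 z.2 ≠ 0 ∧ IsSquare (formEval f D z.1 z.2)) →
      (A.card : ℝ) ≤ B * ((U * V) ^ (2 / 3 : ℝ) * Real.log (2 * H) ^ 2) := by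
  classical
  obtain ⟨B₁, hB₁, h₁⟩ := exists_card_le_of_isSquare D hodd
  obtain ⟨B₂, s, hB₂, h₂⟩ := exists_card_le_of_coeff_eq_zero D hodd hD3
  obtain ⟨c, hc, hbad⟩ := exists_bad_primes D (by omega)
  obtain ⟨r₀, hr₀⟩ := exists_nat_ge ((80 * ((D : ℝ) + 2) ^ 2) ^ 4)
  have hl2 : 0 < Real.log 2 := Real.log_pos (by norm_num)
  set c' : ℝ := c + (r₀ + s.card + 1) / Real.log 2 with hc'
  have hc'0 : 0 < c' := by positivity
  refine ⟨(B₁ + B₂) * c' ^ 2, by positivity,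
    fun f H A U V hdeg1 hdeg2 hH hf hsq hV hUV hAU hAV hA => ?_⟩
  obtain ⟨T, hT, hTcard, hTgood⟩ := hbad f H (by omega) hdeg2 hH hf hsq
  set S : Finset ℕ := (T ∪ (Finset.range r₀ ∪ s)).filter fun p => p.Prime with hS
  have hS2 : ∀ p ∈ S, 2 ≤ p := fun p hp => (Finset.mem_filter.1 hp).2.two_le
  have hHR : (1 : ℝ) ≤ H := by exact_mod_cast hH
  have hL : Real.log 2 ≤ Real.log (2 * H) := Real.log_le_log (by norm_num) (by linarith)
  set L := Real.log (2 * H) with hLdef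
  have hScard : (S.card : ℝ) + 1 ≤ c' * L := by
    have h3 : S.card ≤ T.card + (r₀ + s.card) := by
      refine (Finset.card_filter_le _ _).trans ((Finset.card_union_le _ _).trans ?_)
      refine Nat.add_le_add_left ((Finset.card_union_le _ _).trans ?_) _
      rw [Finset.card_range]
    have h4 : (S.card : ℝ) ≤ T.card + (r₀ + s.card) := by exact_mod_cast h3
    have h5 : (r₀ + s.card + 1 : ℝ) ≤ (r₀ + s.card + 1) / Real.log 2 * L := by
      rw [div_mul_eq_mul_div, le_div_iff₀ hl2]
      gcongr
    rw [hc', add_mul]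
    linarith
  have hgood : ∀ r, r.Prime → r ∉ S → IsGoodPrime D f r := by
    intro r hr hrS
    have hrS' : r ∉ T ∪ (Finset.range r₀ ∪ s) := fun h => hrS (Finset.mem_filter.2 ⟨h, hr⟩)
    rw [Finset.mem_union, Finset.mem_union, not_or, not_or, Finset.mem_range, not_lt] at hrS'
    obtain ⟨g1, g2⟩ := hTgood r hr hrS'.1
    refine ⟨g1, g2, ?_⟩
    have h3 : (80 * ((D : ℝ) + 2) ^ 2) ^ 4 ≤ r := hr₀.trans (by exact_mod_cast hrS'.2.1)
    calc 80 * ((D : ℝ) + 2) ^ 2 = ((80 * ((D : ℝ) + 2) ^ 2) ^ 4) ^ (1 / 4 : ℝ) := by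
          rw [← Real.rpow_natCast (80 * ((D : ℝ) + 2) ^ 2) 4, ← Real.rpow_mul (by positivity)]
          norm_num
      _ ≤ (r : ℝ) ^ (1 / 4 : ℝ) := Real.rpow_le_rpow (by positivity) h3 (by norm_num)
  have hgood' : ∀ r, r.Prime → r ∉ S → IsGoodPrime D f r ∧ ¬ (r : ℤ) ∣ 1 ∧ ¬ (r : ℤ) ∣ 1 := by
    intro r hr hrS
    have : ¬ (r : ℤ) ∣ 1 := fun h => hr.one_lt.ne' (Nat.dvd_one.1 (by exact_mod_cast h))
    exact ⟨hgood r hr hrS, this, this⟩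
  have hU : 1 ≤ U := hV.trans hUV
  have hX0 : 0 ≤ (U * V) ^ (2 / 3 : ℝ) := by positivity
  have hfin : ∀ B : ℝ, 0 < B → B ≤ B₁ + B₂ →
      (A.card : ℝ) ≤ B * (S.card + 1) ^ 2 * (U * V) ^ (2 / 3 : ℝ) →
      (A.card : ℝ) ≤ (B₁ + B₂) * c' ^ 2 * ((U * V) ^ (2 / 3 : ℝ) * L ^ 2) := by
    intro B hB0 hB h
    calc (A.card : ℝ) ≤ _ := h
      _ ≤ (B₁ + B₂) * (c' * L) ^ 2 * (U * V) ^ (2 / 3 : ℝ) := by gcongr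
      _ = _ := by ring
  -- no row degenerates unless `Y` divides the form
  by_cases hdeg : f.natDegree = D
  · refine hfin B₁ hB₁ (by linarith) (h₁ S f 1 1 A U V (by omega) hdeg2 hS2 hgood' hV hUV hAU hAV
      (fun z hz => ?_) fun z hz r hr hrS _ h => ?_)
    · rw [one_mul, one_mul]
      exact (hA z hz).2
    · refine (hgood r hr hrS).not_dvd ?_
      rwa [leadingCoeff, hdeg]
  · obtain ⟨n, hn⟩ := pow_unbounded_of_one_lt V (show (1 : ℝ) < 2 by norm_num)
    refine hfin B₂ hB₂ (by linarith) (h₂ n S f 1 1 A U V (by omega) hS2 (fun r hr hrp => ?_) hgood'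
      (by linarith) hUV hn hAU hAV fun z hz => ?_)
    · refine Finset.mem_filter.2 ⟨?_, hrp⟩
      rw [Finset.mem_union, Finset.mem_union]
      exact Or.inr (Or.inr hr)
    · rw [one_mul, one_mul]
      exact hA z hz

end Descent

/-! ### From binary forms to polynomials in one variable -/

section BinaryForms

open Polynomial

/-- The dehomogenization `F(X, 1)` of a binary form. -/
noncomputable def dehomogenize {R : Type*} [CommRing R] (F : MvPolynomial (Fin 2) R) : R[X] :=
  MvPolynomial.aeval ![X, 1] F

variable {D : ℕ} {F : MvPolynomial (Fin 2) ℤ}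

theorem natDegree_dehomogenize_le (hF : F.IsHomogeneous D) : (dehomogenize F).natDegree ≤ D := by
  rw [dehomogenize, MvPolynomial.aeval_def, MvPolynomial.eval₂_eq']
  refine natDegree_sum_le_of_forall_le _ _ fun d hd => ?_
  have h1 := hF (MvPolynomial.mem_support_iff.1 hd)
  rw [Fin.prod_univ_two]
  simp only [Matrix.cons_val_zero, Matrix.cons_val_one, one_pow, mul_one]
  refine (natDegree_C_mul_X_pow_le _ _).trans ?_
  rw [← h1, Finsupp.weight_apply, Finsupp.sum_fintype _ _ (by simp), Fin.sum_univ_two]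
  simp

theorem homogenize_dehomogenize (hF : F.IsHomogeneous D) : (dehomogenize F).homogenize D = F :=
  homogenize_eq_of_isHomogeneous hF rfl

theorem formEval_dehomogenize (hF : F.IsHomogeneous D) (x y : ℤ) :
    formEval (dehomogenize F) D x y = MvPolynomial.eval ![x, y] F := by
  nth_rw 2 [← homogenize_dehomogenize hF]
  rw [homogenize, MvPolynomial.eval_sum, formEval,
    Finset.Nat.sum_antidiagonal_eq_sum_range_succ_mk]
  refine Finset.sum_congr rfl fun i _ => ?_
  rw [MvPolynomial.eval_monomial, Finsupp.prod_fintype _ _ (by simp), Fin.prod_univ_two]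
  simp [mul_assoc]

theorem natAbs_coeff_dehomogenize_le (hF : F.IsHomogeneous D) (i : ℕ) :
    ((dehomogenize F).coeff i).natAbs ≤ maxCoeff F := by
  by_cases hi : i ≤ D
  · have h1 := coeff_homogenize (dehomogenize F) D (fun₀ | 0 => i | 1 => D - i)
    rw [homogenize_dehomogenize hF] at h1
    simp only [Finsupp.update_apply, Finsupp.single_apply] at h1
    simp [hi] at h1
    rw [← h1]
    by_cases h0 : F.coeff (fun₀ | 0 => i | 1 => D - i) = 0
    · rw [h0]; simp
    · exact Finset.le_sup (f := fun m => (F.coeff m).natAbs) (MvPolynomial.mem_support_iff.2 h0)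
  · rw [coeff_eq_zero_of_natDegree_lt (lt_of_le_of_lt (natDegree_dehomogenize_le hF) (by omega))]
    simp

theorem one_le_maxCoeff (hF : F ≠ 0) : 1 ≤ maxCoeff F := by
  obtain ⟨m, hm⟩ := MvPolynomial.support_nonempty.2 hF
  have h1 : (F.coeff m).natAbs ≤ maxCoeff F :=
    Finset.le_sup (f := fun m => (F.coeff m).natAbs) hm
  have h2 := Int.natAbs_pos.2 (MvPolynomial.mem_support_iff.1 hm)
  omega

/-- A square factor of the dehomogenization homogenizes to one of the form. -/
theorem squarefree_dehomogenize (hF : F.IsHomogeneous D) (hsq : HasNoRepeatedFactor F) :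
    Squarefree ((dehomogenize F).map (Int.castRingHom ℚ)) := by
  have hFQ : ((dehomogenize F).map (Int.castRingHom ℚ)).homogenize D =
      MvPolynomial.map (Int.castRingHom ℚ) F := by
    rw [homogenize_map, homogenize_dehomogenize hF]
  have hdeg : ((dehomogenize F).map (Int.castRingHom ℚ)).natDegree ≤ D :=
    (natDegree_map_le).trans (natDegree_dehomogenize_le hF)
  rintro g ⟨h, hh⟩
  have hne : (dehomogenize F).map (Int.castRingHom ℚ) ≠ 0 := by
    intro h0
    rw [h0, homogenize_zero] at hFQ
    rw [HasNoRepeatedFactor, ← hFQ] at hsq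
    exact not_squarefree_zero hsq
  have hg : g ≠ 0 := by rintro rfl; simp at hh; exact hne (by rw [hh])
  have hh0 : h ≠ 0 := by rintro rfl; simp at hh; exact hne (by rw [hh])
  rw [hh] at hdeg hFQ
  rw [natDegree_mul (mul_ne_zero hg hg) hh0, natDegree_mul hg hg] at hdeg
  have hD : D = g.natDegree + g.natDegree + (D - (g.natDegree + g.natDegree)) := by omega
  rw [hD, homogenize_mul _ _ (natDegree_mul_le) (by omega),
    homogenize_mul _ _ le_rfl le_rfl] at hFQ
  have h1 := hsq _ (Dvd.intro _ hFQ)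
  have h2 := h1.map (MvPolynomial.aeval (R := ℚ) ![X, (1 : ℚ[X])])
  rwa [aeval_homogenize_X_one _ le_rfl] at h2

/-- Otherwise `Y ^ 2` divides the form. -/
theorem le_natDegree_dehomogenize (hD : 2 ≤ D) (hF : F.IsHomogeneous D)
    (hsq : HasNoRepeatedFactor F) : D - 1 ≤ (dehomogenize F).natDegree := by
  by_contra hlt
  push Not at hlt
  have h1 : F = (dehomogenize F).homogenize (D - 2) * MvPolynomial.X 1 ^ 2 := by
    have h2 := homogenize_mul (dehomogenize F) 1 (m := D - 2) (n := 2) (by omega) (by simp)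
    rwa [mul_one, Nat.sub_add_cancel hD, homogenize_dehomogenize hF, homogenize_one] at h2
  rw [HasNoRepeatedFactor, h1, map_mul, map_pow, MvPolynomial.map_X] at hsq
  have h2 := hsq (MvPolynomial.X 1) (Dvd.intro_left _ (by rw [sq]))
  have h3 := h2.map (MvPolynomial.eval (0 : Fin 2 → ℚ))
  simp at h3

theorem nonzeroSquareCount_eq (F : MvPolynomial (Fin 2) ℤ) (U V : ℝ) :
    nonzeroSquareCount F U V = (nonzeroSquarePoints_finite F U V).toFinset.card :=
  Set.ncard_eq_toFinset_card _ _

/-- The automorphism which exchanges the two variables. -/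
noncomputable def swapVars {R : Type*} [CommRing R] : MvPolynomial (Fin 2)
    R ≃ₐ[R] MvPolynomial (Fin 2) R :=
  MvPolynomial.renameEquiv R (Equiv.swap 0 1)

theorem maxCoeff_swapVars (F : MvPolynomial (Fin 2) ℤ) : maxCoeff (swapVars F) = maxCoeff F := by
  have hinj : Function.Injective (Equiv.swap (0 : Fin 2) 1) := Equiv.injective _
  rw [maxCoeff, maxCoeff, swapVars, MvPolynomial.renameEquiv_apply,
    MvPolynomial.support_rename_of_injective hinj, Finset.sup_image]
  refine Finset.sup_congr rfl fun m _ => ?_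
  simp only [Function.comp_apply]
  rw [MvPolynomial.coeff_rename_mapDomain _ hinj]

theorem hasNoRepeatedFactor_swapVars (h : HasNoRepeatedFactor F) :
    HasNoRepeatedFactor (swapVars F) := by
  have e : MvPolynomial.map (Int.castRingHom ℚ) (swapVars F) =
      swapVars (MvPolynomial.map (Int.castRingHom ℚ) F) := by
    simp [swapVars, MvPolynomial.map_rename]
  rw [HasNoRepeatedFactor, e]
  intro g hg
  have h1 := map_dvd (swapVars (R := ℚ)).symm hg
  rw [map_mul, AlgEquiv.symm_apply_apply] at h1
  have h2 := (h _ h1).map (swapVars (R := ℚ))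
  rwa [AlgEquiv.apply_symm_apply] at h2

theorem nonzeroSquareCount_swapVars (F : MvPolynomial (Fin 2) ℤ) (U V : ℝ) :
    nonzeroSquareCount (swapVars F) V U = nonzeroSquareCount F U V := by
  have heval : ∀ x y : ℤ, MvPolynomial.eval ![y, x] (swapVars F) = MvPolynomial.eval ![x, y] F := by
    intro x y
    rw [swapVars, MvPolynomial.renameEquiv_apply, MvPolynomial.eval_rename]
    congr 2
    funext i
    fin_cases i <;> rfl
  have himage : nonzeroSquarePoints (swapVars F) V U = Prod.swap '' nonzeroSquarePoints F U V := by
    ext ⟨y, x⟩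
    constructor
    · rintro ⟨h1, h2, h3, h4⟩
      refine ⟨(x, y), ⟨h2, h1, ?_, ?_⟩, rfl⟩
      · rw [← heval]; exact h3
      · rw [← heval]; exact h4
    · rintro ⟨⟨a, b⟩, ⟨h1, h2, h3, h4⟩, h⟩
      obtain ⟨rfl, rfl⟩ := Prod.mk.inj h
      refine ⟨h2, h1, ?_, ?_⟩
      · change MvPolynomial.eval ![b, a] _ ≠ 0
        rw [heval]; exact h3
      · change IsSquare (MvPolynomial.eval ![b, a] _)
        rw [heval]; exact h4
  rw [nonzeroSquareCount, himage, Set.ncard_image_of_injective _ Prod.swap_injective,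
    nonzeroSquareCount]

theorem exists_nonzeroSquareCount_le (D : ℕ) (hD : 3 ≤ D) (hodd : Odd D) : ∃ C : ℝ, 0 < C ∧
    ∀ F : MvPolynomial (Fin 2) ℤ, F ≠ 0 → F.IsHomogeneous D → HasNoRepeatedFactor F →
      ∀ U V : ℝ, 1 ≤ U → 1 ≤ V → (nonzeroSquareCount F U V : ℝ) ≤
        C * ((U * V) ^ (2 / 3 : ℝ) * Real.log (2 * (maxCoeff F : ℝ)) ^ 2) := by
  obtain ⟨B, hB, h⟩ := exists_card_le_log_sq D hodd hD
  have hle : ∀ F : MvPolynomial (Fin 2) ℤ, F ≠ 0 → F.IsHomogeneous D → HasNoRepeatedFactor F →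
      ∀ U V : ℝ, 1 ≤ V → V ≤ U → (nonzeroSquareCount F U V : ℝ) ≤
        B * ((U * V) ^ (2 / 3 : ℝ) * Real.log (2 * (maxCoeff F : ℝ)) ^ 2) := by
    intro F hF0 hF hsq U V hV hVU
    rw [nonzeroSquareCount_eq]
    refine h (dehomogenize F) (maxCoeff F) _ U V (le_natDegree_dehomogenize (by omega) hF hsq)
      (natDegree_dehomogenize_le hF) (one_le_maxCoeff hF0) (natAbs_coeff_dehomogenize_le hF)
      (squarefree_dehomogenize hF hsq) hV hVU (fun z hz => ?_) (fun z hz => ?_) fun z hz => ?_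
    · have := ((Set.Finite.mem_toFinset _).1 hz).1
      exact abs_le.2 this
    · have := ((Set.Finite.mem_toFinset _).1 hz).2.1
      exact abs_le.2 this
    · rw [formEval_dehomogenize hF]
      exact ((Set.Finite.mem_toFinset _).1 hz).2.2
  refine ⟨B, hB, fun F hF0 hF hsq U V hU hV => ?_⟩
  rcases le_total V U with hVU | hUV
  · exact hle F hF0 hF hsq U V hV hVU
  · have h1 := hle (swapVars F) ((map_ne_zero_iff _ (AlgEquiv.injective _)).2 hF0)
      (hF.rename_isHomogeneous) (hasNoRepeatedFactor_swapVars hsq) V U hU hUV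
    rwa [nonzeroSquareCount_swapVars, maxCoeff_swapVars, mul_comm V U] at h1

end BinaryForms

theorem lemma2 (D : ℕ) (hD : 3 ≤ D) (hodd : Odd D) :
    (∃ C : ℝ, 0 < C ∧ ∀ F : MvPolynomial (Fin 2) ℤ, F ≠ 0 → F.IsHomogeneous D →
      HasNoRepeatedFactor F → ∀ U V : ℝ, 1 ≤ U → 1 ≤ V →
        (nonzeroSquareCount F U V : ℝ) ≤
          C * ((U * V) ^ (2 / 3 : ℝ) * Real.log (2 * (maxCoeff F : ℝ)) ^ 2 + U + V)) ∧
    (∃ C : ℝ, 0 < C ∧ ∀ F : MvPolynomial (Fin 2) ℤ, F ≠ 0 → F.IsHomogeneous D →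
      HasNoRepeatedFactor F → ∀ U V : ℝ, 1 ≤ U → 1 ≤ V →
        (nonzeroSquareCount F U V : ℝ) ≤
          C * ((U * V) ^ (2 / 3 : ℝ) * Real.log (2 * (maxCoeff F : ℝ)) ^ 2)) := by
  have h := exists_nonzeroSquareCount_le D hD hodd
  refine ⟨?_, h⟩
  obtain ⟨C, hC, h⟩ := h
  refine ⟨C, hC, fun F hF0 hF hsq U V hU hV => (h F hF0 hF hsq U V hU hV).trans ?_⟩
  gcongr
  linarith
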